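/- Let $n\ge 1$, $C>0$, $0\le\alpha<\tfrac12$ and $p=\frac{4-2\alpha}{3}$. Then there is $\lambda_0=\lambda_0(C,n,\alpha)\in\mathbb R$ with the following property. Let $V\in L^\infty(\mathbb R\times\mathbb R^n;\mathbb C)$ and $W\in L^\infty(\mathbb R\times\mathbb R^n;\mathbb C\times\mathbb C^n)$ satisfy, for almost every $(t,x)\in\mathbb R\times\mathbb R^n$, $$|V(t,x)|\le \frac{C}{(1+|x|^2)^{\alpha/2}},\qquad |W(t,x)|\le\frac{C}{(1+|x|^2)^{(1+\alpha)/6}},$$ where $|\cdot|$ is the Euclidean norm. Let $u:\mathbb R\times\mathbb R^n\to\mathbb C$ belong to $C^1(\mathbb R;H^1(\mathbb R^n))\cap H^2_{loc}(\mathbb R\times\mathbb R^n)$ and satisfy $$\left|(\partial_t^2+\Delta)u\right|\le |Vu|+\left|W\cdot(\partial_t,\nabla)u\right|\qquad\text{a.e. in }\mathbb R\times\mathbb R^n,$$ where $\Delta$ and $\nabla$ act in $x$, the derivatives are weak derivatives, and $W\cdot(\partial_t,\nabla)u=W_0\,\partial_tu+\sum_{i=1}^nW_i\,\partial_{x_i}u$.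 If $$\sup_{t\in\mathbb R}\int_{\mathbb R^n}e^{4\lambda|x|^p}|u(t,x)|^2\,dx<\infty$$ for some $\lambda>\lambda_0$, then $u\equiv 0$, that is, for every $t\in\mathbb R$ one has $u(t,x)=0$ for almost every $x\in\mathbb R^n$. -/

import Mathlib

open MeasureTheory
open scoped ENNReal ContDiff

noncomputable section

section Weak

variable {F : Type*} [NormedAddCommGroup F] [NormedSpace ℝ F] [MeasureSpace F]

/-- `g` is the weak (distributional) derivative of `f` in the direction `e`; both functions are
locally integrable. -/
structure IsWeakDeriv (e : F) (f g : F → ℂ) : Prop where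
  locallyIntegrable : LocallyIntegrable f
  locallyIntegrable_deriv : LocallyIntegrable g
  integral_eq : ∀ φ : F → ℝ, ContDiff ℝ ∞ φ → HasCompactSupport φ →
    ∫ x, fderiv ℝ φ x e • f x = -∫ x, φ x • g x

open Classical in
/-- The weak derivative of `f` in the direction `e` (unique up to null sets when it exists;
the value is `0` if there is none). -/
def weakDeriv (e : F) (f : F → ℂ) : F → ℂ :=
  if h : ∃ g, IsWeakDeriv e f g then h.choose else 0

/-- The space `L²_loc`. -/
def MemL2Loc (f : F → ℂ) : Prop :=
  ∀ K : Set F, IsCompact K → MemLp f 2 (volume.restrict K)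

/-- The space `H^k_loc`: all weak derivatives of order at most `k` exist and lie in `L²_loc`. -/
def MemHLoc : ℕ → (F → ℂ) → Prop
  | 0, f => MemL2Loc f
  | k + 1, f => MemL2Loc f ∧ ∀ e : F, ∃ g, IsWeakDeriv e f g ∧ MemHLoc k g

end Weak

/-- The space `ℝⁿ` with its Euclidean norm. -/
abbrev Space (n : ℕ) : Type := EuclideanSpace ℝ (Fin n)

/-- Space-time `ℝ × ℝⁿ`, with Lebesgue measure. -/
abbrev SpaceTime (n : ℕ) : Type := ℝ × Space n

/-- The space `L²(ℝⁿ; ℂ)`. -/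
abbrev L2 (n : ℕ) : Type := Lp ℂ 2 (volume : Measure (Space n))

theorem L2.locallyIntegrable {n : ℕ} (f : L2 n) : LocallyIntegrable (f : Space n → ℂ) :=
  (Lp.memLp f).locallyIntegrable (by norm_num)

theorem L2.integrable_smul {n : ℕ} (f : L2 n) {φ : Space n → ℝ} (hφ : Continuous φ)
    (hc : HasCompactSupport φ) : Integrable (fun x => φ x • f x) :=
  (L2.locallyIntegrable f).integrable_smul_left_of_hasCompactSupport hφ hc

theorem continuous_fderiv_test {n : ℕ} {φ : Space n → ℝ} (hφ : ContDiff ℝ ∞ φ) (e : Space n) :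
    Continuous (fun x => fderiv ℝ φ x e) :=
  (hφ.continuous_fderiv (by simp)).clm_apply continuous_const

/-- The Sobolev space `H¹(ℝⁿ; ℂ)`, realised as the space of pairs `(f, ∇f)`, with the norm
`(‖f‖² + ‖∇f‖²)^(1/2)` (the norms on the right being those of `L²`). -/
def H1 (n : ℕ) : Submodule ℂ (WithLp 2 (L2 n × PiLp 2 (fun _ : Fin n => L2 n))) where
  carrier := {p | ∀ i : Fin n, IsWeakDeriv (EuclideanSpace.single i (1 : ℝ)) p.fst (p.snd i)}
  zero_mem' := fun i => by
    refine ⟨L2.locallyIntegrable _, L2.locallyIntegrable _, fun φ _ _ => ?_⟩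
    have h0 : ((0 : L2 n) : Space n → ℂ) =ᵐ[volume] 0 := Lp.coeFn_zero _ _ _
    rw [integral_eq_zero_of_ae, integral_eq_zero_of_ae, neg_zero]
    · filter_upwards [h0] with x hx
      exact (congrArg _ hx).trans (smul_zero _)
    · filter_upwards [h0] with x hx
      exact (congrArg _ hx).trans (smul_zero _)
  add_mem' := fun {p q} hp hq i => by
    refine ⟨L2.locallyIntegrable _, L2.locallyIntegrable _, fun φ hφ hc => ?_⟩
    have hd := continuous_fderiv_test hφ (EuclideanSpace.single i (1 : ℝ))
    have hdc : HasCompactSupport (fun x => fderiv ℝ φ x (EuclideanSpace.single i (1 : ℝ))) :=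
      hc.fderiv_apply ℝ _
    have h1 := Lp.coeFn_add p.fst q.fst
    have h2 := Lp.coeFn_add (p.snd i) (q.snd i)
    have e1 : ∫ x, fderiv ℝ φ x (EuclideanSpace.single i (1 : ℝ)) • (p + q).fst x =
        ∫ x, (fderiv ℝ φ x (EuclideanSpace.single i (1 : ℝ)) • p.fst x +
          fderiv ℝ φ x (EuclideanSpace.single i (1 : ℝ)) • q.fst x) := by
      refine integral_congr_ae ?_
      filter_upwards [h1] with x hx
      rw [← smul_add]
      exact congrArg _ hx
    have e2 : ∫ x, φ x • (p + q).snd i x = ∫ x, (φ x • p.snd i x + φ x • q.snd i x) := by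
      refine integral_congr_ae ?_
      filter_upwards [h2] with x hx
      rw [← smul_add]
      exact congrArg _ hx
    rw [e1, e2, integral_add (L2.integrable_smul _ hd hdc) (L2.integrable_smul _ hd hdc),
      integral_add (L2.integrable_smul _ hφ.continuous hc) (L2.integrable_smul _ hφ.continuous hc),
      (hp i).integral_eq φ hφ hc, (hq i).integral_eq φ hφ hc, neg_add]
  smul_mem' := fun c p hp i => by
    refine ⟨L2.locallyIntegrable _, L2.locallyIntegrable _, fun φ hφ hc => ?_⟩
    have h1 := Lp.coeFn_smul c p.fst
    have h2 := Lp.coeFn_smul c (p.snd i)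
    have e1 : ∫ x, fderiv ℝ φ x (EuclideanSpace.single i (1 : ℝ)) • (c • p).fst x =
        ∫ x, c • (fderiv ℝ φ x (EuclideanSpace.single i (1 : ℝ)) • p.fst x) := by
      refine integral_congr_ae ?_
      filter_upwards [h1] with x hx
      rw [smul_comm]
      exact congrArg _ hx
    have e2 : ∫ x, φ x • (c • p).snd i x = ∫ x, c • (φ x • p.snd i x) := by
      refine integral_congr_ae ?_
      filter_upwards [h2] with x hx
      rw [smul_comm]
      exact congrArg _ hx
    rw [e1, e2, integral_smul, integral_smul, (hp i).integral_eq φ hφ hc, smul_neg]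

/-- The space `C¹(ℝ; H¹(ℝⁿ))`: the slices of `u` form a continuously differentiable curve
in `H¹(ℝⁿ)`. -/
def MemC1H1 {n : ℕ} (u : SpaceTime n → ℂ) : Prop :=
  ∃ v : ℝ → H1 n, ContDiff ℝ 1 v ∧ ∀ t, ∀ᵐ x : Space n, u (t, x) = (v t).1.fst x

/-- The weak derivative `∂_t u`. -/
def weakDt {n : ℕ} (u : SpaceTime n → ℂ) : SpaceTime n → ℂ :=
  weakDeriv ((1 : ℝ), (0 : Space n)) u

/-- The weak derivative `∂_{x_i} u`. -/
def weakDx {n : ℕ} (i : Fin n) (u : SpaceTime n → ℂ) : SpaceTime n → ℂ :=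
  weakDeriv ((0 : ℝ), EuclideanSpace.single i (1 : ℝ)) u

/-- The weak form of `(∂_t² + Δ) u`, with `Δ` the Laplacian in `x`. -/
def weakSpaceTimeLaplacian {n : ℕ} (u : SpaceTime n → ℂ) (z : SpaceTime n) : ℂ :=
  weakDt (weakDt u) z + ∑ i, weakDx i (weakDx i u) z

/-- The values `ℂ × ℂⁿ` of the first-order coefficient, with the Euclidean norm. -/
abbrev CVec (n : ℕ) : Type := WithLp 2 (ℂ × EuclideanSpace ℂ (Fin n))

/-- The first-order term `W · (∂_t, ∇) u` (bilinear product, no conjugation). -/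
def firstOrderTerm {n : ℕ} (W : SpaceTime n → CVec n) (u : SpaceTime n → ℂ)
    (z : SpaceTime n) : ℂ :=
  (W z).fst * weakDt u z + ∑ i, (W z).snd i * weakDx i u z

end

/-! The proof is a Carleman estimate at scale `R`, followed by `R → ∞`. Put `m = p / 2 = (2 - α) /
3`, so `1/2 < m ≤ 2/3`, and fix one space coordinate `s = x_i`. The weight is `φ = K s + M (1 +
s²)^m - N t²` with `M` large depending on `C` and `α`, `K` of size `M R^(2m-1)` and `N` a small
multiple of `M R^(2m-2)`. The linear term keeps `∂_s φ` comparable to `K` on the whole region. The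
middle term makes `φ` convex in `s`, with `b₂ = ∂_s² φ ≥ M γ (1 + s²)^(m-1)`, where `γ = 2m(2m-1) >
0` because `α < 1/2`. The concave term makes `φ` very negative for `|t| ~ R`, which is needed
because `u` does not decay in time; `N` is small enough that `8 N ≤ b₂`.

Conjugation by `e^φ` and integration by parts give `IsSeparatedWeight.carleman`: `∫ e^(2φ) b₂ (|∇v|²
+ K² v²) ≤ 44 ∫ e^(2φ) |(∂_t² + Δ) v|²`. It extends by mollification to a cutoff times `u`. The
exponents match: `|W|²` decays like `(1 + s²)^(m-1)`, as `b₂` does, and `|V|²` like `(1 +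
s²)^(3m-2)`, which for `|s| ≤ 2R` is at most a constant times `b₂ K²`. Hence for large `M` the right
side of the differential inequality is absorbed (`IsSeparatedWeight.absorb`). The cutoff errors
remain; they live in `R/2 ≤ ‖z‖ ≤ 4R`. A Caccioppoli inequality removes the gradient of `u` from
them at the price of a factor `K²`, which cancels the `K²` on the left
(`IsSeparatedWeight.weighted_bound`).

In the error region either `|t| ≥ R/2`, where `-N t²` wins, or `|x| ≥ R/2`, where the assumed decay
of `u` beats the weight once `λ` exceeds a threshold (`weight_le_of_far`). So the error is `O(R
exp(-b R^(2m)))`. On a fixed ball the weight loses only a factor `exp(-c R^(2m-1))`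
(`near_weight_lower_bound`). As `R → ∞` the mass of `u` on every ball is zero, and continuity of `t
↦ u(t, ·)` in `L²` gives vanishing at every time. -/

open Filter Topology Convolution

set_option linter.unusedSectionVars false

noncomputable section


/-! ### Weak derivatives, mollification and local `L²` convergence -/

section Mollification

variable {F : Type*} [NormedAddCommGroup F] [NormedSpace ℝ F] [MeasureSpace F] [BorelSpace F]
  [FiniteDimensional ℝ F]

theorem IsWeakDeriv.ae_unique {e : F} {f g h : F → ℂ} (hg : IsWeakDeriv e f g)
    (hh : IsWeakDeriv e f h) : g =ᵐ[volume] h := by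
  refine ae_eq_of_integral_contDiff_smul_eq hg.locallyIntegrable_deriv
    hh.locallyIntegrable_deriv fun φ hφ hc => ?_
  have h1 := hg.integral_eq φ hφ hc
  rw [hh.integral_eq φ hφ hc] at h1
  exact (neg_injective h1).symm

theorem IsWeakDeriv.weakDeriv {e : F} {f g : F → ℂ} (h : IsWeakDeriv e f g) :
    IsWeakDeriv e f (weakDeriv e f) := by
  have hex : ∃ g, IsWeakDeriv e f g := ⟨g, h⟩
  rw [_root_.weakDeriv, dif_pos hex]
  exact hex.choose_spec

theorem LocallyIntegrable.congr_ae {f g : F → ℂ} (hf : LocallyIntegrable f) (h : f =ᵐ[volume] g) :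
    LocallyIntegrable g := fun x => by
  obtain ⟨s, hs, hi⟩ := hf x
  exact ⟨s, hs, hi.congr (ae_restrict_of_ae h)⟩

theorem IsWeakDeriv.congr_left {e : F} {f f' g : F → ℂ} (h : IsWeakDeriv e f g)
    (hf : f =ᵐ[volume] f') : IsWeakDeriv e f' g := by
  refine ⟨LocallyIntegrable.congr_ae h.locallyIntegrable hf, h.locallyIntegrable_deriv,
    fun φ hφ hc => ?_⟩
  rw [← h.integral_eq φ hφ hc]
  refine integral_congr_ae ?_
  filter_upwards [hf] with x hx
  rw [hx]

theorem MemL2Loc.congr_ae {f g : F → ℂ} (hf : MemL2Loc f) (h : f =ᵐ[volume] g) : MemL2Loc g :=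
  fun K hK => (memLp_congr_ae (ae_restrict_of_ae h)).1 (hf K hK)

theorem MemHLoc.congr_ae {k : ℕ} {f g : F → ℂ} (hf : MemHLoc k f) (h : f =ᵐ[volume] g) :
    MemHLoc k g := by
  cases k with
  | zero => exact MemL2Loc.congr_ae hf h
  | succ k =>
    refine ⟨hf.1.congr_ae h, fun e => ?_⟩
    obtain ⟨d, hd, hk⟩ := hf.2 e
    exact ⟨d, hd.congr_left h, hk⟩

theorem MemHLoc.memL2Loc {k : ℕ} {f : F → ℂ} (hf : MemHLoc k f) : MemL2Loc f := by
  cases k with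
  | zero => exact hf
  | succ k => exact hf.1

theorem MemHLoc.isWeakDeriv {k : ℕ} {f : F → ℂ} (hf : MemHLoc (k + 1) f) (e : F) :
    IsWeakDeriv e f (weakDeriv e f) := by
  obtain ⟨d, hd, -⟩ := hf.2 e
  exact hd.weakDeriv

/-- The derivative selected by `weakDeriv` agrees almost everywhere with the witness that carries
the regularity. -/
theorem MemHLoc.weakDeriv {k : ℕ} {f : F → ℂ} (hf : MemHLoc (k + 1) f) (e : F) :
    MemHLoc k (weakDeriv e f) := by
  obtain ⟨d, hd, hk⟩ := hf.2 e
  exact hk.congr_ae (hd.ae_unique hd.weakDeriv)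

/-- A sequence of bump functions at the origin with supports shrinking to a point. -/
def shrinkingBump (F : Type*) [NormedAddCommGroup F] (k : ℕ) : ContDiffBump (0 : F) where
  rIn := 1 / (2 * ((k : ℝ) + 1))
  rOut := 1 / ((k : ℝ) + 1)
  rIn_pos := by positivity
  rIn_lt_rOut := by
    apply one_div_lt_one_div_of_lt (by positivity)
    have : (0 : ℝ) ≤ k := Nat.cast_nonneg k
    linarith

theorem shrinkingBump_rOut_le_one (k : ℕ) : (shrinkingBump F k).rOut ≤ 1 := by
  have : (0 : ℝ) ≤ k := Nat.cast_nonneg k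
  change 1 / ((k : ℝ) + 1) ≤ 1
  rw [div_le_one (by positivity)]
  linarith

theorem tendsto_shrinkingBump_rOut :
    Tendsto (fun k => (shrinkingBump F k).rOut) atTop (𝓝 0) :=
  tendsto_one_div_add_atTop_nhds_zero_nat

/-- The convolution of `f` with a normalised smooth bump function. -/
def mollify (k : ℕ) (f : F → ℂ) : F → ℂ :=
  ((shrinkingBump F k).normed volume) ⋆[ContinuousLinearMap.lsmul ℝ ℝ, volume] f

variable [(volume : Measure F).IsAddHaarMeasure]

theorem contDiff_mollify (k : ℕ) {f : F → ℂ} (hf : LocallyIntegrable f) :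
    ContDiff ℝ ∞ (mollify k f) :=
  (shrinkingBump F k).hasCompactSupport_normed.contDiff_convolution_left _
    (shrinkingBump F k).contDiff_normed hf

/-- The derivative falls on the kernel, and the reflected kernel `t ↦ ρ (z - t)` is an admissible
test function. The sign from the reflection cancels the sign from integration by parts. -/
theorem IsWeakDeriv.fderiv_mollify {e : F} {f g : F → ℂ} (h : IsWeakDeriv e f g) (k : ℕ) (z : F) :
    fderiv ℝ (mollify k f) z e = mollify k g z := by
  set ρ : F → ℝ := (shrinkingBump F k).normed volume with hρ
  have hρc : HasCompactSupport ρ := (shrinkingBump F k).hasCompactSupport_normed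
  have hρs : ContDiff ℝ ∞ ρ := (shrinkingBump F k).contDiff_normed
  have h1 := (hρc.hasFDerivAt_convolution_left (ContinuousLinearMap.lsmul ℝ ℝ : ℝ →L[ℝ] ℂ →L[ℝ] ℂ)
    (hρs.of_le (by simp)) h.locallyIntegrable z).fderiv
  have hex : ConvolutionExistsAt (fderiv ℝ ρ) f z
      ((ContinuousLinearMap.lsmul ℝ ℝ : ℝ →L[ℝ] ℂ →L[ℝ] ℂ).precompL F) volume :=
    (hρc.fderiv ℝ).convolutionExists_left _ (hρs.continuous_fderiv (by simp))
      h.locallyIntegrable z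
  rw [mollify, h1, convolution_eq_swap, ContinuousLinearMap.integral_apply hex.integrable_swap,
    mollify, convolution_eq_swap]
  have h2 := h.integral_eq (fun t => ρ (z - t)) (hρs.comp (contDiff_const.sub contDiff_id))
    (hρc.comp_homeomorph (Homeomorph.subLeft z))
  have h3 : ∀ t, fderiv ℝ (fun t => ρ (z - t)) t e = -fderiv ℝ ρ (z - t) e := fun t => by
    have hd := ((hρs.differentiable (by simp)).differentiableAt (x := z - t)).hasFDerivAt.comp t
      ((hasFDerivAt_const z t).sub (hasFDerivAt_id t))
    have h4 : HasFDerivAt (fun t => ρ (z - t)) _ t := hd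
    rw [h4.fderiv]
    simp
  simp_rw [h3, neg_smul, integral_neg, neg_inj] at h2
  exact h2

theorem mollify_congr_ae {f g : F → ℂ} (h : f =ᵐ[volume] g) (k : ℕ) :
    mollify k f = mollify k g := by
  funext x
  rw [mollify, mollify, convolution_eq_swap, convolution_eq_swap]
  refine integral_congr_ae ?_
  filter_upwards [h] with t ht
  rw [ht]

/-- All kernels are supported in the unit ball, so a locally square integrable function may be
truncated to a global `L²` function without changing its mollifications on a given ball. -/
theorem mollify_eqOn_closedBall {f : F → ℂ} {r : ℝ} {x : F} (hx : x ∈ Metric.closedBall (0 : F) r)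
    (k : ℕ) :
    mollify k ((Metric.closedBall (0 : F) (r + 1)).indicator f) x = mollify k f x := by
  rw [mollify, mollify, convolution_def, convolution_def]
  congr 1
  funext t
  by_cases ht : t ∈ Metric.closedBall (0 : F) 1
  · have : x - t ∈ Metric.closedBall (0 : F) (r + 1) := by
      simp only [mem_closedBall_zero_iff] at *
      exact (norm_sub_le _ _).trans (add_le_add hx ht)
    rw [Set.indicator_of_mem this]
  · have h0 : (shrinkingBump F k).normed volume t = 0 := by
      have hn : t ∉ Function.support ((shrinkingBump F k).normed (volume : Measure F)) := by
        rw [ContDiffBump.support_normed_eq]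
        intro hb
        exact ht (Metric.ball_subset_closedBall
          (Metric.ball_subset_ball (shrinkingBump_rOut_le_one k) hb))
      simpa using hn
    simp [h0]

/-- Jensen's inequality for the mollification error. -/
theorem enorm_mollify_sub_sq_le {f : F → ℂ} (hfm : StronglyMeasurable f)
    (hf : LocallyIntegrable f) (k : ℕ) (x : F) :
    ‖mollify k f x - f x‖ₑ ^ 2 ≤
      ∫⁻ t, ENNReal.ofReal ((shrinkingBump F k).normed volume t) * ‖f (x - t) - f x‖ₑ ^ 2 := by
  set b := shrinkingBump F k
  set ρ : F → ℝ := b.normed volume with hρ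
  have hρ0 : ∀ t, 0 ≤ ρ t := b.nonneg_normed
  have hρi : ∫ t, ρ t = 1 := b.integral_normed
  have hρm : Measurable ρ := b.continuous_normed.measurable
  have hint : Integrable ρ := b.integrable_normed
  -- The kernel has unit mass, so `ν` is a probability measure and Jensen's inequality becomes the
  -- comparison of its `L¹` and `L²` norms.
  let ν : Measure F := volume.withDensity fun t => ENNReal.ofReal (ρ t)
  have hν : IsProbabilityMeasure ν := ⟨by
    rw [withDensity_apply _ MeasurableSet.univ, Measure.restrict_univ,
      ← ofReal_integral_eq_lintegral_ofReal hint (ae_of_all _ hρ0), hρi, ENNReal.ofReal_one]⟩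
  have hgm : StronglyMeasurable fun t => f (x - t) - f x :=
    (hfm.comp_measurable (measurable_const.sub measurable_id)).sub stronglyMeasurable_const
  have hex : Integrable (fun t => ρ t • f (x - t)) :=
    (b.hasCompactSupport_normed.convolutionExists_left (ContinuousLinearMap.lsmul ℝ ℝ)
      b.continuous_normed hf x).integrable
  have e1 : mollify k f x - f x = ∫ t, ρ t • (f (x - t) - f x) := by
    simp_rw [smul_sub]
    rw [integral_sub hex (hint.smul_const _), integral_smul_const, hρi, one_smul]
    rfl
  have h1 : ‖mollify k f x - f x‖ₑ ≤ eLpNorm (fun t => f (x - t) - f x) 1 ν := by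
    rw [e1, eLpNorm_one_eq_lintegral_enorm,
      lintegral_withDensity_eq_lintegral_mul _ hρm.ennreal_ofReal hgm.enorm]
    refine (enorm_integral_le_lintegral_enorm _).trans (lintegral_mono fun t => ?_)
    rw [enorm_smul, Real.enorm_eq_ofReal (hρ0 t)]
    rfl
  have h2 := h1.trans (eLpNorm_le_eLpNorm_of_exponent_le (q := 2) (by norm_num)
    hgm.aestronglyMeasurable)
  calc ‖mollify k f x - f x‖ₑ ^ 2 ≤ eLpNorm (fun t => f (x - t) - f x) 2 ν ^ 2 := by gcongr
    _ = _ := by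
      have := eLpNorm_nnreal_pow_eq_lintegral (f := fun t => f (x - t) - f x) (μ := ν) (p := 2)
        (by norm_num)
      simp only [NNReal.coe_ofNat, ENNReal.rpow_ofNat, ENNReal.coe_ofNat] at this
      rw [this, lintegral_withDensity_eq_lintegral_mul _ hρm.ennreal_ofReal
        (hgm.enorm.pow_const 2)]
      rfl

theorem tendsto_eLpNorm_translate {f : F → ℂ} (hf : MemLp f 2 volume) :
    Tendsto (fun t : F => eLpNorm (fun x => f (x - t) - f x) 2 volume) (𝓝 0) (𝓝 0) := by
  have : Fact ((1 : ℝ≥0∞) ≤ 2) := ⟨by norm_num⟩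
  let g : F → C(F, F) := fun t => ⟨fun x => x - t, by fun_prop⟩
  have hg : Continuous g :=
    ContinuousMap.continuous_of_continuous_uncurry _ (by
      change Continuous fun q : F × F => q.2 - q.1
      fun_prop)
  have hmp : ∀ t, MeasurePreserving (g t) (volume : Measure F) volume := fun t =>
    measurePreserving_sub_right _ t
  have h1 := (continuous_const (y := hf.toLp f)).compMeasurePreservingLp hg hmp
    (by norm_num : (2 : ℝ≥0∞) ≠ ⊤)
  have h2 := h1.tendsto 0
  rw [Lp.tendsto_Lp_iff_tendsto_eLpNorm'] at h2
  refine h2.congr fun t => eLpNorm_congr_ae ?_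
  have e0 := hf.coeFn_toLp
  have ea := Lp.coeFn_compMeasurePreserving (hf.toLp f) (hmp t)
  have eb := Lp.coeFn_compMeasurePreserving (hf.toLp f) (hmp 0)
  have ec := (hmp t).quasiMeasurePreserving.ae_eq e0
  filter_upwards [e0, ea, eb, ec] with x h0 ha hb hc
  simp only [Pi.sub_apply] at *
  rw [ha, hb]
  simp only [Function.comp_apply] at *
  rw [hc]
  simp [g, h0]

/-- By Jensen and Tonelli the squared error is at most an average of squared translation errors over
shifts in the support of the kernel, and translation is continuous in `L²`. -/
theorem tendsto_eLpNorm_mollify_sub_of_memLp {f : F → ℂ} (hf : MemLp f 2 volume) :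
    Tendsto (fun k => eLpNorm (mollify k f - f) 2 volume) atTop (𝓝 0) := by
  obtain ⟨f', hf'm, hff'⟩ : ∃ f', StronglyMeasurable f' ∧ f =ᵐ[volume] f' := hf.1
  have key : ∀ k, eLpNorm (mollify k f - f) 2 volume = eLpNorm (mollify k f' - f') 2 volume :=
    fun k => by
      rw [mollify_congr_ae hff' k]
      refine eLpNorm_congr_ae ?_
      filter_upwards [hff'] with x hx
      simp [hx]
  simp_rw [key]
  have hf' : MemLp f' 2 volume := (memLp_congr_ae hff').1 hf
  have hloc : LocallyIntegrable f' := hf'.locallyIntegrable (by norm_num)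
  rw [ENNReal.tendsto_nhds_zero]
  intro ε hε
  have h1 := (ENNReal.tendsto_nhds_zero.1 (tendsto_eLpNorm_translate hf')) ε hε
  obtain ⟨δ, hδ, hball⟩ := Metric.eventually_nhds_iff_ball.1 h1
  filter_upwards [tendsto_shrinkingBump_rOut (F := F) |>.eventually (gt_mem_nhds hδ)] with k hk
  set b := shrinkingBump F k
  set ρ : F → ℝ := b.normed volume with hρ
  have sq : ∀ g : F → ℂ, eLpNorm g 2 volume ^ 2 = ∫⁻ x, ‖g x‖ₑ ^ 2 := fun g => by
    have := eLpNorm_nnreal_pow_eq_lintegral (f := g) (μ := (volume : Measure F)) (p := 2)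
      (by norm_num)
    simpa only [NNReal.coe_ofNat, ENNReal.rpow_ofNat, ENNReal.coe_ofNat] using this
  have hρm : Measurable fun t => ENNReal.ofReal (ρ t) :=
    b.continuous_normed.measurable.ennreal_ofReal
  have h3 : eLpNorm (mollify k f' - f') 2 volume ^ 2 ≤ ε ^ 2 := by
    rw [sq]
    calc ∫⁻ x, ‖(mollify k f' - f') x‖ₑ ^ 2
        ≤ ∫⁻ x, ∫⁻ t, ENNReal.ofReal (ρ t) * ‖f' (x - t) - f' x‖ₑ ^ 2 :=
          lintegral_mono fun x => enorm_mollify_sub_sq_le hf'm hloc k x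
      _ = ∫⁻ t, ∫⁻ x, ENNReal.ofReal (ρ t) * ‖f' (x - t) - f' x‖ₑ ^ 2 := by
          refine lintegral_lintegral_swap (Measurable.aemeasurable ?_)
          have m1 : Measurable fun q : F × F => f' (q.1 - q.2) - f' q.1 :=
            (hf'm.measurable.comp (measurable_fst.sub measurable_snd)).sub
              (hf'm.measurable.comp measurable_fst)
          exact (hρm.comp measurable_snd).mul (m1.enorm.pow_const 2)
      _ ≤ ∫⁻ t, ENNReal.ofReal (ρ t) * ε ^ 2 := by
          refine lintegral_mono fun t => ?_
          have m2 : Measurable fun x : F => f' (x - t) - f' x :=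
            (hf'm.measurable.comp (measurable_id.sub measurable_const)).sub hf'm.measurable
          rw [lintegral_const_mul _ (m2.enorm.pow_const 2), ← sq fun x => f' (x - t) - f' x]
          by_cases ht : t ∈ Metric.ball (0 : F) δ
          · gcongr
            exact hball t ht
          · have : ρ t = 0 := by
              have hn : t ∉ Function.support (b.normed (volume : Measure F)) := by
                rw [ContDiffBump.support_normed_eq]
                exact fun hb => ht (Metric.ball_subset_ball hk.le hb)
              simpa using hn
            simp [this]
      _ = ε ^ 2 := by
          rw [lintegral_mul_const _ hρm, ← ofReal_integral_eq_lintegral_ofReal b.integrable_normed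
            (ae_of_all _ b.nonneg_normed), b.integral_normed]
          simp
  exact (ENNReal.pow_le_pow_left_iff two_ne_zero).1 h3

/-- Convergence in `L²` of a sequence of square integrable functions. -/
structure TendstoL2 (h : ℕ → F → ℂ) (g : F → ℂ) : Prop where
  memLp_seq : ∀ k, MemLp (h k) 2 volume
  memLp : MemLp g 2 volume
  tendsto : Tendsto (fun k => eLpNorm (h k - g) 2 volume) atTop (𝓝 0)

theorem TendstoL2.add {h h' : ℕ → F → ℂ} {g g' : F → ℂ} (H : TendstoL2 h g)
    (H' : TendstoL2 h' g') : TendstoL2 (fun k z => h k z + h' k z) (fun z => g z + g' z) := by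
  refine ⟨fun k => (H.memLp_seq k).add (H'.memLp_seq k), H.memLp.add H'.memLp, ?_⟩
  have h0 := H.tendsto.add H'.tendsto
  rw [add_zero] at h0
  refine tendsto_of_tendsto_of_tendsto_of_le_of_le tendsto_const_nhds h0 (fun _ => bot_le)
    fun k => ?_
  have e : (fun z => h k z + h' k z) - (fun z => g z + g' z) = (h k - g) + (h' k - g') := by
    funext z
    simp only [Pi.sub_apply, Pi.add_apply]
    ring
  change eLpNorm ((fun z => h k z + h' k z) - (fun z => g z + g' z)) 2 volume ≤ _
  rw [e]
  exact eLpNorm_add_le ((H.memLp_seq k).sub H.memLp).1 ((H'.memLp_seq k).sub H'.memLp).1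
    (by norm_num)

theorem TendstoL2.sum {ι : Type*} (s : Finset ι) {h : ι → ℕ → F → ℂ} {g : ι → F → ℂ}
    (H : ∀ i ∈ s, TendstoL2 (h i) (g i)) :
    TendstoL2 (fun k z => ∑ i ∈ s, h i k z) (fun z => ∑ i ∈ s, g i z) := by
  classical
  induction s using Finset.induction_on with
  | empty =>
    simp only [Finset.sum_empty]
    refine ⟨fun _ => MemLp.zero', MemLp.zero', ?_⟩
    simp
  | insert a s ha ih =>
    simp only [Finset.sum_insert ha]
    exact (H a (Finset.mem_insert_self a s)).add
      (ih fun i hi => H i (Finset.mem_insert_of_mem hi))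

theorem TendstoL2.tendsto_integral {h : ℕ → F → ℂ} {g : F → ℂ} (H : TendstoL2 h g) :
    Tendsto (fun k => ∫ z, ‖h k z‖ ^ 2) atTop (𝓝 (∫ z, ‖g z‖ ^ 2)) := by
  have : Fact ((1 : ℝ≥0∞) ≤ 2) := ⟨by norm_num⟩
  have h1 := (Lp.tendsto_Lp_iff_tendsto_eLpNorm'' h H.memLp_seq g H.memLp).2 H.tendsto
  have key : ∀ f : F → ℂ, ∀ hf : MemLp f 2 volume, ‖hf.toLp f‖ ^ 2 = ∫ z, ‖f z‖ ^ 2 := by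
    intro f hf
    rw [Lp.norm_toLp, hf.eLpNorm_eq_integral_rpow_norm (by norm_num) (by norm_num)]
    have hnn : 0 ≤ ∫ z, ‖f z‖ ^ 2 := integral_nonneg fun z => by positivity
    rw [ENNReal.toReal_ofReal (by positivity)]
    simp only [ENNReal.toReal_ofNat, Real.rpow_ofNat]
    rw [← one_div, ← Real.sqrt_eq_rpow]
    exact Real.sq_sqrt hnn
  have h2 := (h1.norm).pow 2
  simp_rw [key] at h2
  exact h2

theorem MemL2Loc.memLp_smul {f : F → ℂ} (hf : MemL2Loc f) {c : F → ℝ} (hc : Continuous c)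
    (hcs : HasCompactSupport c) : MemLp (fun z => c z • f z) 2 volume := by
  obtain ⟨B, hB⟩ := hcs.exists_bound_of_continuous hc
  have h1 : MemLp ((tsupport c).indicator f) 2 volume :=
    (memLp_indicator_iff_restrict (isClosed_tsupport c).measurableSet).2 (hf _ hcs)
  have h2 := MemLp.of_le_mul (f := fun z => c z • (tsupport c).indicator f z) (c := B) h1
    (hc.aestronglyMeasurable.smul h1.1) (ae_of_all _ fun z => by
      rw [norm_smul]
      exact mul_le_mul_of_nonneg_right (hB z) (norm_nonneg _))
  refine (memLp_congr_ae (ae_of_all _ fun z => ?_)).1 h2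
  by_cases hz : z ∈ tsupport c
  · simp [hz]
  · simp [image_eq_zero_of_notMem_tsupport hz]

/-- Every term of the integral inequalities below is a compactly supported continuous coefficient
times `u` or a derivative of `u`, so this is what lets them pass from mollified functions to `u`. -/
theorem MemL2Loc.tendstoL2_mollify {f : F → ℂ} (hf : MemL2Loc f) (hfl : LocallyIntegrable f)
    {c : F → ℝ} (hc : Continuous c) (hcs : HasCompactSupport c) :
    TendstoL2 (fun k z => c z • mollify k f z) (fun z => c z • f z) := by
  obtain ⟨B, hB⟩ := hcs.exists_bound_of_continuous hc
  obtain ⟨r, hr⟩ := (hcs : IsCompact (tsupport c)).isBounded.subset_closedBall (0 : F)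
  set f₁ := (Metric.closedBall (0 : F) (r + 1)).indicator f with hf₁
  have h1 : MemLp f₁ 2 volume :=
    (memLp_indicator_iff_restrict Metric.isClosed_closedBall.measurableSet).2
      (hf _ (isCompact_closedBall _ _))
  have hm : ∀ k, Continuous (mollify k f) := fun k => (contDiff_mollify k hfl).continuous
  have hB0 : 0 ≤ B := (norm_nonneg _).trans (hB 0)
  refine ⟨fun k => ?_, hf.memLp_smul hc hcs, ?_⟩
  · exact (hc.smul (hm k)).memLp_of_hasCompactSupport hcs.smul_right
  · have h2 := ENNReal.Tendsto.const_mul (a := ENNReal.ofReal B)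
      (tendsto_eLpNorm_mollify_sub_of_memLp h1) (Or.inr ENNReal.ofReal_ne_top)
    rw [mul_zero] at h2
    refine tendsto_of_tendsto_of_tendsto_of_le_of_le tendsto_const_nhds h2 (fun _ => bot_le)
      fun k => ?_
    refine eLpNorm_le_mul_eLpNorm_of_ae_le_mul (ae_of_all _ fun z => ?_) 2
    simp only [Pi.sub_apply]
    by_cases hz : z ∈ tsupport c
    · rw [← smul_sub, norm_smul, hf₁, mollify_eqOn_closedBall (hr hz),
        Set.indicator_of_mem (Metric.closedBall_subset_closedBall (by linarith) (hr hz))]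
      exact mul_le_mul_of_nonneg_right (hB z) (norm_nonneg _)
    · simp only [image_eq_zero_of_notMem_tsupport hz, zero_smul, sub_zero, norm_zero]
      positivity

end Mollification


/-! ### Calculus of directional derivatives -/

section DirDeriv

variable {F : Type*} [NormedAddCommGroup F] [NormedSpace ℝ F]

/-- The derivative of a real function in the direction `e`. -/
def dirDeriv (e : F) (f : F → ℝ) (z : F) : ℝ := fderiv ℝ f z e

theorem ContDiff.dirDeriv {f : F → ℝ} (hf : ContDiff ℝ ∞ f) (e : F) :
    ContDiff ℝ ∞ (dirDeriv e f) :=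
  (hf.fderiv_right (m := ∞) (by simp)).clm_apply contDiff_const

theorem HasCompactSupport.dirDeriv {f : F → ℝ} (hf : HasCompactSupport f) (e : F) :
    HasCompactSupport (dirDeriv e f) :=
  hf.fderiv_apply ℝ e

theorem tsupport_dirDeriv_subset (e : F) (f : F → ℝ) : tsupport (dirDeriv e f) ⊆ tsupport f :=
  tsupport_fderiv_apply_subset ℝ e

theorem dirDeriv_eq_zero_of_notMem {e : F} {f : F → ℝ} {z : F} (hz : z ∉ tsupport f) :
    dirDeriv e f z = 0 :=
  image_eq_zero_of_notMem_tsupport fun h => hz (tsupport_dirDeriv_subset e f h)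

theorem dirDeriv_mul {f g : F → ℝ} (hf : ContDiff ℝ ∞ f) (hg : ContDiff ℝ ∞ g) (e z : F) :
    dirDeriv e (fun z => f z * g z) z = dirDeriv e f z * g z + f z * dirDeriv e g z := by
  have h := ((hf.differentiable (by simp)).differentiableAt (x := z)).hasFDerivAt.mul
    ((hg.differentiable (by simp)).differentiableAt (x := z)).hasFDerivAt
  have h' : HasFDerivAt (fun z => f z * g z) _ z := h
  rw [dirDeriv, h'.fderiv]
  simp only [add_apply, smul_apply, smul_eq_mul, dirDeriv]
  ring

theorem dirDeriv_add {f g : F → ℝ} (hf : ContDiff ℝ ∞ f) (hg : ContDiff ℝ ∞ g) (e z : F) :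
    dirDeriv e (fun z => f z + g z) z = dirDeriv e f z + dirDeriv e g z := by
  have h := ((hf.differentiable (by simp)).differentiableAt (x := z)).hasFDerivAt.add
    ((hg.differentiable (by simp)).differentiableAt (x := z)).hasFDerivAt
  have h' : HasFDerivAt (fun z => f z + g z) _ z := h
  rw [dirDeriv, h'.fderiv]
  rfl

theorem dirDeriv_const (c : ℝ) (e z : F) : dirDeriv e (fun _ => c) z = 0 := by
  simp [dirDeriv]

theorem dirDeriv_exp {f : F → ℝ} (hf : ContDiff ℝ ∞ f) (e z : F) :
    dirDeriv e (fun z => Real.exp (f z)) z = Real.exp (f z) * dirDeriv e f z := by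
  have h := ((hf.differentiable (by simp)).differentiableAt (x := z)).hasFDerivAt.exp
  rw [dirDeriv, h.fderiv]
  rfl

theorem dirDeriv_comm {f : F → ℝ} (hf : ContDiff ℝ ∞ f) (d e z : F) :
    dirDeriv d (dirDeriv e f) z = dirDeriv e (dirDeriv d f) z := by
  have hsym : IsSymmSndFDerivAt ℝ f z :=
    (hf.contDiffAt (x := z)).isSymmSndFDerivAt (by
      rw [minSmoothness_of_isRCLikeNormedField]
      exact WithTop.coe_le_coe.2 le_top)
  have h1 : DifferentiableAt ℝ (fderiv ℝ f) z :=
    ((hf.fderiv_right (m := ∞) (by simp)).differentiable (by simp)).differentiableAt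
  have key : ∀ a b : F, dirDeriv a (dirDeriv b f) z = fderiv ℝ (fderiv ℝ f) z a b := fun a b => by
    have h2 : HasFDerivAt (dirDeriv b f) _ z := h1.hasFDerivAt.clm_apply (hasFDerivAt_const b z)
    rw [dirDeriv, h2.fderiv]
    simp
  rw [key, key]
  exact hsym d e

end DirDeriv

/-! ### Integration by parts as identities modulo divergences -/

section NullIntegral

variable {F : Type*} [NormedAddCommGroup F] [NormedSpace ℝ F] [MeasureSpace F] [BorelSpace F]
  [FiniteDimensional ℝ F] [(volume : Measure F).IsAddHaarMeasure]

/-- `h` is integrable with vanishing integral. -/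
def NullIntegral (h : F → ℝ) : Prop := Integrable h ∧ ∫ z, h z = 0

theorem NullIntegral.add {f g : F → ℝ} (hf : NullIntegral f) (hg : NullIntegral g) :
    NullIntegral fun z => f z + g z :=
  ⟨hf.1.add hg.1, by rw [integral_add hf.1 hg.1, hf.2, hg.2, add_zero]⟩

theorem NullIntegral.const_mul {f : F → ℝ} (hf : NullIntegral f) (c : ℝ) :
    NullIntegral fun z => c * f z :=
  ⟨hf.1.const_mul c, by rw [integral_const_mul, hf.2, mul_zero]⟩

theorem NullIntegral.sum {ι : Type*} (s : Finset ι) {f : ι → F → ℝ}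
    (hf : ∀ i ∈ s, NullIntegral (f i)) : NullIntegral fun z => ∑ i ∈ s, f i z :=
  ⟨integrable_finsetSum _ fun i hi => (hf i hi).1, by
    rw [integral_finsetSum _ fun i hi => (hf i hi).1]
    exact Finset.sum_eq_zero fun i hi => (hf i hi).2⟩

theorem NullIntegral.congr {f g : F → ℝ} (hf : NullIntegral f) (h : ∀ z, f z = g z) :
    NullIntegral g := (funext h : f = g) ▸ hf

theorem nullIntegral_dirDeriv {q : F → ℝ} (hq : ContDiff ℝ ∞ q) (hc : HasCompactSupport q)
    (e : F) : NullIntegral (dirDeriv e q) := by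
  have hi : Integrable (dirDeriv e q) :=
    (hq.dirDeriv e).continuous.integrable_of_hasCompactSupport (hc.dirDeriv e)
  refine ⟨hi, ?_⟩
  have h := integral_mul_fderiv_eq_neg_fderiv_mul_of_integrable (μ := (volume : Measure F))
    (f := fun _ : F => (1 : ℝ)) (g := q) (v := e) (by simp) (by simpa [dirDeriv] using! hi)
    (by simpa using hq.continuous.integrable_of_hasCompactSupport hc)
    (fun x _ => differentiableAt_const _)
    (fun x _ => (hq.differentiable (by simp)).differentiableAt)
  simpa [dirDeriv] using h

/-- The expression is the divergence `∂_e (c ∂_e f ∂_d f) - ½ ∂_d (c (∂_e f)²)`; the mixed second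
derivatives cancel. Summed over `e`, it is the Rellich identity for `c Δf ∂_d f`. -/
theorem nullIntegral_second_first {f : F → ℝ} (hf : ContDiff ℝ ∞ f)
    (hfc : HasCompactSupport f) {c : F → ℝ} (hc : ContDiff ℝ ∞ c) (e d : F) :
    NullIntegral fun z => c z * dirDeriv e (dirDeriv e f) z * dirDeriv d f z
      + dirDeriv e c z * dirDeriv e f z * dirDeriv d f z
      - 1 / 2 * dirDeriv d c z * dirDeriv e f z ^ 2 := by
  have he := hf.dirDeriv e
  have hd := hf.dirDeriv d
  have h1 := nullIntegral_dirDeriv (hc.mul (he.mul hd)) ((hfc.dirDeriv d).mul_left.mul_left) e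
  have h2 := nullIntegral_dirDeriv (hc.mul (he.mul he)) ((hfc.dirDeriv e).mul_left.mul_left) d
  refine (h1.add (h2.const_mul (-1 / 2))).congr fun z => ?_
  rw [dirDeriv_mul hc (he.mul hd), dirDeriv_mul hc (he.mul he), dirDeriv_mul he hd,
    dirDeriv_mul he he, dirDeriv_comm hf d e]
  ring

/-- The expression is the divergence `∂_e (c f ∂_e f) - ½ ∂_e (f² ∂_e c)`. -/
theorem nullIntegral_second_zero {f : F → ℝ} (hf : ContDiff ℝ ∞ f)
    (hfc : HasCompactSupport f) {c : F → ℝ} (hc : ContDiff ℝ ∞ c) (e : F) :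
    NullIntegral fun z => c z * dirDeriv e (dirDeriv e f) z * f z + c z * dirDeriv e f z ^ 2
      - 1 / 2 * dirDeriv e (dirDeriv e c) z * f z ^ 2 := by
  have he := hf.dirDeriv e
  have hce := hc.dirDeriv e
  have h1 := nullIntegral_dirDeriv (hc.mul (he.mul hf)) (hfc.mul_left.mul_left) e
  have h2 := nullIntegral_dirDeriv (hce.mul (hf.mul hf)) (hfc.mul_left.mul_left) e
  refine (h1.add (h2.const_mul (-1 / 2))).congr fun z => ?_
  rw [dirDeriv_mul hc (he.mul hf), dirDeriv_mul hce (hf.mul hf), dirDeriv_mul he hf,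
    dirDeriv_mul hf hf]
  ring

theorem nullIntegral_first_zero {f : F → ℝ} (hf : ContDiff ℝ ∞ f)
    (hfc : HasCompactSupport f) {c : F → ℝ} (hc : ContDiff ℝ ∞ c) (d : F) :
    NullIntegral fun z => c z * f z * dirDeriv d f z + 1 / 2 * dirDeriv d c z * f z ^ 2 := by
  have h2 := nullIntegral_dirDeriv (hc.mul (hf.mul hf)) (hfc.mul_left.mul_left) d
  refine (h2.const_mul (1 / 2)).congr fun z => ?_
  rw [dirDeriv_mul hc (hf.mul hf), dirDeriv_mul hf hf]
  ring

end NullIntegral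

/-! ### Carleman and Caccioppoli inequalities for real test functions -/

section Carleman

variable {F : Type*} [NormedAddCommGroup F] [NormedSpace ℝ F] {J : Type*} [DecidableEq J]

/-- `φ` is the sum of a quadratic function in the direction `j₀` with second derivative `-2 N` and
of a function in the direction `j₁` whose first four derivatives are `b₁, b₂, b₃, b₄`. -/
structure IsSeparatedWeight (E : J → F) (j₀ j₁ : J) (N : ℝ) (φ a₁ b₁ b₂ b₃ b₄ : F → ℝ) :
    Prop where
  ne : j₀ ≠ j₁
  contDiff : ContDiff ℝ ∞ φ
  contDiff_a₁ : ContDiff ℝ ∞ a₁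
  contDiff_b₁ : ContDiff ℝ ∞ b₁
  contDiff_b₂ : ContDiff ℝ ∞ b₂
  contDiff_b₃ : ContDiff ℝ ∞ b₃
  deriv : ∀ j z, dirDeriv (E j) φ z =
    (if j = j₀ then a₁ z else 0) + (if j = j₁ then b₁ z else 0)
  deriv_a₁ : ∀ j z, dirDeriv (E j) a₁ z = if j = j₀ then -2 * N else 0
  deriv_b₁ : ∀ j z, dirDeriv (E j) b₁ z = if j = j₁ then b₂ z else 0
  deriv_b₂ : ∀ j z, dirDeriv (E j) b₂ z = if j = j₁ then b₃ z else 0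
  deriv_b₃ : ∀ j z, dirDeriv (E j) b₃ z = if j = j₁ then b₄ z else 0

variable {E : J → F} {j₀ j₁ : J} {N : ℝ} {φ a₁ b₁ b₂ b₃ b₄ : F → ℝ}

theorem sum_ite_add_ite_mul [Fintype J] (j₀ j₁ : J) (a b : ℝ) (x : J → ℝ) :
    ∑ j, ((if j = j₀ then a else 0) + (if j = j₁ then b else 0)) * x j = a * x j₀ + b * x j₁ := by
  simp [add_mul, Finset.sum_add_distrib]

theorem IsSeparatedWeight.sum_deriv_sq [Fintype J]
    (h : IsSeparatedWeight E j₀ j₁ N φ a₁ b₁ b₂ b₃ b₄) (z : F) :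
    ∑ j, dirDeriv (E j) φ z ^ 2 = a₁ z ^ 2 + b₁ z ^ 2 := by
  simp_rw [sq (dirDeriv _ φ z), h.deriv]
  rw [sum_ite_add_ite_mul]
  simp [h.ne, h.ne.symm]
  ring

theorem IsSeparatedWeight.deriv_deriv (h : IsSeparatedWeight E j₀ j₁ N φ a₁ b₁ b₂ b₃ b₄) (j : J)
    (z : F) : dirDeriv (E j) (dirDeriv (E j) φ) z =
      (if j = j₀ then -2 * N else 0) + (if j = j₁ then b₂ z else 0) := by
  have e1 : dirDeriv (E j) φ = fun z => (fun z => (if j = j₀ then (1 : ℝ) else 0) * a₁ z) z +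
      (fun z => (if j = j₁ then (1 : ℝ) else 0) * b₁ z) z := by
    funext z
    rw [h.deriv]
    simp
  rw [e1, dirDeriv_add (contDiff_const.mul h.contDiff_a₁) (contDiff_const.mul h.contDiff_b₁),
    dirDeriv_mul contDiff_const h.contDiff_a₁, dirDeriv_mul contDiff_const h.contDiff_b₁,
    dirDeriv_const, dirDeriv_const, h.deriv_a₁, h.deriv_b₁]
  split_ifs <;> simp

theorem IsSeparatedWeight.dirDeriv_exp_mul (h : IsSeparatedWeight E j₀ j₁ N φ a₁ b₁ b₂ b₃ b₄)
    {v : F → ℝ} (hv : ContDiff ℝ ∞ v) (e z : F) :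
    dirDeriv e (fun z => Real.exp (φ z) * v z) z =
      Real.exp (φ z) * (dirDeriv e φ z * v z + dirDeriv e v z) := by
  rw [dirDeriv_mul h.contDiff.exp hv, dirDeriv_exp h.contDiff]
  ring

theorem IsSeparatedWeight.sum_deriv_deriv_exp_mul [Fintype J]
    (h : IsSeparatedWeight E j₀ j₁ N φ a₁ b₁ b₂ b₃ b₄) {v : F → ℝ} (hv : ContDiff ℝ ∞ v) (z : F) :
    ∑ j, dirDeriv (E j) (dirDeriv (E j) fun z => Real.exp (φ z) * v z) z =
      Real.exp (φ z) * ((a₁ z ^ 2 + b₁ z ^ 2) * v z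
        + 2 * (a₁ z * dirDeriv (E j₀) v z + b₁ z * dirDeriv (E j₁) v z)
        + (-2 * N + b₂ z) * v z + ∑ j, dirDeriv (E j) (dirDeriv (E j) v) z) := by
  have h1 : ∀ j, dirDeriv (E j) (dirDeriv (E j) fun z => Real.exp (φ z) * v z) z =
      Real.exp (φ z) * (dirDeriv (E j) φ z ^ 2 * v z
        + 2 * (dirDeriv (E j) φ z * dirDeriv (E j) v z)
        + dirDeriv (E j) (dirDeriv (E j) φ) z * v z + dirDeriv (E j) (dirDeriv (E j) v) z) := by
    intro j
    have hd := h.contDiff.dirDeriv (E j)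
    have hvd := hv.dirDeriv (E j)
    have e1 : dirDeriv (E j) (fun z => Real.exp (φ z) * v z) = fun z => Real.exp (φ z) *
        (fun z => (fun z => dirDeriv (E j) φ z * v z) z + dirDeriv (E j) v z) z :=
      funext fun z => h.dirDeriv_exp_mul hv _ z
    rw [e1, h.dirDeriv_exp_mul ((hd.mul hv).add hvd), dirDeriv_add (hd.mul hv) hvd,
      dirDeriv_mul hd hv]
    ring
  have h2 : ∑ j, dirDeriv (E j) φ z * dirDeriv (E j) v z =
      a₁ z * dirDeriv (E j₀) v z + b₁ z * dirDeriv (E j₁) v z := by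
    simp_rw [h.deriv]
    rw [sum_ite_add_ite_mul]
  have h3 : ∑ j, dirDeriv (E j) (dirDeriv (E j) φ) z = -2 * N + b₂ z := by
    simp_rw [h.deriv_deriv]
    simp [Finset.sum_add_distrib]
  simp_rw [h1, ← Finset.mul_sum, Finset.sum_add_distrib, ← Finset.mul_sum, ← Finset.sum_mul]
  rw [h2, h3, h.sum_deriv_sq]

variable [MeasureSpace F] [BorelSpace F] [FiniteDimensional ℝ F]
  [(volume : Measure F).IsAddHaarMeasure] [Fintype J]

/-- The two factors sum to `e^φ L (e^(-φ) f)`, with `L` the sum of the second derivatives along `E`.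
They are its symmetric and antisymmetric parts, except that `b₂ f` has been added to the first and
subtracted from the second. The exact commutator would control only the derivatives along `E j₀` and
`E j₁`; the shift produces the full gradient term `2 b₂ |∇f|²` and in exchange lowers the leading
zero-order coefficient from `4 b₁² b₂` to `2 b₁² b₂`. -/
theorem IsSeparatedWeight.nullIntegral_commutator
    (h : IsSeparatedWeight E j₀ j₁ N φ a₁ b₁ b₂ b₃ b₄)
    {f : F → ℝ} (hf : ContDiff ℝ ∞ f) (hfc : HasCompactSupport f) :
    NullIntegral fun z =>
      2 * (∑ j, dirDeriv (E j) (dirDeriv (E j) f) z + (a₁ z ^ 2 + b₁ z ^ 2 + b₂ z) * f z)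
        * (-2 * a₁ z * dirDeriv (E j₀) f z - 2 * b₁ z * dirDeriv (E j₁) f z
          - (2 * b₂ z - 2 * N) * f z)
      - (-8 * N * dirDeriv (E j₀) f z ^ 2 + 4 * b₂ z * dirDeriv (E j₁) f z ^ 2
        + 2 * b₂ z * ∑ j, dirDeriv (E j) f z ^ 2
        + (2 * b₁ z ^ 2 * b₂ z - 2 * a₁ z ^ 2 * b₂ z - 8 * N * a₁ z ^ 2 + 2 * b₁ z * b₃ z
          - 2 * b₂ z ^ 2 - 2 * b₄ z) * f z ^ 2) := by
  have ha := h.contDiff_a₁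
  have hb := h.contDiff_b₁
  have hb2 := h.contDiff_b₂
  have hG : ContDiff ℝ ∞ fun z => 2 * b₂ z + -2 * N :=
    (contDiff_const.mul hb2).add contDiff_const
  have hP : ContDiff ℝ ∞ fun z => (a₁ z * a₁ z + b₁ z * b₁ z) + b₂ z :=
    ((ha.mul ha).add (hb.mul hb)).add hb2
  have n1 := NullIntegral.sum (Finset.univ : Finset J) fun j _ =>
    nullIntegral_second_first hf hfc ha (E j) (E j₀)
  have n2 := NullIntegral.sum (Finset.univ : Finset J) fun j _ =>
    nullIntegral_second_first hf hfc hb (E j) (E j₁)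
  have n3 := NullIntegral.sum (Finset.univ : Finset J) fun j _ =>
    nullIntegral_second_zero hf hfc hG (E j)
  have n4 := nullIntegral_first_zero hf hfc (hP.mul ha) (E j₀)
  have n5 := nullIntegral_first_zero hf hfc (hP.mul hb) (E j₁)
  -- `n1`, `n2`, `n3` treat the second-order operator against the first-order and zero-order terms,
  -- `n4` and `n5` the potential against the first-order terms. The product of the two zero-order
  -- terms is left as it is.
  refine (((((n1.const_mul (-4)).add (n2.const_mul (-4))).add (n3.const_mul (-2))).add
    (n4.const_mul (-4))).add (n5.const_mul (-4))).congr fun z => ?_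
  have dG : ∀ j, dirDeriv (E j) (fun z => 2 * b₂ z + -2 * N) = fun z =>
      (if j = j₁ then (2 : ℝ) else 0) * b₃ z := fun j => by
    funext z
    rw [dirDeriv_add (contDiff_const.mul hb2) contDiff_const, dirDeriv_mul contDiff_const hb2,
      dirDeriv_const, dirDeriv_const, h.deriv_b₂]
    split_ifs <;> simp
  have ddG : ∀ j, dirDeriv (E j) (dirDeriv (E j) fun z => 2 * b₂ z + -2 * N) z =
      if j = j₁ then 2 * b₄ z else 0 := fun j => by
    rw [dG, dirDeriv_mul contDiff_const h.contDiff_b₃, dirDeriv_const, h.deriv_b₃]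
    split_ifs <;> simp
  have hne := h.ne
  have hne' := h.ne.symm
  have dP : ∀ j, dirDeriv (E j) (fun z => (a₁ z * a₁ z + b₁ z * b₁ z) + b₂ z) z =
      (if j = j₀ then -4 * N * a₁ z else 0) + (if j = j₁ then 2 * b₁ z * b₂ z + b₃ z else 0) :=
    fun j => by
    rw [dirDeriv_add ((ha.mul ha).add (hb.mul hb)) hb2,
      dirDeriv_add (ha.mul ha) (hb.mul hb), dirDeriv_mul ha ha, dirDeriv_mul hb hb,
      h.deriv_a₁, h.deriv_b₁, h.deriv_b₂]
    split_ifs <;> ring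
  have e1 : ∑ j, (a₁ z * dirDeriv (E j) (dirDeriv (E j) f) z * dirDeriv (E j₀) f z
      + dirDeriv (E j) a₁ z * dirDeriv (E j) f z * dirDeriv (E j₀) f z
      - 1 / 2 * dirDeriv (E j₀) a₁ z * dirDeriv (E j) f z ^ 2) =
      a₁ z * (∑ j, dirDeriv (E j) (dirDeriv (E j) f) z) * dirDeriv (E j₀) f z
        - 2 * N * dirDeriv (E j₀) f z ^ 2 + N * ∑ j, dirDeriv (E j) f z ^ 2 := by
    simp_rw [h.deriv_a₁]
    rw [Finset.sum_sub_distrib, Finset.sum_add_distrib, ← Finset.sum_mul, ← Finset.mul_sum,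
      ← Finset.mul_sum]
    simp
    ring
  have e2 : ∑ j, (b₁ z * dirDeriv (E j) (dirDeriv (E j) f) z * dirDeriv (E j₁) f z
      + dirDeriv (E j) b₁ z * dirDeriv (E j) f z * dirDeriv (E j₁) f z
      - 1 / 2 * dirDeriv (E j₁) b₁ z * dirDeriv (E j) f z ^ 2) =
      b₁ z * (∑ j, dirDeriv (E j) (dirDeriv (E j) f) z) * dirDeriv (E j₁) f z
        + b₂ z * dirDeriv (E j₁) f z ^ 2 - 1 / 2 * b₂ z * ∑ j, dirDeriv (E j) f z ^ 2 := by
    simp_rw [h.deriv_b₁]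
    rw [Finset.sum_sub_distrib, Finset.sum_add_distrib, ← Finset.sum_mul, ← Finset.mul_sum,
      ← Finset.mul_sum]
    simp
    ring
  have e3 : ∑ j, ((2 * b₂ z + -2 * N) * dirDeriv (E j) (dirDeriv (E j) f) z * f z
      + (2 * b₂ z + -2 * N) * dirDeriv (E j) f z ^ 2
      - 1 / 2 * dirDeriv (E j) (dirDeriv (E j) fun z => 2 * b₂ z + -2 * N) z * f z ^ 2) =
      (2 * b₂ z + -2 * N) * (∑ j, dirDeriv (E j) (dirDeriv (E j) f) z) * f z
        + (2 * b₂ z + -2 * N) * (∑ j, dirDeriv (E j) f z ^ 2) - b₄ z * f z ^ 2 := by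
    simp_rw [ddG]
    rw [Finset.sum_sub_distrib, Finset.sum_add_distrib, ← Finset.sum_mul, ← Finset.mul_sum,
      ← Finset.mul_sum]
    simp
  rw [e1, e2, e3]
  have d4 : dirDeriv (E j₀) (fun z => ((a₁ z * a₁ z + b₁ z * b₁ z) + b₂ z) * a₁ z) z =
      -4 * N * a₁ z * a₁ z + (a₁ z * a₁ z + b₁ z * b₁ z + b₂ z) * (-2 * N) := by
    have := dirDeriv_mul hP ha (E j₀) z
    rw [dP, h.deriv_a₁] at this
    simp only [hne, if_true, if_false, add_zero] at this
    exact this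
  have d5 : dirDeriv (E j₁) (fun z => ((a₁ z * a₁ z + b₁ z * b₁ z) + b₂ z) * b₁ z) z =
      (2 * b₁ z * b₂ z + b₃ z) * b₁ z + (a₁ z * a₁ z + b₁ z * b₁ z + b₂ z) * b₂ z := by
    have := dirDeriv_mul hP hb (E j₁) z
    rw [dP, h.deriv_b₁] at this
    simp only [hne', if_true, if_false, zero_add] at this
    exact this
  rw [d4, d5]
  ring

/-- The main term `2 b₁² b₂` is at least `b₂ K² / 2`. The two terms with `a²` cost at most `3/64` of
`b₂ K²`, and the terms with `b₃`, `b₄` and `b₂²` are of lower order in `K` and cost at most `1/5` of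
it. -/
theorem carleman_coefficient_lower_bound {K M N Γ a b₁ b₂ b₃ b₄ : ℝ} (hK : 1 ≤ K) (hN : 0 ≤ N)
    (hKΓ : 40 * Γ ≤ K) (hKM : 100 * M ≤ K ^ 2) (hb₁ : K / 2 ≤ b₁ ∧ b₁ ≤ 2 * K)
    (ha : |a| ≤ K / 8) (hb₂ : 8 * N ≤ b₂ ∧ b₂ ≤ 2 * M) (hb₃ : |b₃| ≤ Γ * b₂)
    (hb₄ : |b₄| ≤ Γ * b₂) :
    b₂ * (K ^ 2 / 4) ≤ 2 * b₁ ^ 2 * b₂ - 2 * a ^ 2 * b₂ - 8 * N * a ^ 2 + 2 * b₁ * b₃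
      - 2 * b₂ ^ 2 - 2 * b₄ := by
  obtain ⟨hb1l, hb1u⟩ := hb₁
  obtain ⟨hb2l, hb2u⟩ := hb₂
  have hb20 : 0 ≤ b₂ := by linarith
  have ha2 : a ^ 2 ≤ K ^ 2 / 64 := by
    have := sq_le_sq' (abs_le.1 ha).1 (abs_le.1 ha).2
    linarith [show (K / 8) ^ 2 = K ^ 2 / 64 by ring]
  have hb12l : K ^ 2 / 4 ≤ b₁ ^ 2 := by nlinarith
  have t1 : b₂ * (K ^ 2 / 4) ≤ b₂ * b₁ ^ 2 := mul_le_mul_of_nonneg_left hb12l hb20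
  have t2 : b₂ * a ^ 2 ≤ b₂ * (K ^ 2 / 64) := mul_le_mul_of_nonneg_left ha2 hb20
  have t3 : 8 * N * a ^ 2 ≤ b₂ * a ^ 2 := mul_le_mul_of_nonneg_right hb2l (sq_nonneg _)
  have t4 : -(2 * K * (Γ * b₂)) ≤ b₁ * b₃ := by
    have h1 : |b₁ * b₃| ≤ 2 * K * (Γ * b₂) := by
      rw [abs_mul]
      exact mul_le_mul (abs_le.2 ⟨by linarith, hb1u⟩) hb₃ (abs_nonneg _) (by linarith)
    exact (abs_le.1 h1).1
  have t5 : b₂ * b₂ ≤ b₂ * (2 * M) := mul_le_mul_of_nonneg_left hb2u hb20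
  have t6 := (abs_le.1 hb₄).2
  have t7 : b₂ * (4 * K * Γ + 4 * M + 2 * Γ) ≤ b₂ * (K ^ 2 / 5) := by
    refine mul_le_mul_of_nonneg_left ?_ hb20
    nlinarith
  have t8 : 0 ≤ b₂ * K ^ 2 := mul_nonneg hb20 (sq_nonneg K)
  linarith

/-- Since `8 N ≤ b₂`, half of `2 b₂ G` pays for the negative term in `D₀`. What remains contains `b₂
(G + K² f² / 4)`, while undoing the conjugation requires `b₂ (2 G + 10 K² f²)`; the factor `44`
covers both. -/
theorem carleman_quadratic_form_lower_bound {K N a b₁ b₂ Z G D₀ D₁ e V f v : ℝ} (hK : 1 ≤ K)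
    (hN : 0 ≤ N) (hb₁ : K / 2 ≤ b₁ ∧ b₁ ≤ 2 * K) (ha : |a| ≤ K / 8) (hb₂ : 8 * N ≤ b₂)
    (hV : e ^ 2 * V ≤ 2 * G + 2 * (a ^ 2 + b₁ ^ 2) * f ^ 2) (hG : D₀ ^ 2 ≤ G)
    (hf : f ^ 2 = e ^ 2 * v ^ 2) (hZ : b₂ * (K ^ 2 / 4) ≤ Z) :
    e ^ 2 * b₂ * (V + K ^ 2 * v ^ 2) ≤
      44 * (-8 * N * D₀ ^ 2 + 4 * b₂ * D₁ ^ 2 + 2 * b₂ * G + Z * f ^ 2) := by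
  obtain ⟨hb1l, hb1u⟩ := hb₁
  have hb20 : 0 ≤ b₂ := by linarith
  have hG0 : 0 ≤ G := (sq_nonneg _).trans hG
  have ha2 : a ^ 2 ≤ K ^ 2 / 64 := by
    have := sq_le_sq' (abs_le.1 ha).1 (abs_le.1 ha).2
    linarith [show (K / 8) ^ 2 = K ^ 2 / 64 by ring]
  have hb12u : b₁ ^ 2 ≤ 4 * K ^ 2 := by nlinarith
  have s1 : b₂ * (e ^ 2 * V) ≤ b₂ * (2 * G + 9 * K ^ 2 * f ^ 2) := by
    refine mul_le_mul_of_nonneg_left (hV.trans ?_) hb20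
    have : (a ^ 2 + b₁ ^ 2) * f ^ 2 ≤ (9 / 2 * K ^ 2) * f ^ 2 :=
      mul_le_mul_of_nonneg_right (by linarith [sq_nonneg K]) (sq_nonneg _)
    linarith
  have s2 : b₂ * (K ^ 2 / 4) * f ^ 2 ≤ Z * f ^ 2 := mul_le_mul_of_nonneg_right hZ (sq_nonneg f)
  have s3 : 8 * N * D₀ ^ 2 ≤ b₂ * G := mul_le_mul hb₂ hG (sq_nonneg _) hb20
  have s4 : 0 ≤ b₂ * D₁ ^ 2 := mul_nonneg hb20 (sq_nonneg _)
  have s5 : 0 ≤ b₂ * G := mul_nonneg hb20 hG0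
  have s6 : 0 ≤ b₂ * K ^ 2 * f ^ 2 := by positivity
  have s7 : e ^ 2 * b₂ * (V + K ^ 2 * v ^ 2) = b₂ * (e ^ 2 * V) + b₂ * K ^ 2 * f ^ 2 := by
    rw [hf]
    ring
  rw [s7]
  linarith

/-- **Carleman inequality** for real test functions and a separated weight. -/
theorem IsSeparatedWeight.carleman (h : IsSeparatedWeight E j₀ j₁ N φ a₁ b₁ b₂ b₃ b₄)
    {v : F → ℝ} (hv : ContDiff ℝ ∞ v) (hvc : HasCompactSupport v) {K M Γ : ℝ}
    (hK : 1 ≤ K) (hN : 0 ≤ N) (hKΓ : 40 * Γ ≤ K) (hKM : 100 * M ≤ K ^ 2)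
    (hb₁ : ∀ z ∈ tsupport v, K / 2 ≤ b₁ z ∧ b₁ z ≤ 2 * K)
    (ha₁ : ∀ z ∈ tsupport v, |a₁ z| ≤ K / 8)
    (hb₂ : ∀ z ∈ tsupport v, 8 * N ≤ b₂ z ∧ b₂ z ≤ 2 * M)
    (hb₃ : ∀ z ∈ tsupport v, |b₃ z| ≤ Γ * b₂ z)
    (hb₄ : ∀ z ∈ tsupport v, |b₄ z| ≤ Γ * b₂ z) :
    ∫ z, Real.exp (φ z) ^ 2 * b₂ z * (∑ j, dirDeriv (E j) v z ^ 2 + K ^ 2 * v z ^ 2) ≤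
      44 * ∫ z, (Real.exp (φ z) * ∑ j, dirDeriv (E j) (dirDeriv (E j) v) z) ^ 2 := by
  set f : F → ℝ := fun z => Real.exp (φ z) * v z with hfdef
  have hexp : ContDiff ℝ ∞ fun z => Real.exp (φ z) := h.contDiff.exp
  have hf : ContDiff ℝ ∞ f := hexp.mul hv
  have hfc : HasCompactSupport f := hvc.mul_left
  have hnull := h.nullIntegral_commutator hf hfc
  have hexpc := hexp.continuous
  have i1 : Integrable fun z => Real.exp (φ z) ^ 2 * b₂ z *
      (∑ j, dirDeriv (E j) v z ^ 2 + K ^ 2 * v z ^ 2) := by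
    have hs : HasCompactSupport fun z => ∑ j, dirDeriv (E j) v z ^ 2 + K ^ 2 * v z ^ 2 := by
      refine HasCompactSupport.intro hvc fun z hz => ?_
      simp [dirDeriv_eq_zero_of_notMem hz, image_eq_zero_of_notMem_tsupport hz]
    refine Continuous.integrable_of_hasCompactSupport ?_ hs.mul_left
    exact ((hexpc.pow 2).mul h.contDiff_b₂.continuous).mul
      ((continuous_finsetSum _ fun j _ => ((hv.dirDeriv (E j)).continuous.pow 2)).add
        (continuous_const.mul (hv.continuous.pow 2)))
  have i2 : Integrable fun z =>
      (Real.exp (φ z) * ∑ j, dirDeriv (E j) (dirDeriv (E j) v) z) ^ 2 := by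
    refine Continuous.integrable_of_hasCompactSupport ((hexpc.mul
      (continuous_finsetSum _ fun j _ => ((hv.dirDeriv (E j)).dirDeriv (E j)).continuous)).pow 2)
      (HasCompactSupport.intro hvc fun z hz => ?_)
    have : ∀ j, dirDeriv (E j) (dirDeriv (E j) v) z = 0 := fun j =>
      dirDeriv_eq_zero_of_notMem fun hz' => hz (tsupport_dirDeriv_subset _ _ hz')
    simp [this]
  rw [← integral_const_mul, ← sub_nonpos, ← integral_sub i1 (i2.const_mul 44)]
  -- Adding a multiple of a null integral reduces the integral inequality to a pointwise one.
  have hn := hnull.const_mul (-44)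
  rw [← hn.2]
  refine integral_mono (i1.sub (i2.const_mul 44)) hn.1 fun z => ?_
  simp only
  have hL : Real.exp (φ z) * ∑ j, dirDeriv (E j) (dirDeriv (E j) v) z =
      (∑ j, dirDeriv (E j) (dirDeriv (E j) f) z + (a₁ z ^ 2 + b₁ z ^ 2 + b₂ z) * f z)
        + (-2 * a₁ z * dirDeriv (E j₀) f z - 2 * b₁ z * dirDeriv (E j₁) f z
          - (2 * b₂ z - 2 * N) * f z) := by
    rw [h.sum_deriv_deriv_exp_mul hv, h.dirDeriv_exp_mul hv, h.dirDeriv_exp_mul hv, h.deriv,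
      h.deriv]
    simp only [h.ne, h.ne.symm, if_true, if_false, hfdef]
    ring
  rw [hL]
  set S := ∑ j, dirDeriv (E j) (dirDeriv (E j) f) z + (a₁ z ^ 2 + b₁ z ^ 2 + b₂ z) * f z
  set A := -2 * a₁ z * dirDeriv (E j₀) f z - 2 * b₁ z * dirDeriv (E j₁) f z
          - (2 * b₂ z - 2 * N) * f z
  -- The difference `(S + A)² - 2 S A = S² + A²` is discarded, so only the quadratic form from the
  -- cross term is needed.
  suffices hQ : Real.exp (φ z) ^ 2 * b₂ z * (∑ j, dirDeriv (E j) v z ^ 2 + K ^ 2 * v z ^ 2) ≤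
      44 * (-8 * N * dirDeriv (E j₀) f z ^ 2 + 4 * b₂ z * dirDeriv (E j₁) f z ^ 2
        + 2 * b₂ z * ∑ j, dirDeriv (E j) f z ^ 2
        + (2 * b₁ z ^ 2 * b₂ z - 2 * a₁ z ^ 2 * b₂ z - 8 * N * a₁ z ^ 2 + 2 * b₁ z * b₃ z
          - 2 * b₂ z ^ 2 - 2 * b₄ z) * f z ^ 2) by
    nlinarith [sq_nonneg S, sq_nonneg A]
  by_cases hz : z ∈ tsupport v
  swap
  · have hz' : z ∉ tsupport f := fun h' => hz (tsupport_mul_subset_right h')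
    simp [dirDeriv_eq_zero_of_notMem hz, image_eq_zero_of_notMem_tsupport hz,
      dirDeriv_eq_zero_of_notMem hz', image_eq_zero_of_notMem_tsupport hz']
  have hsum : Real.exp (φ z) ^ 2 * ∑ j, dirDeriv (E j) v z ^ 2 ≤
      2 * ∑ j, dirDeriv (E j) f z ^ 2 + 2 * (a₁ z ^ 2 + b₁ z ^ 2) * f z ^ 2 := by
    rw [← h.sum_deriv_sq, Finset.mul_sum, Finset.mul_sum, mul_assoc, Finset.sum_mul,
      Finset.mul_sum, ← Finset.sum_add_distrib]
    refine Finset.sum_le_sum fun j _ => ?_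
    rw [h.dirDeriv_exp_mul hv, hfdef]
    nlinarith [sq_nonneg (Real.exp (φ z) * dirDeriv (E j) v z
      + 2 * (Real.exp (φ z) * (dirDeriv (E j) φ z * v z)))]
  have hj0 : dirDeriv (E j₀) f z ^ 2 ≤ ∑ j, dirDeriv (E j) f z ^ 2 :=
    Finset.single_le_sum (f := fun j => dirDeriv (E j) f z ^ 2) (fun j _ => sq_nonneg _)
      (Finset.mem_univ j₀)
  have hf2 : f z ^ 2 = Real.exp (φ z) ^ 2 * v z ^ 2 := by
    rw [hfdef]
    ring
  have hZ := carleman_coefficient_lower_bound hK hN hKΓ hKM (hb₁ z hz) (ha₁ z hz) (hb₂ z hz)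
    (hb₃ z hz) (hb₄ z hz)
  exact carleman_quadratic_form_lower_bound hK hN (hb₁ z hz) (ha₁ z hz) (hb₂ z hz).1 hsum hj0 hf2
    hZ

/-- **Caccioppoli inequality** for smooth real functions. -/
theorem caccioppoli_real (E : J → F) {f ζ : F → ℝ} (hf : ContDiff ℝ ∞ f) (hζ : ContDiff ℝ ∞ ζ)
    (hζc : HasCompactSupport ζ) {δ : ℝ} (hδ : 0 < δ) :
    ∫ z, ζ z ^ 2 * ∑ j, dirDeriv (E j) f z ^ 2 ≤
      ∫ z, (2 * δ * (ζ z * ∑ j, dirDeriv (E j) (dirDeriv (E j) f) z) ^ 2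
        + (ζ z ^ 2 / (2 * δ) + 4 * ∑ j, dirDeriv (E j) ζ z ^ 2) * f z ^ 2) := by
  -- The divergence of `ζ² f ∇f`.
  have hn : NullIntegral fun z => ∑ j, dirDeriv (E j)
      (fun z => (fun z => ζ z * ζ z) z * (fun z => f z * dirDeriv (E j) f z) z) z :=
    NullIntegral.sum _ fun j _ => nullIntegral_dirDeriv
      ((hζ.mul hζ).mul (hf.mul (hf.dirDeriv (E j)))) ((hζc.mul_left (f := ζ)).mul_right) (E j)
  have hfe : ∀ j, ContDiff ℝ ∞ (dirDeriv (E j) f) := fun j => hf.dirDeriv (E j)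
  have hζe : ∀ j, ContDiff ℝ ∞ (dirDeriv (E j) ζ) := fun j => hζ.dirDeriv (E j)
  have c1 : Continuous fun z => ∑ j, dirDeriv (E j) f z ^ 2 :=
    continuous_finsetSum _ fun j _ => (hfe j).continuous.pow 2
  have c2 : Continuous fun z => ∑ j, dirDeriv (E j) (dirDeriv (E j) f) z :=
    continuous_finsetSum _ fun j _ => ((hfe j).dirDeriv (E j)).continuous
  have c3 : Continuous fun z => ∑ j, dirDeriv (E j) ζ z ^ 2 :=
    continuous_finsetSum _ fun j _ => (hζe j).continuous.pow 2
  have hζ' := hζ.continuous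
  have hf' := hf.continuous
  have i1 : Integrable fun z => ζ z ^ 2 * ∑ j, dirDeriv (E j) f z ^ 2 := by
    refine Continuous.integrable_of_hasCompactSupport ((hζ'.pow 2).mul c1)
      (HasCompactSupport.intro hζc fun z hz => ?_)
    simp [image_eq_zero_of_notMem_tsupport hz]
  have i2 : Integrable fun z => (2 * δ * (ζ z * ∑ j, dirDeriv (E j) (dirDeriv (E j) f) z) ^ 2
        + (ζ z ^ 2 / (2 * δ) + 4 * ∑ j, dirDeriv (E j) ζ z ^ 2) * f z ^ 2) := by
    refine Continuous.integrable_of_hasCompactSupport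
      ((continuous_const.mul ((hζ'.mul c2).pow 2)).add
        ((((hζ'.pow 2).div_const _).add (continuous_const.mul c3)).mul (hf'.pow 2)))
      (HasCompactSupport.intro hζc fun z hz => ?_)
    simp [image_eq_zero_of_notMem_tsupport hz, dirDeriv_eq_zero_of_notMem hz]
  rw [← sub_nonpos, ← integral_sub i1 i2]
  have hn2 := hn.const_mul 2
  rw [← hn2.2]
  refine integral_mono (i1.sub i2) hn2.1 fun z => ?_
  simp only
  have e1 : ∀ j, dirDeriv (E j)
      (fun z => (fun z => ζ z * ζ z) z * (fun z => f z * dirDeriv (E j) f z) z) z =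
      ζ z ^ 2 * dirDeriv (E j) f z ^ 2
        + ζ z ^ 2 * f z * dirDeriv (E j) (dirDeriv (E j) f) z
        + 2 * ζ z * dirDeriv (E j) ζ z * f z * dirDeriv (E j) f z := fun j => by
    rw [dirDeriv_mul (hζ.mul hζ) (hf.mul (hfe j)), dirDeriv_mul hζ hζ, dirDeriv_mul hf (hfe j)]
    ring
  have e2 : -(ζ z ^ 2 * ∑ j, dirDeriv (E j) f z ^ 2) / 2
      - 2 * (∑ j, dirDeriv (E j) ζ z ^ 2) * f z ^ 2 ≤
      ∑ j, 2 * ζ z * dirDeriv (E j) ζ z * f z * dirDeriv (E j) f z := by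
    rw [Finset.mul_sum, Finset.mul_sum, ← Finset.sum_neg_distrib, Finset.sum_div, Finset.sum_mul,
      ← Finset.sum_sub_distrib]
    refine Finset.sum_le_sum fun j _ => ?_
    nlinarith [sq_nonneg (ζ z * dirDeriv (E j) f z + 2 * dirDeriv (E j) ζ z * f z)]
  simp_rw [e1, Finset.sum_add_distrib, ← Finset.mul_sum]
  set L := ∑ j, dirDeriv (E j) (dirDeriv (E j) f) z
  -- The free parameter `δ` weighs the second-order term; a small `δ` later allows it to be
  -- absorbed.
  have e3 : -(δ * (ζ z * L) ^ 2 + ζ z ^ 2 / (4 * δ) * f z ^ 2) ≤ ζ z ^ 2 * f z * L := by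
    have : δ * (ζ z * L) ^ 2 + ζ z ^ 2 / (4 * δ) * f z ^ 2 + ζ z ^ 2 * f z * L =
        δ * (ζ z * L + ζ z * f z / (2 * δ)) ^ 2 := by
      field_simp
      ring
    have h0 : 0 ≤ δ * (ζ z * L + ζ z * f z / (2 * δ)) ^ 2 := by positivity
    linarith
  have e4 : ζ z ^ 2 / (2 * δ) = 2 * (ζ z ^ 2 / (4 * δ)) := by
    field_simp
    norm_num
  rw [e4]
  linarith

end Carleman


/-! ### Real and imaginary parts -/

section ComplexParts

variable {F : Type*} [NormedAddCommGroup F] [NormedSpace ℝ F]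

theorem dirDeriv_re {u : F → ℂ} (hu : ContDiff ℝ ∞ u) (e z : F) :
    dirDeriv e (fun z => (u z).re) z = (fderiv ℝ u z e).re := by
  have h := Complex.reCLM.hasFDerivAt.comp z
    ((hu.differentiable (by simp)).differentiableAt (x := z)).hasFDerivAt
  have h' : HasFDerivAt (fun z => (u z).re) _ z := h
  rw [dirDeriv, h'.fderiv]
  rfl

theorem dirDeriv_im {u : F → ℂ} (hu : ContDiff ℝ ∞ u) (e z : F) :
    dirDeriv e (fun z => (u z).im) z = (fderiv ℝ u z e).im := by
  have h := Complex.imCLM.hasFDerivAt.comp z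
    ((hu.differentiable (by simp)).differentiableAt (x := z)).hasFDerivAt
  have h' : HasFDerivAt (fun z => (u z).im) _ z := h
  rw [dirDeriv, h'.fderiv]
  rfl

theorem contDiff_re {u : F → ℂ} (hu : ContDiff ℝ ∞ u) : ContDiff ℝ ∞ fun z => (u z).re :=
  Complex.reCLM.contDiff.comp hu

theorem contDiff_im {u : F → ℂ} (hu : ContDiff ℝ ∞ u) : ContDiff ℝ ∞ fun z => (u z).im :=
  Complex.imCLM.contDiff.comp hu

theorem norm_sq_eq_re_add_im (w : ℂ) : ‖w‖ ^ 2 = w.re ^ 2 + w.im ^ 2 := by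
  rw [Complex.sq_norm, Complex.normSq_apply]
  ring

theorem dirDeriv_dirDeriv_mul {f g : F → ℝ} (hf : ContDiff ℝ ∞ f) (hg : ContDiff ℝ ∞ g)
    (e z : F) : dirDeriv e (dirDeriv e fun z => f z * g z) z =
      dirDeriv e (dirDeriv e f) z * g z + 2 * dirDeriv e f z * dirDeriv e g z
        + f z * dirDeriv e (dirDeriv e g) z := by
  have h1 : dirDeriv e (fun z => f z * g z) = fun z =>
      (fun z => dirDeriv e f z * g z) z + (fun z => f z * dirDeriv e g z) z :=
    funext fun z => dirDeriv_mul hf hg e z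
  rw [h1, dirDeriv_add ((hf.dirDeriv e).mul hg) (hf.mul (hg.dirDeriv e)),
    dirDeriv_mul (hf.dirDeriv e) hg, dirDeriv_mul hf (hg.dirDeriv e)]
  ring

end ComplexParts

/-! ### Passage to complex functions with weak derivatives -/

section Weak

variable {F : Type*} [NormedAddCommGroup F] [NormedSpace ℝ F] [MeasureSpace F] [BorelSpace F]
  [FiniteDimensional ℝ F] [(volume : Measure F).IsAddHaarMeasure]
  {J : Type*} [DecidableEq J] [Fintype J] {E : J → F} {j₀ j₁ : J} {N : ℝ}
  {φ a₁ b₁ b₂ b₃ b₄ : F → ℝ}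

/-- Carleman inequality for the product of a real cutoff and a smooth complex function. -/
theorem IsSeparatedWeight.carleman_smooth (h : IsSeparatedWeight E j₀ j₁ N φ a₁ b₁ b₂ b₃ b₄)
    {η : F → ℝ} (hη : ContDiff ℝ ∞ η) (hηc : HasCompactSupport η) {K M Γ : ℝ}
    (hK : 1 ≤ K) (hN : 0 ≤ N) (hKΓ : 40 * Γ ≤ K) (hKM : 100 * M ≤ K ^ 2)
    (hb₁ : ∀ z ∈ tsupport η, K / 2 ≤ b₁ z ∧ b₁ z ≤ 2 * K)
    (ha₁ : ∀ z ∈ tsupport η, |a₁ z| ≤ K / 8)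
    (hb₂ : ∀ z ∈ tsupport η, 8 * N ≤ b₂ z ∧ b₂ z ≤ 2 * M)
    (hb₃ : ∀ z ∈ tsupport η, |b₃ z| ≤ Γ * b₂ z)
    (hb₄ : ∀ z ∈ tsupport η, |b₄ z| ≤ Γ * b₂ z)
    (hb₂0 : ∀ z, 0 ≤ b₂ z)
    {u : F → ℂ} {du ddu : J → F → ℂ} (hu : ContDiff ℝ ∞ u) (hdus : ∀ j, ContDiff ℝ ∞ (du j))
    (hddus : ∀ j, ContDiff ℝ ∞ (ddu j))
    (hdu : ∀ j z, fderiv ℝ u z (E j) = du j z) (hddu : ∀ j z, fderiv ℝ (du j) z (E j) = ddu j z) :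
    (∑ j, ∫ z, ‖(Real.exp (φ z) * √(b₂ z) * η z) • du j z
        + (Real.exp (φ z) * √(b₂ z) * dirDeriv (E j) η z) • u z‖ ^ 2)
      + ∫ z, ‖(Real.exp (φ z) * √(b₂ z) * K * η z) • u z‖ ^ 2 ≤
    44 * ∫ z, ‖∑ j, ((Real.exp (φ z) * η z) • ddu j z
        + (2 * Real.exp (φ z) * dirDeriv (E j) η z) • du j z
        + (Real.exp (φ z) * dirDeriv (E j) (dirDeriv (E j) η) z) • u z)‖ ^ 2 := by
  have hre := contDiff_re hu
  have him := contDiff_im hu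
  have hv₁ : ContDiff ℝ ∞ fun z => η z * (u z).re := hη.mul hre
  have hv₂ : ContDiff ℝ ∞ fun z => η z * (u z).im := hη.mul him
  have hs₁ : tsupport (fun z => η z * (u z).re) ⊆ tsupport η := tsupport_mul_subset_left
  have hs₂ : tsupport (fun z => η z * (u z).im) ⊆ tsupport η := tsupport_mul_subset_left
  -- The operator, the weight and the cutoff are real, so the inequality is applied to the real and
  -- imaginary parts of `η u` and summed.
  have c₁ := h.carleman hv₁ hηc.mul_right hK hN hKΓ hKM (fun z hz => hb₁ z (hs₁ hz))
    (fun z hz => ha₁ z (hs₁ hz)) (fun z hz => hb₂ z (hs₁ hz)) (fun z hz => hb₃ z (hs₁ hz))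
    (fun z hz => hb₄ z (hs₁ hz))
  have c₂ := h.carleman hv₂ hηc.mul_right hK hN hKΓ hKM (fun z hz => hb₁ z (hs₂ hz))
    (fun z hz => ha₁ z (hs₂ hz)) (fun z hz => hb₂ z (hs₂ hz)) (fun z hz => hb₃ z (hs₂ hz))
    (fun z hz => hb₄ z (hs₂ hz))
  have dre : ∀ j, dirDeriv (E j) (fun z => (u z).re) = fun z => (du j z).re := fun j => by
    funext z
    rw [dirDeriv_re hu, hdu]
  have dim : ∀ j, dirDeriv (E j) (fun z => (u z).im) = fun z => (du j z).im := fun j => by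
    funext z
    rw [dirDeriv_im hu, hdu]
  have ddre : ∀ j z, dirDeriv (E j) (dirDeriv (E j) fun z => (u z).re) z = (ddu j z).re :=
    fun j z => by rw [dre, dirDeriv_re (hdus j), hddu]
  have ddim : ∀ j z, dirDeriv (E j) (dirDeriv (E j) fun z => (u z).im) z = (ddu j z).im :=
    fun j z => by rw [dim, dirDeriv_im (hdus j), hddu]
  simp_rw [dirDeriv_mul hη hre, dirDeriv_dirDeriv_mul hη hre, ddre, dre] at c₁
  simp_rw [dirDeriv_mul hη him, dirDeriv_dirDeriv_mul hη him, ddim, dim] at c₂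
  have hex : Continuous fun z => Real.exp (φ z) := h.contDiff.exp.continuous
  have hsq : Continuous fun z => √(b₂ z) := h.contDiff_b₂.continuous.sqrt
  have hb2c := h.contDiff_b₂.continuous
  have hηc' := hη.continuous
  have hdη : ∀ j, Continuous (dirDeriv (E j) η) := fun j => (hη.dirDeriv _).continuous
  have hddη : ∀ j, Continuous (dirDeriv (E j) (dirDeriv (E j) η)) := fun j =>
    ((hη.dirDeriv _).dirDeriv _).continuous
  have huc := hu.continuous
  have hduc : ∀ j, Continuous (du j) := fun j => (hdus j).continuous
  have hdduc : ∀ j, Continuous (ddu j) := fun j => (hddus j).continuous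
  have z0 : ∀ z, z ∉ tsupport η → η z = 0 := fun z hz => image_eq_zero_of_notMem_tsupport hz
  have z1 : ∀ j z, z ∉ tsupport η → dirDeriv (E j) η z = 0 := fun j z hz =>
    dirDeriv_eq_zero_of_notMem hz
  have z2 : ∀ j z, z ∉ tsupport η → dirDeriv (E j) (dirDeriv (E j) η) z = 0 := fun j z hz =>
    dirDeriv_eq_zero_of_notMem fun hz' => hz (tsupport_dirDeriv_subset _ _ hz')
  have ig : ∀ {g : F → ℝ}, Continuous g → (∀ z, z ∉ tsupport η → g z = 0) → Integrable g :=
    fun hg h0 => hg.integrable_of_hasCompactSupport (HasCompactSupport.intro hηc h0)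
  have igr : Continuous fun z => (u z).re := hre.continuous
  have igi : Continuous fun z => (u z).im := him.continuous
  have igdr : ∀ j, Continuous fun z => (du j z).re := fun j => (contDiff_re (hdus j)).continuous
  have igdi : ∀ j, Continuous fun z => (du j z).im := fun j => (contDiff_im (hdus j)).continuous
  have igddr : ∀ j, Continuous fun z => (ddu j z).re := fun j => (contDiff_re (hddus j)).continuous
  have igddi : ∀ j, Continuous fun z => (ddu j z).im := fun j => (contDiff_im (hddus j)).continuous
  have key := add_le_add c₁ c₂
  rw [← mul_add, ← integral_add, ← integral_add] at key
  rotate_left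
  · exact ig (by fun_prop) fun z hz => by simp [z0 z hz, z1 _ z hz, z2 _ z hz]
  · exact ig (by fun_prop) fun z hz => by simp [z0 z hz, z1 _ z hz, z2 _ z hz]
  · exact ig (by fun_prop) fun z hz => by simp [z0 z hz, z1 _ z hz]
  · exact ig (by fun_prop) fun z hz => by simp [z0 z hz, z1 _ z hz]
  rw [← integral_finsetSum, ← integral_add]
  rotate_left
  · exact integrable_finsetSum _ fun j _ =>
      ig (by fun_prop) fun z hz => by simp [z0 z hz, z1 _ z hz]
  · exact ig (by fun_prop) fun z hz => by simp [z0 z hz]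
  · exact fun j _ => ig (by fun_prop) fun z hz => by simp [z0 z hz, z1 _ z hz]
  refine (le_of_eq (integral_congr_ae (ae_of_all _ fun z => ?_))).trans
    (key.trans (le_of_eq (congrArg _ (integral_congr_ae (ae_of_all _ fun z => ?_)))))
  · have hb := Real.sq_sqrt (hb₂0 z)
    have e1 : ∀ j, ‖(Real.exp (φ z) * √(b₂ z) * η z) • du j z
        + (Real.exp (φ z) * √(b₂ z) * dirDeriv (E j) η z) • u z‖ ^ 2 =
        Real.exp (φ z) ^ 2 * b₂ z * ((dirDeriv (E j) η z * (u z).re + η z * (du j z).re) ^ 2 +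
          (dirDeriv (E j) η z * (u z).im + η z * (du j z).im) ^ 2) := fun j => by
      rw [norm_sq_eq_re_add_im]
      simp only [Complex.add_re, Complex.add_im, Complex.smul_re, Complex.smul_im, smul_eq_mul]
      linear_combination Real.exp (φ z) ^ 2 *
        ((dirDeriv (E j) η z * (u z).re + η z * (du j z).re) ^ 2 +
          (dirDeriv (E j) η z * (u z).im + η z * (du j z).im) ^ 2) * hb
    have e2 : ‖(Real.exp (φ z) * √(b₂ z) * K * η z) • u z‖ ^ 2 =
        Real.exp (φ z) ^ 2 * b₂ z * (K ^ 2 * ((η z * (u z).re) ^ 2 + (η z * (u z).im) ^ 2)) := by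
      rw [norm_sq_eq_re_add_im]
      simp only [Complex.smul_re, Complex.smul_im, smul_eq_mul]
      linear_combination Real.exp (φ z) ^ 2 * K ^ 2 *
        ((η z * (u z).re) ^ 2 + (η z * (u z).im) ^ 2) * hb
    simp_rw [e1]
    rw [e2, ← Finset.mul_sum, Finset.sum_add_distrib]
    ring
  · beta_reduce
    rw [norm_sq_eq_re_add_im, Complex.re_sum, Complex.im_sum]
    simp only [Complex.add_re, Complex.add_im, Complex.smul_re, Complex.smul_im, smul_eq_mul]
    rw [Finset.mul_sum, Finset.mul_sum]
    congr 2
    all_goals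
      refine Finset.sum_congr rfl fun j _ => ?_
      ring

/-- Carleman inequality for the product of a cutoff and a function with two weak derivatives. -/
theorem IsSeparatedWeight.carleman_weak (h : IsSeparatedWeight E j₀ j₁ N φ a₁ b₁ b₂ b₃ b₄)
    {η : F → ℝ} (hη : ContDiff ℝ ∞ η) (hηc : HasCompactSupport η) {K M Γ : ℝ}
    (hK : 1 ≤ K) (hN : 0 ≤ N) (hKΓ : 40 * Γ ≤ K) (hKM : 100 * M ≤ K ^ 2)
    (hb₁ : ∀ z ∈ tsupport η, K / 2 ≤ b₁ z ∧ b₁ z ≤ 2 * K)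
    (ha₁ : ∀ z ∈ tsupport η, |a₁ z| ≤ K / 8)
    (hb₂ : ∀ z ∈ tsupport η, 8 * N ≤ b₂ z ∧ b₂ z ≤ 2 * M)
    (hb₃ : ∀ z ∈ tsupport η, |b₃ z| ≤ Γ * b₂ z)
    (hb₄ : ∀ z ∈ tsupport η, |b₄ z| ≤ Γ * b₂ z)
    (hb₂0 : ∀ z, 0 ≤ b₂ z)
    {u : F → ℂ} {du ddu : J → F → ℂ} (hu : MemL2Loc u) (hdus : ∀ j, MemL2Loc (du j))
    (hddus : ∀ j, MemL2Loc (ddu j)) (hdu : ∀ j, IsWeakDeriv (E j) u (du j))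
    (hddu : ∀ j, IsWeakDeriv (E j) (du j) (ddu j)) :
    (∑ j, ∫ z, ‖(Real.exp (φ z) * √(b₂ z) * η z) • du j z
        + (Real.exp (φ z) * √(b₂ z) * dirDeriv (E j) η z) • u z‖ ^ 2)
      + ∫ z, ‖(Real.exp (φ z) * √(b₂ z) * K * η z) • u z‖ ^ 2 ≤
    44 * ∫ z, ‖∑ j, ((Real.exp (φ z) * η z) • ddu j z
        + (2 * Real.exp (φ z) * dirDeriv (E j) η z) • du j z
        + (Real.exp (φ z) * dirDeriv (E j) (dirDeriv (E j) η) z) • u z)‖ ^ 2 := by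
  have hex : Continuous fun z => Real.exp (φ z) := h.contDiff.exp.continuous
  have hsq : Continuous fun z => √(b₂ z) := h.contDiff_b₂.continuous.sqrt
  have hηc' := hη.continuous
  have hdη : ∀ j, Continuous (dirDeriv (E j) η) := fun j => (hη.dirDeriv _).continuous
  have hddη : ∀ j, Continuous (dirDeriv (E j) (dirDeriv (E j) η)) := fun j =>
    ((hη.dirDeriv _).dirDeriv _).continuous
  have hsη : ∀ j, HasCompactSupport (dirDeriv (E j) η) := fun j => hηc.dirDeriv _
  have hssη : ∀ j, HasCompactSupport (dirDeriv (E j) (dirDeriv (E j) η)) := fun j =>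
    (hηc.dirDeriv _).dirDeriv _
  have lu : LocallyIntegrable u := (hdu j₀).locallyIntegrable
  have ldu : ∀ j, LocallyIntegrable (du j) := fun j => (hdu j).locallyIntegrable_deriv
  have lddu : ∀ j, LocallyIntegrable (ddu j) := fun j => (hddu j).locallyIntegrable_deriv
  -- The derivatives of a mollified function are the mollified weak derivatives, so every integral
  -- converges to its counterpart for `u`.
  have smooth := fun k => h.carleman_smooth hη hηc hK hN hKΓ hKM hb₁ ha₁ hb₂ hb₃ hb₄ hb₂0
    (contDiff_mollify k lu) (fun j => contDiff_mollify k (ldu j))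
    (fun j => contDiff_mollify k (lddu j)) (fun j z => (hdu j).fderiv_mollify k z)
    (fun j z => (hddu j).fderiv_mollify k z)
  refine le_of_tendsto_of_tendsto' (b := atTop) (Tendsto.add (tendsto_finsetSum _ fun j _ => ?_) ?_) ?_ smooth
  · exact (((hdus j).tendstoL2_mollify (ldu j) (by fun_prop) hηc.mul_left).add
      (hu.tendstoL2_mollify lu (by fun_prop) (hsη j).mul_left)).tendsto_integral
  · exact (hu.tendstoL2_mollify lu (by fun_prop) hηc.mul_left).tendsto_integral
  · refine Tendsto.const_mul _ (TendstoL2.tendsto_integral (TendstoL2.sum _ fun j _ => ?_))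
    exact (((hddus j).tendstoL2_mollify (lddu j) (by fun_prop) hηc.mul_left).add
      ((hdus j).tendstoL2_mollify (ldu j) (by fun_prop) (hsη j).mul_left)).add
      (hu.tendstoL2_mollify lu (by fun_prop) (hssη j).mul_left)

theorem caccioppoli_smooth {ζ : F → ℝ} (hζ : ContDiff ℝ ∞ ζ) (hζc : HasCompactSupport ζ) {δ : ℝ}
    (hδ : 0 < δ)
    {u : F → ℂ} {du ddu : J → F → ℂ} (hu : ContDiff ℝ ∞ u) (hdus : ∀ j, ContDiff ℝ ∞ (du j))
    (hddus : ∀ j, ContDiff ℝ ∞ (ddu j))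
    (hdu : ∀ j z, fderiv ℝ u z (E j) = du j z) (hddu : ∀ j z, fderiv ℝ (du j) z (E j) = ddu j z) :
    ∑ j, ∫ z, ‖ζ z • du j z‖ ^ 2 ≤
      2 * δ * (∫ z, ‖∑ j, ζ z • ddu j z‖ ^ 2) + 1 / (2 * δ) * (∫ z, ‖ζ z • u z‖ ^ 2)
        + 4 * ∑ j, ∫ z, ‖dirDeriv (E j) ζ z • u z‖ ^ 2 := by
  have hre := contDiff_re hu
  have him := contDiff_im hu
  have c₁ := caccioppoli_real E hre hζ hζc hδ
  have c₂ := caccioppoli_real E him hζ hζc hδ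
  have dre : ∀ j, dirDeriv (E j) (fun z => (u z).re) = fun z => (du j z).re := fun j => by
    funext z
    rw [dirDeriv_re hu, hdu]
  have dim : ∀ j, dirDeriv (E j) (fun z => (u z).im) = fun z => (du j z).im := fun j => by
    funext z
    rw [dirDeriv_im hu, hdu]
  have ddre : ∀ j z, dirDeriv (E j) (dirDeriv (E j) fun z => (u z).re) z = (ddu j z).re :=
    fun j z => by rw [dre, dirDeriv_re (hdus j), hddu]
  have ddim : ∀ j z, dirDeriv (E j) (dirDeriv (E j) fun z => (u z).im) z = (ddu j z).im :=
    fun j z => by rw [dim, dirDeriv_im (hdus j), hddu]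
  simp_rw [ddre, dre] at c₁
  simp_rw [ddim, dim] at c₂
  have hζ' := hζ.continuous
  have hdζ : ∀ j, Continuous (dirDeriv (E j) ζ) := fun j => (hζ.dirDeriv _).continuous
  have huc := hu.continuous
  have hduc : ∀ j, Continuous (du j) := fun j => (hdus j).continuous
  have hdduc : ∀ j, Continuous (ddu j) := fun j => (hddus j).continuous
  have z0 : ∀ z, z ∉ tsupport ζ → ζ z = 0 := fun z hz => image_eq_zero_of_notMem_tsupport hz
  have z1 : ∀ j z, z ∉ tsupport ζ → dirDeriv (E j) ζ z = 0 := fun j z hz =>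
    dirDeriv_eq_zero_of_notMem hz
  have ig : ∀ {g : F → ℝ}, Continuous g → (∀ z, z ∉ tsupport ζ → g z = 0) → Integrable g :=
    fun hg h0 => hg.integrable_of_hasCompactSupport (HasCompactSupport.intro hζc h0)
  have igr : Continuous fun z => (u z).re := hre.continuous
  have igi : Continuous fun z => (u z).im := him.continuous
  have igdr : ∀ j, Continuous fun z => (du j z).re := fun j => (contDiff_re (hdus j)).continuous
  have igdi : ∀ j, Continuous fun z => (du j z).im := fun j => (contDiff_im (hdus j)).continuous
  have igddr : ∀ j, Continuous fun z => (ddu j z).re := fun j => (contDiff_re (hddus j)).continuous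
  have igddi : ∀ j, Continuous fun z => (ddu j z).im := fun j => (contDiff_im (hddus j)).continuous
  have key := add_le_add c₁ c₂
  rw [← integral_add, ← integral_add] at key
  rotate_left
  · exact ig (by fun_prop) fun z hz => by simp [z0 z hz, z1 _ z hz]
  · exact ig (by fun_prop) fun z hz => by simp [z0 z hz, z1 _ z hz]
  · exact ig (by fun_prop) fun z hz => by simp [z0 z hz]
  · exact ig (by fun_prop) fun z hz => by simp [z0 z hz]
  rw [← integral_finsetSum, ← integral_finsetSum, ← integral_const_mul, ← integral_const_mul,
    ← integral_const_mul, ← integral_add, ← integral_add]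
  rotate_left
  · exact ig (by fun_prop) fun z hz => by simp [z0 z hz]
  · exact ig (by fun_prop) fun z hz => by simp [z1 _ z hz]
  · exact ig (by fun_prop) fun z hz => by simp [z0 z hz]
  · exact ig (by fun_prop) fun z hz => by simp [z0 z hz]
  · exact fun j _ => ig (by fun_prop) fun z hz => by simp [z1 _ z hz]
  · exact fun j _ => ig (by fun_prop) fun z hz => by simp [z0 z hz]
  refine (le_of_eq (integral_congr_ae (ae_of_all _ fun z => ?_))).trans
    (key.trans (le_of_eq (integral_congr_ae (ae_of_all _ fun z => ?_))))
  · simp only [norm_sq_eq_re_add_im, Complex.smul_re, Complex.smul_im, smul_eq_mul]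
    rw [Finset.sum_add_distrib, Finset.mul_sum, Finset.mul_sum]
    simp_rw [mul_pow]
  · simp only [norm_sq_eq_re_add_im, Complex.smul_re, Complex.smul_im, smul_eq_mul,
      Complex.re_sum, Complex.im_sum, mul_pow, ← mul_add, ← Finset.sum_mul, ← Finset.mul_sum]
    ring

/-- Caccioppoli inequality for a function with two weak derivatives. -/
theorem caccioppoli_weak [Nonempty J] {ζ : F → ℝ} (hζ : ContDiff ℝ ∞ ζ)
    (hζc : HasCompactSupport ζ) {δ : ℝ} (hδ : 0 < δ)
    {u : F → ℂ} {du ddu : J → F → ℂ} (hu : MemL2Loc u) (hdus : ∀ j, MemL2Loc (du j))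
    (hddus : ∀ j, MemL2Loc (ddu j)) (hdu : ∀ j, IsWeakDeriv (E j) u (du j))
    (hddu : ∀ j, IsWeakDeriv (E j) (du j) (ddu j)) :
    ∑ j, ∫ z, ‖ζ z • du j z‖ ^ 2 ≤
      2 * δ * (∫ z, ‖∑ j, ζ z • ddu j z‖ ^ 2) + 1 / (2 * δ) * (∫ z, ‖ζ z • u z‖ ^ 2)
        + 4 * ∑ j, ∫ z, ‖dirDeriv (E j) ζ z • u z‖ ^ 2 := by
  have lu : LocallyIntegrable u := (hdu (Classical.arbitrary J)).locallyIntegrable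
  have ldu : ∀ j, LocallyIntegrable (du j) := fun j => (hdu j).locallyIntegrable_deriv
  have lddu : ∀ j, LocallyIntegrable (ddu j) := fun j => (hddu j).locallyIntegrable_deriv
  have hζ' := hζ.continuous
  have smooth := fun k => caccioppoli_smooth hζ hζc hδ
    (contDiff_mollify k lu) (fun j => contDiff_mollify k (ldu j))
    (fun j => contDiff_mollify k (lddu j)) (fun j z => (hdu j).fderiv_mollify k z)
    (fun j z => (hddu j).fderiv_mollify k z)
  refine le_of_tendsto_of_tendsto' (b := atTop) (tendsto_finsetSum _ fun j _ => ?_) (Tendsto.add (Tendsto.add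
    (Tendsto.const_mul _ ?_) (Tendsto.const_mul _ ?_)) (Tendsto.const_mul _
    (tendsto_finsetSum _ fun j _ => ?_))) smooth
  · exact ((hdus j).tendstoL2_mollify (ldu j) hζ' hζc).tendsto_integral
  · exact (TendstoL2.sum _ fun j _ =>
      (hddus j).tendstoL2_mollify (lddu j) hζ' hζc).tendsto_integral
  · exact (hu.tendstoL2_mollify lu hζ' hζc).tendsto_integral
  · exact (hu.tendstoL2_mollify lu (hζ.dirDeriv _).continuous (hζc.dirDeriv _)).tendsto_integral

end Weak


/-! ### Absorbing the lower-order terms and the cutoff errors -/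

section Absorption

theorem norm_real_smul_sq (c : ℝ) (w : ℂ) : ‖c • w‖ ^ 2 = c ^ 2 * ‖w‖ ^ 2 := by
  rw [norm_smul, mul_pow, Real.norm_eq_abs, sq_abs]

theorem norm_add_sq_le_two_mul (x y : ℂ) : ‖x + y‖ ^ 2 ≤ 2 * ‖x‖ ^ 2 + 2 * ‖y‖ ^ 2 := by
  have h := norm_add_le x y
  have h' : ‖x + y‖ ^ 2 ≤ (‖x‖ + ‖y‖) ^ 2 := by gcongr
  nlinarith [sq_nonneg (‖x‖ - ‖y‖)]

theorem norm_sum_sq_le {J : Type*} [Fintype J] (x : J → ℂ) :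
    ‖∑ j, x j‖ ^ 2 ≤ Fintype.card J * ∑ j, ‖x j‖ ^ 2 := by
  have h1 : ‖∑ j, x j‖ ^ 2 ≤ (∑ j, ‖x j‖) ^ 2 := by
    gcongr
    exact norm_sum_le _ _
  exact h1.trans (by simpa using sq_sum_le_card_mul_sum_sq (s := Finset.univ) (f := fun j => ‖x j‖))

/-- The constant in front of the error terms created by the cutoff. -/
def cutoffConstant (d B C : ℝ) : ℝ := 352 * C ^ 2 * d * B ^ 2 + 704 * d * B ^ 2 + 176 * d ^ 2 * B ^ 2

/-- Where no derivative falls on the cutoff, the differential inequality replaces `∑ ddu` by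
lower-order terms, and these fit into half of the left side of the Carleman inequality: `352 = 2 ·
44 · 4`, doubled to `704` for the gradient since `|η du|² ≤ 2 |η du + dη u|² + 2 |dη u|²`. Every
other term contains a derivative of `η` and hence a factor `ζ`. -/
theorem cutoff_error_bound {J : Type*} [Fintype J] {e η b K B ζ C P H : ℝ} {u : ℂ}
    {du ddu : J → ℂ} {dη ddη : J → ℝ} (hH1 : H ≤ 1) (hH0 : 0 ≤ H) (hb : 0 ≤ b)
    (hpde : ‖∑ j, ddu j‖ ^ 2 ≤ 2 * C ^ 2 * (P * ‖u‖ ^ 2 + H * ∑ j, ‖du j‖ ^ 2))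
    (hdη : ∀ j, |dη j| ≤ B * ζ) (hddη : ∀ j, |ddη j| ≤ B * ζ)
    (hHb : 704 * C ^ 2 * H ≤ b) (hPb : 352 * C ^ 2 * P ≤ b * K ^ 2) :
    44 * ‖∑ j, ((e * η) • ddu j + (2 * e * dη j) • du j + (e * ddη j) • u)‖ ^ 2 ≤
      1 / 2 * (∑ j, ‖(e * √b * η) • du j + (e * √b * dη j) • u‖ ^ 2 + ‖(e * √b * K * η) • u‖ ^ 2)
        + cutoffConstant (Fintype.card J) B C *
          (‖(ζ * e) • u‖ ^ 2 + ∑ j, ‖(ζ * e) • du j‖ ^ 2) := by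
  set d : ℝ := (Fintype.card J : ℝ) with hd
  have hd0 : 0 ≤ d := Nat.cast_nonneg _
  set U := ‖u‖ ^ 2 with hU
  set G := ∑ j, ‖du j‖ ^ 2 with hG
  have hU0 : 0 ≤ U := by positivity
  have hG0 : 0 ≤ G := by positivity
  set X := ∑ j, ‖η • du j + dη j • u‖ ^ 2 with hX
  have hX0 : 0 ≤ X := by positivity
  have hsqb := Real.sq_sqrt hb
  have e1 : ∑ j, ‖(e * √b * η) • du j + (e * √b * dη j) • u‖ ^ 2 = e ^ 2 * b * X := by
    rw [hX, Finset.mul_sum]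
    refine Finset.sum_congr rfl fun j _ => ?_
    rw [mul_smul, mul_smul (e * √b), ← smul_add, norm_real_smul_sq, mul_pow, hsqb]
  have e2 : ‖(e * √b * K * η) • u‖ ^ 2 = e ^ 2 * b * K ^ 2 * η ^ 2 * U := by
    rw [norm_real_smul_sq, mul_pow, mul_pow, mul_pow, hsqb]
  have e3 : ‖(ζ * e) • u‖ ^ 2 + ∑ j, ‖(ζ * e) • du j‖ ^ 2 = ζ ^ 2 * e ^ 2 * (U + G) := by
    simp_rw [norm_real_smul_sq]
    rw [← Finset.mul_sum]
    ring
  set Y := ∑ j, ((2 * dη j) • du j + ddη j • u) with hY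
  have e4 : ∑ j, ((e * η) • ddu j + (2 * e * dη j) • du j + (e * ddη j) • u) =
      e • (η • ∑ j, ddu j + Y) := by
    rw [hY, Finset.smul_sum, ← Finset.sum_add_distrib, Finset.smul_sum]
    refine Finset.sum_congr rfl fun j _ => ?_
    simp only [smul_add, smul_smul]
    rw [← add_assoc]
    congr 3
    ring
  have sq_le : ∀ {x : ℝ}, |x| ≤ B * ζ → x ^ 2 ≤ B ^ 2 * ζ ^ 2 := fun {x} hx => by
    rw [← sq_abs, ← mul_pow]
    gcongr
  have hYle : ‖Y‖ ^ 2 ≤ 8 * d * B ^ 2 * ζ ^ 2 * G + 2 * d ^ 2 * B ^ 2 * ζ ^ 2 * U := by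
    refine (norm_sum_sq_le _).trans ?_
    have : ∑ j, ‖(2 * dη j) • du j + ddη j • u‖ ^ 2 ≤
        ∑ j, (8 * B ^ 2 * ζ ^ 2 * ‖du j‖ ^ 2 + 2 * B ^ 2 * ζ ^ 2 * U) := by
      refine Finset.sum_le_sum fun j _ => (norm_add_sq_le_two_mul _ _).trans ?_
      rw [norm_real_smul_sq, norm_real_smul_sq]
      have t1 := mul_le_mul_of_nonneg_right (sq_le (hdη j)) (sq_nonneg ‖du j‖)
      have t2 := mul_le_mul_of_nonneg_right (sq_le (hddη j)) hU0
      linarith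
    rw [Finset.sum_add_distrib, ← Finset.mul_sum, Finset.sum_const, Finset.card_univ,
      nsmul_eq_mul, ← hd, ← hG] at this
    calc d * ∑ j, ‖(2 * dη j) • du j + ddη j • u‖ ^ 2
        ≤ d * (8 * B ^ 2 * ζ ^ 2 * G + d * (2 * B ^ 2 * ζ ^ 2 * U)) := by gcongr
      _ = _ := by ring
  have hηG : η ^ 2 * G ≤ 2 * X + 2 * d * B ^ 2 * ζ ^ 2 * U := by
    have : ∑ j, η ^ 2 * ‖du j‖ ^ 2 ≤
        ∑ j, (2 * ‖η • du j + dη j • u‖ ^ 2 + 2 * B ^ 2 * ζ ^ 2 * U) := by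
      refine Finset.sum_le_sum fun j _ => ?_
      have h1 := norm_add_sq_le_two_mul (η • du j + dη j • u) (-(dη j • u))
      rw [add_neg_cancel_right, norm_neg, norm_real_smul_sq, norm_real_smul_sq] at h1
      have t2 := mul_le_mul_of_nonneg_right (sq_le (hdη j)) hU0
      linarith
    rw [Finset.sum_add_distrib, ← Finset.mul_sum, ← Finset.mul_sum, Finset.sum_const,
      Finset.card_univ, nsmul_eq_mul, ← hd] at this
    linarith
  have hT : ‖η • ∑ j, ddu j + Y‖ ^ 2 ≤
      2 * (2 * C ^ 2 * (P * η ^ 2 * U + H * (2 * X + 2 * d * B ^ 2 * ζ ^ 2 * U)))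
        + 2 * (8 * d * B ^ 2 * ζ ^ 2 * G + 2 * d ^ 2 * B ^ 2 * ζ ^ 2 * U) := by
    have h1 := norm_add_sq_le_two_mul (η • ∑ j, ddu j) Y
    rw [norm_real_smul_sq] at h1
    have h2 := mul_le_mul_of_nonneg_left hpde (sq_nonneg η)
    have h3 := mul_le_mul_of_nonneg_left hηG (mul_nonneg (sq_nonneg C) hH0)
    have h4 : η ^ 2 * (2 * C ^ 2 * (P * U + H * G)) =
        2 * C ^ 2 * (P * η ^ 2 * U) + 2 * (C ^ 2 * H * (η ^ 2 * G)) := by ring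
    linarith
  have k1 : 352 * C ^ 2 * P * (η ^ 2 * U) ≤ b * K ^ 2 * (η ^ 2 * U) :=
    mul_le_mul_of_nonneg_right hPb (by positivity)
  have k2 : 704 * C ^ 2 * H * X ≤ b * X := mul_le_mul_of_nonneg_right hHb hX0
  have k3 : H * (352 * C ^ 2 * d * B ^ 2 * ζ ^ 2 * U) ≤ 1 * (352 * C ^ 2 * d * B ^ 2 * ζ ^ 2 * U) :=
    mul_le_mul_of_nonneg_right hH1 (by positivity)
  have k4 : 0 ≤ 352 * C ^ 2 * d * B ^ 2 * ζ ^ 2 * G := by positivity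
  have k5 : 0 ≤ 704 * d * B ^ 2 * ζ ^ 2 * U := by positivity
  have k6 : 0 ≤ 176 * d ^ 2 * B ^ 2 * ζ ^ 2 * G := by positivity
  rw [e1, e2, e3, e4, norm_real_smul_sq, cutoffConstant]
  have main : 44 * ‖η • ∑ j, ddu j + Y‖ ^ 2 ≤ 1 / 2 * (b * X + b * K ^ 2 * η ^ 2 * U)
      + (352 * C ^ 2 * d * B ^ 2 + 704 * d * B ^ 2 + 176 * d ^ 2 * B ^ 2) * ζ ^ 2 * (U + G) := by
    linarith
  have := mul_le_mul_of_nonneg_left main (sq_nonneg e)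
  linarith

variable {F : Type*} [NormedAddCommGroup F] [NormedSpace ℝ F] [MeasureSpace F] [BorelSpace F]
  [FiniteDimensional ℝ F] [(volume : Measure F).IsAddHaarMeasure]
  {J : Type*} [DecidableEq J] [Fintype J] {E : J → F} {j₀ j₁ : J} {N : ℝ}
  {φ a₁ b₁ b₂ b₃ b₄ : F → ℝ}

theorem _root_.MeasureTheory.MemLp.integrable_norm_sq {f : F → ℂ} (hf : MemLp f 2 volume) :
    Integrable fun z => ‖f z‖ ^ 2 :=
  hf.integrable_norm_pow two_ne_zero

/-- Combination of the Carleman inequality with the differential inequality: the weighted norm of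
`η u` is controlled by the weighted norms of `u` and its gradient where the cutoff varies. -/
theorem IsSeparatedWeight.absorb (h : IsSeparatedWeight E j₀ j₁ N φ a₁ b₁ b₂ b₃ b₄)
    {η ζ : F → ℝ} (hη : ContDiff ℝ ∞ η) (hηc : HasCompactSupport η) (hζ : ContDiff ℝ ∞ ζ)
    (hζc : HasCompactSupport ζ) {K M Γ B C : ℝ} {P H : F → ℝ}
    (hK : 1 ≤ K) (hN : 0 ≤ N) (hKΓ : 40 * Γ ≤ K) (hKM : 100 * M ≤ K ^ 2)
    (hb₁ : ∀ z ∈ tsupport η, K / 2 ≤ b₁ z ∧ b₁ z ≤ 2 * K)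
    (ha₁ : ∀ z ∈ tsupport η, |a₁ z| ≤ K / 8)
    (hb₂ : ∀ z ∈ tsupport η, 8 * N ≤ b₂ z ∧ b₂ z ≤ 2 * M)
    (hb₃ : ∀ z ∈ tsupport η, |b₃ z| ≤ Γ * b₂ z)
    (hb₄ : ∀ z ∈ tsupport η, |b₄ z| ≤ Γ * b₂ z)
    (hb₂0 : ∀ z, 0 ≤ b₂ z)
    {u : F → ℂ} {du ddu : J → F → ℂ} (hu : MemL2Loc u) (hdus : ∀ j, MemL2Loc (du j))
    (hddus : ∀ j, MemL2Loc (ddu j)) (hdu : ∀ j, IsWeakDeriv (E j) u (du j))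
    (hddu : ∀ j, IsWeakDeriv (E j) (du j) (ddu j))
    (hH1 : ∀ z, H z ≤ 1) (hH0 : ∀ z, 0 ≤ H z)
    (hpde : ∀ᵐ z, ‖∑ j, ddu j z‖ ^ 2 ≤
      2 * C ^ 2 * (P z * ‖u z‖ ^ 2 + H z * ∑ j, ‖du j z‖ ^ 2))
    (hdη : ∀ j z, |dirDeriv (E j) η z| ≤ B * ζ z)
    (hddη : ∀ j z, |dirDeriv (E j) (dirDeriv (E j) η) z| ≤ B * ζ z)
    (hHb : ∀ z ∈ tsupport η, 704 * C ^ 2 * H z ≤ b₂ z)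
    (hPb : ∀ z ∈ tsupport η, 352 * C ^ 2 * P z ≤ b₂ z * K ^ 2) :
    ∫ z, ‖(Real.exp (φ z) * √(b₂ z) * K * η z) • u z‖ ^ 2 ≤
      2 * cutoffConstant (Fintype.card J) B C * ((∫ z, ‖(ζ z * Real.exp (φ z)) • u z‖ ^ 2)
        + ∑ j, ∫ z, ‖(ζ z * Real.exp (φ z)) • du j z‖ ^ 2) := by
  have carl := h.carleman_weak hη hηc hK hN hKΓ hKM hb₁ ha₁ hb₂ hb₃ hb₄ hb₂0 hu hdus hddus hdu hddu
  have hex : Continuous fun z => Real.exp (φ z) := h.contDiff.exp.continuous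
  have hsq : Continuous fun z => √(b₂ z) := h.contDiff_b₂.continuous.sqrt
  have hηc' := hη.continuous
  have hζ' := hζ.continuous
  have hdη' : ∀ j, Continuous (dirDeriv (E j) η) := fun j => (hη.dirDeriv _).continuous
  have hddη' : ∀ j, Continuous (dirDeriv (E j) (dirDeriv (E j) η)) := fun j =>
    ((hη.dirDeriv _).dirDeriv _).continuous
  have hsη : ∀ j, HasCompactSupport (dirDeriv (E j) η) := fun j => hηc.dirDeriv _
  have hssη : ∀ j, HasCompactSupport (dirDeriv (E j) (dirDeriv (E j) η)) := fun j =>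
    (hηc.dirDeriv _).dirDeriv _
  have iA : ∀ j, Integrable fun z => ‖(Real.exp (φ z) * √(b₂ z) * η z) • du j z
        + (Real.exp (φ z) * √(b₂ z) * dirDeriv (E j) η z) • u z‖ ^ 2 := fun j =>
    (((hdus j).memLp_smul (by fun_prop) hηc.mul_left).add
      (hu.memLp_smul (by fun_prop) (hsη j).mul_left)).integrable_norm_sq
  have iD : Integrable fun z => ‖(Real.exp (φ z) * √(b₂ z) * K * η z) • u z‖ ^ 2 :=
    (hu.memLp_smul (by fun_prop) hηc.mul_left).integrable_norm_sq
  have iT : Integrable fun z => ‖∑ j, ((Real.exp (φ z) * η z) • ddu j z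
        + (2 * Real.exp (φ z) * dirDeriv (E j) η z) • du j z
        + (Real.exp (φ z) * dirDeriv (E j) (dirDeriv (E j) η) z) • u z)‖ ^ 2 :=
    (memLp_finsetSum _ fun j _ => (((hddus j).memLp_smul (by fun_prop) hηc.mul_left).add
      ((hdus j).memLp_smul (by fun_prop) (hsη j).mul_left)).add
      (hu.memLp_smul (by fun_prop) (hssη j).mul_left)).integrable_norm_sq
  have iU : Integrable fun z => ‖(ζ z * Real.exp (φ z)) • u z‖ ^ 2 :=
    (hu.memLp_smul (by fun_prop) hζc.mul_right).integrable_norm_sq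
  have iG : ∀ j, Integrable fun z => ‖(ζ z * Real.exp (φ z)) • du j z‖ ^ 2 := fun j =>
    ((hdus j).memLp_smul (by fun_prop) hζc.mul_right).integrable_norm_sq
  set c := cutoffConstant (Fintype.card J) B C with hc
  have hc0 : 0 ≤ c := by
    rw [hc, cutoffConstant]
    positivity
  have iAD : Integrable fun z => 1 / 2 * (∑ j, ‖(Real.exp (φ z) * √(b₂ z) * η z) • du j z
        + (Real.exp (φ z) * √(b₂ z) * dirDeriv (E j) η z) • u z‖ ^ 2
        + ‖(Real.exp (φ z) * √(b₂ z) * K * η z) • u z‖ ^ 2) :=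
    ((integrable_finsetSum _ fun j _ => iA j).add iD).const_mul _
  have iUG : Integrable fun z => c * (‖(ζ z * Real.exp (φ z)) • u z‖ ^ 2
        + ∑ j, ‖(ζ z * Real.exp (φ z)) • du j z‖ ^ 2) :=
    (iU.add (integrable_finsetSum _ fun j _ => iG j)).const_mul _
  -- The factor `1 / 2` lets the first group be moved to the left side of `carl`.
  have bound : 44 * ∫ z, ‖∑ j, ((Real.exp (φ z) * η z) • ddu j z
        + (2 * Real.exp (φ z) * dirDeriv (E j) η z) • du j z
        + (Real.exp (φ z) * dirDeriv (E j) (dirDeriv (E j) η) z) • u z)‖ ^ 2 ≤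
      1 / 2 * ((∑ j, ∫ z, ‖(Real.exp (φ z) * √(b₂ z) * η z) • du j z
        + (Real.exp (φ z) * √(b₂ z) * dirDeriv (E j) η z) • u z‖ ^ 2)
        + ∫ z, ‖(Real.exp (φ z) * √(b₂ z) * K * η z) • u z‖ ^ 2)
      + c * ((∫ z, ‖(ζ z * Real.exp (φ z)) • u z‖ ^ 2)
        + ∑ j, ∫ z, ‖(ζ z * Real.exp (φ z)) • du j z‖ ^ 2) := by
    rw [← integral_const_mul, ← integral_finsetSum _ fun j _ => iA j,
      ← integral_finsetSum _ fun j _ => iG j,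
      ← integral_add (integrable_finsetSum _ fun j _ => iA j) iD,
      ← integral_add iU (integrable_finsetSum _ fun j _ => iG j),
      ← integral_const_mul, ← integral_const_mul, ← integral_add iAD iUG]
    refine integral_mono_ae (iT.const_mul _) (iAD.add iUG) ?_
    filter_upwards [hpde] with z hz
    by_cases hzη : z ∈ tsupport η
    · exact cutoff_error_bound (hH1 z) (hH0 z) (hb₂0 z) hz (fun j => hdη j z) (fun j => hddη j z)
        (hHb z hzη) (hPb z hzη)
    · have z0 : η z = 0 := image_eq_zero_of_notMem_tsupport hzη
      have z1 : ∀ j, dirDeriv (E j) η z = 0 := fun j => dirDeriv_eq_zero_of_notMem hzη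
      have z2 : ∀ j, dirDeriv (E j) (dirDeriv (E j) η) z = 0 := fun j =>
        dirDeriv_eq_zero_of_notMem fun hz' => hzη (tsupport_dirDeriv_subset _ _ hz')
      have p1 : 0 ≤ c * (‖(ζ z * Real.exp (φ z)) • u z‖ ^ 2 +
        ∑ j, ‖(ζ z * Real.exp (φ z)) • du j z‖ ^ 2) := by positivity
      simpa [z0, z1, z2] using p1
  have pA : 0 ≤ ∑ j, ∫ z, ‖(Real.exp (φ z) * √(b₂ z) * η z) • du j z
        + (Real.exp (φ z) * √(b₂ z) * dirDeriv (E j) η z) • u z‖ ^ 2 :=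
    Finset.sum_nonneg fun j _ => integral_nonneg fun z => by positivity
  linarith

/-- Weighted gradient bound from the differential inequality. -/
theorem weighted_gradient_bound [Nonempty J] {ξ : F → ℝ} (hξ : ContDiff ℝ ∞ ξ)
    (hξc : HasCompactSupport ξ) {C : ℝ} (hC : 0 < C) {P H : F → ℝ}
    {u : F → ℂ} {du ddu : J → F → ℂ} (hu : MemL2Loc u) (hdus : ∀ j, MemL2Loc (du j))
    (hddus : ∀ j, MemL2Loc (ddu j)) (hdu : ∀ j, IsWeakDeriv (E j) u (du j))
    (hddu : ∀ j, IsWeakDeriv (E j) (du j) (ddu j))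
    (hH1 : ∀ z, H z ≤ 1) (hP1 : ∀ z, P z ≤ 1)
    (hpde : ∀ᵐ z, ‖∑ j, ddu j z‖ ^ 2 ≤
      2 * C ^ 2 * (P z * ‖u z‖ ^ 2 + H z * ∑ j, ‖du j z‖ ^ 2)) :
    ∑ j, ∫ z, ‖ξ z • du j z‖ ^ 2 ≤
      (1 + 8 * C ^ 2) * (∫ z, ‖ξ z • u z‖ ^ 2)
        + 8 * ∑ j, ∫ z, ‖dirDeriv (E j) ξ z • u z‖ ^ 2 := by
  -- With `δ = 1 / (8 C²)` the second-order term is `2 δ · 2 C² = 1/2` times the integrals of `u`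
  -- and its gradient, so the gradient can be absorbed.
  have hδ : 0 < 1 / (8 * C ^ 2) := by positivity
  have cac := caccioppoli_weak hξ hξc hδ hu hdus hddus hdu hddu
  have hξ' := hξ.continuous
  have iT : Integrable fun z => ‖∑ j, ξ z • ddu j z‖ ^ 2 :=
    (memLp_finsetSum _ fun j _ => (hddus j).memLp_smul hξ' hξc).integrable_norm_sq
  have iU : Integrable fun z => ‖ξ z • u z‖ ^ 2 := (hu.memLp_smul hξ' hξc).integrable_norm_sq
  have iG : ∀ j, Integrable fun z => ‖ξ z • du j z‖ ^ 2 := fun j =>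
    ((hdus j).memLp_smul hξ' hξc).integrable_norm_sq
  have bound : ∫ z, ‖∑ j, ξ z • ddu j z‖ ^ 2 ≤
      2 * C ^ 2 * ((∫ z, ‖ξ z • u z‖ ^ 2) + ∑ j, ∫ z, ‖ξ z • du j z‖ ^ 2) := by
    rw [← integral_finsetSum _ fun j _ => iG j,
      ← integral_add iU (integrable_finsetSum _ fun j _ => iG j), ← integral_const_mul]
    refine integral_mono_ae iT
      ((iU.add (integrable_finsetSum _ fun j _ => iG j)).const_mul _) ?_
    filter_upwards [hpde] with z hz
    simp_rw [norm_real_smul_sq]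
    rw [← Finset.smul_sum, norm_real_smul_sq, ← Finset.mul_sum]
    have h1 : P z * ‖u z‖ ^ 2 + H z * ∑ j, ‖du j z‖ ^ 2 ≤ ‖u z‖ ^ 2 + ∑ j, ‖du j z‖ ^ 2 := by
      refine add_le_add ?_ ?_
      · exact mul_le_of_le_one_left (by positivity) (hP1 z)
      · exact mul_le_of_le_one_left (by positivity) (hH1 z)
    calc ξ z ^ 2 * ‖∑ j, ddu j z‖ ^ 2
        ≤ ξ z ^ 2 * (2 * C ^ 2 * (‖u z‖ ^ 2 + ∑ j, ‖du j z‖ ^ 2)) := by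
          refine mul_le_mul_of_nonneg_left (hz.trans ?_) (sq_nonneg _)
          exact mul_le_mul_of_nonneg_left h1 (by positivity)
      _ = _ := by ring
  have h1 : 2 * (1 / (8 * C ^ 2)) * ∫ z, ‖∑ j, ξ z • ddu j z‖ ^ 2 ≤
      1 / 2 * ((∫ z, ‖ξ z • u z‖ ^ 2) + ∑ j, ∫ z, ‖ξ z • du j z‖ ^ 2) := by
    calc _ ≤ 2 * (1 / (8 * C ^ 2)) *
        (2 * C ^ 2 * ((∫ z, ‖ξ z • u z‖ ^ 2) + ∑ j, ∫ z, ‖ξ z • du j z‖ ^ 2)) :=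
          mul_le_mul_of_nonneg_left bound (by positivity)
      _ = _ := by
        field_simp
        ring
  have h2 : 1 / (2 * (1 / (8 * C ^ 2))) = 4 * C ^ 2 := by
    field_simp
    norm_num
  rw [h2] at cac
  linarith

/-- The weighted `L²` bound for `u` obtained from the Carleman and Caccioppoli inequalities. -/
theorem IsSeparatedWeight.weighted_bound (h : IsSeparatedWeight E j₀ j₁ N φ a₁ b₁ b₂ b₃ b₄)
    {η ζ : F → ℝ} (hη : ContDiff ℝ ∞ η) (hηc : HasCompactSupport η) (hζ : ContDiff ℝ ∞ ζ)
    (hζc : HasCompactSupport ζ) {K M Γ B C : ℝ} (hC : 0 < C) {P H : F → ℝ}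
    (hK : 1 ≤ K) (hN : 0 ≤ N) (hKΓ : 40 * Γ ≤ K) (hKM : 100 * M ≤ K ^ 2)
    (hb₁ : ∀ z ∈ tsupport η, K / 2 ≤ b₁ z ∧ b₁ z ≤ 2 * K)
    (ha₁ : ∀ z ∈ tsupport η, |a₁ z| ≤ K / 8)
    (hb₂ : ∀ z ∈ tsupport η, 8 * N ≤ b₂ z ∧ b₂ z ≤ 2 * M)
    (hb₃ : ∀ z ∈ tsupport η, |b₃ z| ≤ Γ * b₂ z)
    (hb₄ : ∀ z ∈ tsupport η, |b₄ z| ≤ Γ * b₂ z)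
    (hb₂0 : ∀ z, 0 ≤ b₂ z)
    {u : F → ℂ} {du ddu : J → F → ℂ} (hu : MemL2Loc u) (hdus : ∀ j, MemL2Loc (du j))
    (hddus : ∀ j, MemL2Loc (ddu j)) (hdu : ∀ j, IsWeakDeriv (E j) u (du j))
    (hddu : ∀ j, IsWeakDeriv (E j) (du j) (ddu j))
    (hH1 : ∀ z, H z ≤ 1) (hH0 : ∀ z, 0 ≤ H z) (hP1 : ∀ z, P z ≤ 1)
    (hpde : ∀ᵐ z, ‖∑ j, ddu j z‖ ^ 2 ≤
      2 * C ^ 2 * (P z * ‖u z‖ ^ 2 + H z * ∑ j, ‖du j z‖ ^ 2))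
    (hdη : ∀ j z, |dirDeriv (E j) η z| ≤ B * ζ z)
    (hddη : ∀ j z, |dirDeriv (E j) (dirDeriv (E j) η) z| ≤ B * ζ z)
    (hHb : ∀ z ∈ tsupport η, 704 * C ^ 2 * H z ≤ b₂ z)
    (hPb : ∀ z ∈ tsupport η, 352 * C ^ 2 * P z ≤ b₂ z * K ^ 2)
    (hζ1 : ∀ z, |ζ z| ≤ 1) (hdζ : ∀ j z, |dirDeriv (E j) ζ z| ≤ B)
    (hgrad : ∀ z ∈ tsupport ζ, a₁ z ^ 2 + b₁ z ^ 2 ≤ 5 * K ^ 2) :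
    ∫ z, b₂ z * (Real.exp (φ z) * η z) ^ 2 * ‖u z‖ ^ 2 ≤
      2 * cutoffConstant (Fintype.card J) B C *
        (2 + 8 * C ^ 2 + 16 * (Fintype.card J * B ^ 2 + 5)) *
        ∫ z in tsupport ζ, Real.exp (φ z) ^ 2 * ‖u z‖ ^ 2 := by
  have : Nonempty J := ⟨j₀⟩
  have habs := h.absorb hη hηc hζ hζc hK hN hKΓ hKM hb₁ ha₁ hb₂ hb₃ hb₄ hb₂0 hu hdus hddus hdu hddu
    hH1 hH0 hpde hdη hddη hHb hPb
  have hexp : ContDiff ℝ ∞ fun z => Real.exp (φ z) := h.contDiff.exp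
  have hξ : ContDiff ℝ ∞ fun z => ζ z * Real.exp (φ z) := hζ.mul hexp
  have hξc : HasCompactSupport fun z => ζ z * Real.exp (φ z) := hζc.mul_right
  have hgr := weighted_gradient_bound hξ hξc hC hu hdus hddus hdu hddu hH1 hP1 hpde
  set c := cutoffConstant (Fintype.card J) B C with hc
  have hc0 : 0 ≤ c := by
    rw [hc, cutoffConstant]
    positivity
  set d : ℝ := (Fintype.card J : ℝ) with hd
  have hd0 : 0 ≤ d := Nat.cast_nonneg _
  have hKpos : 0 < K := by linarith
  have iu : Integrable (fun z => Real.exp (φ z) ^ 2 * ‖u z‖ ^ 2) (volume.restrict (tsupport ζ)) := by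
    have h1 : IntegrableOn (fun z => ‖u z‖ ^ 2) (tsupport ζ) :=
      (hu _ hζc).integrable_norm_pow two_ne_zero
    exact h1.continuousOn_mul (hexp.continuous.pow 2).continuousOn hζc
  set I := ∫ z in tsupport ζ, Real.exp (φ z) ^ 2 * ‖u z‖ ^ 2 with hI
  have hI0 : 0 ≤ I := integral_nonneg fun z => by positivity
  have l1 : ∫ z, ‖(ζ z * Real.exp (φ z)) • u z‖ ^ 2 ≤ I := by
    have hzero : ∀ z, z ∉ tsupport ζ → ‖(ζ z * Real.exp (φ z)) • u z‖ ^ 2 = 0 := fun z hz => by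
      simp [image_eq_zero_of_notMem_tsupport hz]
    rw [← setIntegral_eq_integral_of_forall_compl_eq_zero hzero]
    refine integral_mono_ae ((hu.memLp_smul hξ.continuous hξc).integrable_norm_sq).integrableOn
      iu (ae_of_all _ fun z => ?_)
    beta_reduce
    rw [norm_real_smul_sq, mul_pow]
    have : ζ z ^ 2 ≤ 1 := by
      rw [← sq_abs]
      exact pow_le_one₀ (abs_nonneg _) (hζ1 z)
    have h0 : 0 ≤ Real.exp (φ z) ^ 2 * ‖u z‖ ^ 2 := by positivity
    nlinarith
  have l2 : ∑ j, ∫ z, ‖dirDeriv (E j) (fun z => ζ z * Real.exp (φ z)) z • u z‖ ^ 2 ≤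
      2 * (d * B ^ 2 + 5 * K ^ 2) * I := by
    have hi : ∀ j, Integrable fun z =>
        ‖dirDeriv (E j) (fun z => ζ z * Real.exp (φ z)) z • u z‖ ^ 2 := fun j =>
      (hu.memLp_smul (hξ.dirDeriv _).continuous (hξc.dirDeriv _)).integrable_norm_sq
    rw [← integral_finsetSum _ fun j _ => hi j]
    have hzero : ∀ z, z ∉ tsupport ζ →
        ∑ j, ‖dirDeriv (E j) (fun z => ζ z * Real.exp (φ z)) z • u z‖ ^ 2 = 0 := fun z hz => by
      refine Finset.sum_eq_zero fun j _ => ?_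
      rw [dirDeriv_mul hζ hexp, image_eq_zero_of_notMem_tsupport hz, dirDeriv_eq_zero_of_notMem hz]
      simp
    rw [← setIntegral_eq_integral_of_forall_compl_eq_zero hzero, hI, ← integral_const_mul]
    refine setIntegral_mono_on (integrable_finsetSum _ fun j _ => hi j).integrableOn
      (iu.const_mul _) (isClosed_tsupport ζ).measurableSet fun z hz => ?_
    have e1 : ∀ j, ‖dirDeriv (E j) (fun z => ζ z * Real.exp (φ z)) z • u z‖ ^ 2 ≤
        2 * (B ^ 2 + dirDeriv (E j) φ z ^ 2) * (Real.exp (φ z) ^ 2 * ‖u z‖ ^ 2) := fun j => by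
      rw [norm_real_smul_sq, dirDeriv_mul hζ hexp, dirDeriv_exp h.contDiff,
        ← mul_assoc (2 * (B ^ 2 + dirDeriv (E j) φ z ^ 2))]
      refine mul_le_mul_of_nonneg_right ?_ (sq_nonneg ‖u z‖)
      have s1 : dirDeriv (E j) ζ z ^ 2 ≤ B ^ 2 := by
        rw [← sq_abs]
        have := hdζ j z
        gcongr
      have s2 : ζ z ^ 2 ≤ 1 := by
        rw [← sq_abs]
        exact pow_le_one₀ (abs_nonneg _) (hζ1 z)
      have s3 : (dirDeriv (E j) ζ z + ζ z * dirDeriv (E j) φ z) ^ 2 ≤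
          2 * (B ^ 2 + dirDeriv (E j) φ z ^ 2) := by
        nlinarith [sq_nonneg (dirDeriv (E j) ζ z - ζ z * dirDeriv (E j) φ z),
          mul_le_mul_of_nonneg_right s2 (sq_nonneg (dirDeriv (E j) φ z))]
      calc _ = (dirDeriv (E j) ζ z + ζ z * dirDeriv (E j) φ z) ^ 2 * Real.exp (φ z) ^ 2 := by ring
        _ ≤ _ := mul_le_mul_of_nonneg_right s3 (sq_nonneg _)
    refine (Finset.sum_le_sum fun j _ => e1 j).trans ?_
    rw [← Finset.sum_mul, ← Finset.mul_sum, Finset.sum_add_distrib, h.sum_deriv_sq,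
      Finset.sum_const, Finset.card_univ, nsmul_eq_mul, ← hd]
    refine mul_le_mul_of_nonneg_right ?_ (by positivity)
    linarith [hgrad z hz]
  have l3 : ∫ z, ‖(Real.exp (φ z) * √(b₂ z) * K * η z) • u z‖ ^ 2 =
      K ^ 2 * ∫ z, b₂ z * (Real.exp (φ z) * η z) ^ 2 * ‖u z‖ ^ 2 := by
    rw [← integral_const_mul]
    congr 1
    funext z
    rw [norm_real_smul_sq, mul_pow, mul_pow, mul_pow, Real.sq_sqrt (hb₂0 z)]
    ring
  rw [l3] at habs
  have hK2 : 1 ≤ K ^ 2 := one_le_pow₀ hK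
  have l4 : (∫ z, ‖(ζ z * Real.exp (φ z)) • u z‖ ^ 2)
        + ∑ j, ∫ z, ‖(ζ z * Real.exp (φ z)) • du j z‖ ^ 2 ≤
      K ^ 2 * ((2 + 8 * C ^ 2 + 16 * (d * B ^ 2 + 5)) * I) := by
    have s1 : (2 + 8 * C ^ 2) * ∫ z, ‖(ζ z * Real.exp (φ z)) • u z‖ ^ 2 ≤
        (2 + 8 * C ^ 2) * I := mul_le_mul_of_nonneg_left l1 (by positivity)
    have s2 : 1 * ((2 + 8 * C ^ 2 + 16 * (d * B ^ 2)) * I) ≤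
        K ^ 2 * ((2 + 8 * C ^ 2 + 16 * (d * B ^ 2)) * I) :=
      mul_le_mul_of_nonneg_right hK2 (by positivity)
    linarith
  have l5 := habs.trans (mul_le_mul_of_nonneg_left l4 (by positivity : 0 ≤ 2 * c))
  have l6 : K ^ 2 * ∫ z, b₂ z * (Real.exp (φ z) * η z) ^ 2 * ‖u z‖ ^ 2 ≤
      K ^ 2 * (2 * c * (2 + 8 * C ^ 2 + 16 * (d * B ^ 2 + 5)) * I) := by linarith
  -- The `K²` gained from the Carleman inequality cancels the `K²` lost by differentiating `e^φ`;
  -- the constant is therefore independent of `K`, and later of `R`.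
  exact le_of_mul_le_mul_left l6 (by positivity)

end Absorption


/-! ### The convex profile `(1 + s²)^m` -/

section Profile

theorem hasDerivAt_one_add_sq_rpow (q s : ℝ) :
    HasDerivAt (fun s : ℝ => (1 + s ^ 2) ^ q) (2 * q * s * (1 + s ^ 2) ^ (q - 1)) s := by
  have h1 : HasDerivAt (fun s : ℝ => 1 + s ^ 2) (2 * s) s := by
    simpa using (hasDerivAt_pow 2 s).const_add 1
  have h2 := h1.rpow_const (p := q) (Or.inl (by positivity))
  convert h2 using 1
  ring

theorem contDiff_one_add_sq_rpow (q : ℝ) : ContDiff ℝ ∞ fun s : ℝ => (1 + s ^ 2) ^ q :=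
  (contDiff_const.add (contDiff_id.pow 2)).rpow_const_of_ne fun s => by
    have : (0 : ℝ) < 1 + s ^ 2 := by positivity
    exact this.ne'

/-- First derivative of `(1 + s²)^m`. -/
def profileDeriv₁ (m s : ℝ) : ℝ := 2 * m * s * (1 + s ^ 2) ^ (m - 1)

/-- Second derivative of `(1 + s²)^m`. -/
def profileDeriv₂ (m s : ℝ) : ℝ :=
  2 * m * (2 * m - 1) * (1 + s ^ 2) ^ (m - 1) + 4 * m * (1 - m) * (1 + s ^ 2) ^ (m - 2)

/-- Third derivative of `(1 + s²)^m`. -/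
def profileDeriv₃ (m s : ℝ) : ℝ :=
  2 * s * (2 * m * (2 * m - 1) * (m - 1) * (1 + s ^ 2) ^ (m - 2)
    + 4 * m * (1 - m) * (m - 2) * (1 + s ^ 2) ^ (m - 3))

/-- Fourth derivative of `(1 + s²)^m`. -/
def profileDeriv₄ (m s : ℝ) : ℝ :=
  2 * (2 * m * (2 * m - 1) * (m - 1) * (1 + s ^ 2) ^ (m - 2)
    + 4 * m * (1 - m) * (m - 2) * (1 + s ^ 2) ^ (m - 3))
  + 4 * s ^ 2 * (2 * m * (2 * m - 1) * (m - 1) * (m - 2) * (1 + s ^ 2) ^ (m - 3)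
    + 4 * m * (1 - m) * (m - 2) * (m - 3) * (1 + s ^ 2) ^ (m - 4))

theorem contDiff_profileDeriv₁ (m : ℝ) : ContDiff ℝ ∞ (profileDeriv₁ m) :=
  (contDiff_const.mul contDiff_id).mul (contDiff_one_add_sq_rpow _)

theorem contDiff_profileDeriv₂ (m : ℝ) : ContDiff ℝ ∞ (profileDeriv₂ m) :=
  (contDiff_const.mul (contDiff_one_add_sq_rpow _)).add
    (contDiff_const.mul (contDiff_one_add_sq_rpow _))

theorem contDiff_profileDeriv₃ (m : ℝ) : ContDiff ℝ ∞ (profileDeriv₃ m) :=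
  (contDiff_const.mul contDiff_id).mul ((contDiff_const.mul (contDiff_one_add_sq_rpow _)).add
    (contDiff_const.mul (contDiff_one_add_sq_rpow _)))

theorem one_add_sq_rpow_sub_one (q s : ℝ) :
    (1 + s ^ 2) ^ (q - 1) = (1 + s ^ 2) ^ q / (1 + s ^ 2) :=
  Real.rpow_sub_one (by positivity) q

theorem hasDerivAt_profileDeriv₁ (m s : ℝ) :
    HasDerivAt (profileDeriv₁ m) (profileDeriv₂ m s) s := by
  have h := ((hasDerivAt_id s).const_mul (2 * m)).mul (hasDerivAt_one_add_sq_rpow (m - 1) s)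
  have h' : HasDerivAt (profileDeriv₁ m) _ s := h
  convert h' using 1
  simp only [profileDeriv₂, id_eq, mul_one]
  rw [show m - 2 = m - 1 - 1 by ring, one_add_sq_rpow_sub_one (m - 1)]
  field_simp
  ring

theorem hasDerivAt_profileDeriv₂ (m s : ℝ) :
    HasDerivAt (profileDeriv₂ m) (profileDeriv₃ m s) s := by
  have h := ((hasDerivAt_one_add_sq_rpow (m - 1) s).const_mul (2 * m * (2 * m - 1))).add
    ((hasDerivAt_one_add_sq_rpow (m - 2) s).const_mul (4 * m * (1 - m)))
  have h' : HasDerivAt (profileDeriv₂ m) _ s := h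
  convert h' using 1
  simp only [profileDeriv₃]
  rw [show m - 1 - 1 = m - 2 by ring, show m - 2 - 1 = m - 3 by ring]
  ring

theorem hasDerivAt_profileDeriv₃ (m s : ℝ) :
    HasDerivAt (profileDeriv₃ m) (profileDeriv₄ m s) s := by
  have h := ((hasDerivAt_id s).const_mul 2).mul
    (((hasDerivAt_one_add_sq_rpow (m - 2) s).const_mul (2 * m * (2 * m - 1) * (m - 1))).add
    ((hasDerivAt_one_add_sq_rpow (m - 3) s).const_mul (4 * m * (1 - m) * (m - 2))))
  have h' : HasDerivAt (profileDeriv₃ m) _ s := h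
  convert h' using 1
  simp only [profileDeriv₄, id_eq, Pi.add_apply]
  rw [show m - 2 - 1 = m - 3 by ring, show m - 3 - 1 = m - 4 by ring]
  ring

variable {m : ℝ}

/-- For `1/2 < m < 1` both summands of the second derivative are positive. The coefficient kept here
is the `γ` of the later estimates. -/
theorem profileDeriv₂_lower (hm : 1 / 2 < m) (hm' : m ≤ 2 / 3) (s : ℝ) :
    2 * m * (2 * m - 1) * (1 + s ^ 2) ^ (m - 1) ≤ profileDeriv₂ m s := by
  rw [profileDeriv₂]
  have : 0 ≤ 4 * m * (1 - m) * (1 + s ^ 2) ^ (m - 2) := by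
    have h1 : 0 ≤ 1 - m := by linarith
    have h2 : 0 ≤ m := by linarith
    positivity
  linarith

theorem one_add_sq_rpow_le_one {q : ℝ} (hq : q ≤ 0) (s : ℝ) : (1 + s ^ 2) ^ q ≤ 1 :=
  Real.rpow_le_one_of_one_le_of_nonpos (by nlinarith [sq_nonneg s]) hq

theorem one_add_sq_rpow_succ_le (q s : ℝ) : (1 + s ^ 2) ^ (q - 1) ≤ (1 + s ^ 2) ^ q :=
  Real.rpow_le_rpow_of_exponent_le (by nlinarith [sq_nonneg s]) (by linarith)

theorem profileDeriv₂_upper (hm : 1 / 2 < m) (hm' : m ≤ 2 / 3) (s : ℝ) :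
    profileDeriv₂ m s ≤ 2 := by
  rw [profileDeriv₂]
  have h1 := one_add_sq_rpow_le_one (q := m - 1) (by linarith) s
  have h2 := one_add_sq_rpow_le_one (q := m - 2) (by linarith) s
  have c1 : 0 ≤ 2 * m * (2 * m - 1) := mul_nonneg (by linarith) (by linarith)
  have c2 : 0 ≤ 4 * m * (1 - m) := mul_nonneg (by linarith) (by linarith)
  have t1 := mul_le_mul_of_nonneg_left h1 c1
  have t2 := mul_le_mul_of_nonneg_left h2 c2
  nlinarith

/-- Higher derivatives have to be bounded by multiples of the second one. The factor `|s| ≤ 1 + s²`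
is paid for by the smaller exponent `m - 2`. -/
theorem abs_profileDeriv₃_le (hm : 1 / 2 < m) (hm' : m ≤ 2 / 3) (s : ℝ) :
    |profileDeriv₃ m s| ≤ 40 * (1 + s ^ 2) ^ (m - 1) := by
  set r := 1 + s ^ 2 with hr
  have hr0 : 0 < r := by positivity
  set x := r ^ (m - 1) with hx
  have hx0 : 0 ≤ x := by positivity
  have e2 : r ^ (m - 2) = x / r := by
    rw [hx, hr, ← one_add_sq_rpow_sub_one]
    ring_nf
  have h3 : r ^ (m - 3) ≤ r ^ (m - 2) := by
    have := one_add_sq_rpow_succ_le (m - 2) s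
    rwa [show m - 2 - 1 = m - 3 by ring] at this
  have h30 : 0 ≤ r ^ (m - 3) := by positivity
  have h20 : 0 ≤ r ^ (m - 2) := by positivity
  have c1 : |2 * m * (2 * m - 1) * (m - 1)| ≤ 1 := by
    rw [abs_mul, abs_of_nonneg (mul_nonneg (by linarith) (by linarith) : 0 ≤ 2 * m * (2 * m - 1)),
      abs_of_nonpos (by linarith)]
    nlinarith [mul_nonneg (show 0 ≤ m by linarith) (show 0 ≤ 2 * m - 1 by linarith)]
  have c2 : |4 * m * (1 - m) * (m - 2)| ≤ 2 := by
    rw [abs_mul, abs_of_nonneg (mul_nonneg (by linarith) (by linarith) : 0 ≤ 4 * m * (1 - m)),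
      abs_of_nonpos (by linarith)]
    have : 4 * m * (1 - m) ≤ 1 := by nlinarith [sq_nonneg (2 * m - 1)]
    nlinarith
  have h1 : |2 * m * (2 * m - 1) * (m - 1) * r ^ (m - 2)
      + 4 * m * (1 - m) * (m - 2) * r ^ (m - 3)| ≤ 3 * r ^ (m - 2) := by
    refine (abs_add_le _ _).trans ?_
    rw [abs_mul _ (r ^ (m - 2)), abs_mul _ (r ^ (m - 3)), abs_of_nonneg h20, abs_of_nonneg h30]
    nlinarith
  have hs : |s| ≤ r := by
    rw [hr]
    nlinarith [sq_nonneg (|s| - 1), sq_abs s]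
  rw [profileDeriv₃, abs_mul, abs_mul, abs_two]
  calc 2 * |s| * _ ≤ 2 * r * (3 * r ^ (m - 2)) := by gcongr
    _ = 6 * x := by
      rw [e2]
      field_simp
      ring
    _ ≤ 40 * x := by linarith

theorem abs_profileDeriv₄_le (hm : 1 / 2 < m) (hm' : m ≤ 2 / 3) (s : ℝ) :
    |profileDeriv₄ m s| ≤ 40 * (1 + s ^ 2) ^ (m - 1) := by
  set r := 1 + s ^ 2 with hr
  have hr0 : 0 < r := by positivity
  set x := r ^ (m - 1) with hx
  have hx0 : 0 ≤ x := by positivity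
  have h2 : r ^ (m - 2) ≤ x := by
    have := one_add_sq_rpow_succ_le (m - 1) s
    rwa [show m - 1 - 1 = m - 2 by ring] at this
  have h3 : r ^ (m - 3) ≤ r ^ (m - 2) := by
    have := one_add_sq_rpow_succ_le (m - 2) s
    rwa [show m - 2 - 1 = m - 3 by ring] at this
  have h4 : r ^ (m - 4) ≤ r ^ (m - 3) := by
    have := one_add_sq_rpow_succ_le (m - 3) s
    rwa [show m - 3 - 1 = m - 4 by ring] at this
  have e3 : r * r ^ (m - 3) = r ^ (m - 2) := by
    rw [show m - 3 = m - 2 - 1 by ring, hr, one_add_sq_rpow_sub_one]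
    field_simp
  have h30 : 0 ≤ r ^ (m - 3) := by positivity
  have h20 : 0 ≤ r ^ (m - 2) := by positivity
  have h40 : 0 ≤ r ^ (m - 4) := by positivity
  have c1 : |2 * m * (2 * m - 1) * (m - 1)| ≤ 1 := by
    rw [abs_mul, abs_of_nonneg (mul_nonneg (by linarith) (by linarith) : 0 ≤ 2 * m * (2 * m - 1)),
      abs_of_nonpos (by linarith)]
    nlinarith [mul_nonneg (show 0 ≤ m by linarith) (show 0 ≤ 2 * m - 1 by linarith)]
  have c2 : |4 * m * (1 - m) * (m - 2)| ≤ 2 := by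
    rw [abs_mul, abs_of_nonneg (mul_nonneg (by linarith) (by linarith) : 0 ≤ 4 * m * (1 - m)),
      abs_of_nonpos (by linarith)]
    have : 4 * m * (1 - m) ≤ 1 := by nlinarith [sq_nonneg (2 * m - 1)]
    nlinarith
  have d2 : |m - 2| ≤ 2 := abs_le.2 ⟨by linarith, by linarith⟩
  have d3 : |m - 3| ≤ 3 := abs_le.2 ⟨by linarith, by linarith⟩
  have t1 : |2 * m * (2 * m - 1) * (m - 1) * r ^ (m - 2)
      + 4 * m * (1 - m) * (m - 2) * r ^ (m - 3)| ≤ 3 * r ^ (m - 2) := by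
    refine (abs_add_le _ _).trans ?_
    rw [abs_mul _ (r ^ (m - 2)), abs_mul _ (r ^ (m - 3)), abs_of_nonneg h20, abs_of_nonneg h30]
    nlinarith
  have t2 : |2 * m * (2 * m - 1) * (m - 1) * (m - 2) * r ^ (m - 3)
      + 4 * m * (1 - m) * (m - 2) * (m - 3) * r ^ (m - 4)| ≤ 8 * r ^ (m - 3) := by
    refine (abs_add_le _ _).trans ?_
    rw [abs_mul _ (r ^ (m - 3)), abs_mul _ (r ^ (m - 4)), abs_of_nonneg h30, abs_of_nonneg h40,
      abs_mul _ (m - 2), abs_mul _ (m - 3)]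
    have q1 : |2 * m * (2 * m - 1) * (m - 1)| * |m - 2| ≤ 1 * 2 :=
      mul_le_mul c1 d2 (abs_nonneg _) (by norm_num)
    have q2 : |4 * m * (1 - m) * (m - 2)| * |m - 3| ≤ 2 * 3 :=
      mul_le_mul c2 d3 (abs_nonneg _) (by norm_num)
    have q3 := mul_le_mul_of_nonneg_right q1 h30
    have q4 := mul_le_mul_of_nonneg_right q2 h40
    linarith
  have hs : s ^ 2 ≤ r := by
    rw [hr]
    linarith
  rw [profileDeriv₄]
  refine (abs_add_le _ _).trans ?_
  rw [abs_mul 2, abs_two, abs_mul (4 * s ^ 2), abs_of_nonneg (by positivity : 0 ≤ 4 * s ^ 2)]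
  have t3 : 4 * s ^ 2 * |2 * m * (2 * m - 1) * (m - 1) * (m - 2) * r ^ (m - 3)
      + 4 * m * (1 - m) * (m - 2) * (m - 3) * r ^ (m - 4)| ≤ 4 * r * (8 * r ^ (m - 3)) := by
    gcongr
  have t4 : 4 * r * (8 * r ^ (m - 3)) = 32 * r ^ (m - 2) := by
    rw [← e3]
    ring
  linarith

theorem one_add_sq_le_of_abs_le {s a R : ℝ} (hR : 1 ≤ R) (hs : |s| ≤ a * R) :
    1 + s ^ 2 ≤ (1 + a ^ 2) * R ^ 2 := by
  have h1 : s ^ 2 ≤ (a * R) ^ 2 := by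
    rw [← sq_abs]
    gcongr
  have h2 : 1 ≤ R ^ 2 := one_le_pow₀ hR
  nlinarith

/-- This growth rate dictates the size `K ~ M R^(2m-1)` of the linear term: it must dominate the
slope of the profile. -/
theorem abs_profileDeriv₁_le (hm : 1 / 2 < m) (hm' : m ≤ 2 / 3) {s R : ℝ} (hR : 1 ≤ R)
    (hs : |s| ≤ 4 * R) : |profileDeriv₁ m s| ≤ 34 * R ^ (2 * m - 1) := by
  have hR0 : 0 < R := by linarith
  set r := 1 + s ^ 2 with hr
  have hr0 : 0 < r := by positivity
  have h1 : |s| ≤ r ^ (1 / 2 : ℝ) := by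
    rw [← Real.sqrt_eq_rpow]
    exact Real.abs_le_sqrt (by rw [hr]; linarith)
  have h2 : r ^ (m - 1 / 2) ≤ 17 * R ^ (2 * m - 1) := by
    have h3 : r ≤ 17 * R ^ 2 := by
      have := one_add_sq_le_of_abs_le hR hs
      norm_num at this
      exact this
    calc r ^ (m - 1 / 2) ≤ (17 * R ^ 2) ^ (m - 1 / 2) :=
          Real.rpow_le_rpow hr0.le h3 (by linarith)
      _ = 17 ^ (m - 1 / 2) * R ^ (2 * m - 1) := by
          rw [Real.mul_rpow (by norm_num) (by positivity), ← Real.rpow_natCast R 2,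
            ← Real.rpow_mul hR0.le]
          congr 2
          push_cast
          ring
      _ ≤ 17 ^ (1 : ℝ) * R ^ (2 * m - 1) := by
          gcongr
          · norm_num
          · linarith
      _ = 17 * R ^ (2 * m - 1) := by rw [Real.rpow_one]
  rw [profileDeriv₁, abs_mul, abs_mul, abs_of_nonneg (by linarith : 0 ≤ 2 * m),
    abs_of_nonneg (by positivity : 0 ≤ r ^ (m - 1))]
  calc 2 * m * |s| * r ^ (m - 1) ≤ 2 * 1 * r ^ (1 / 2 : ℝ) * r ^ (m - 1) := by
        gcongr
        linarith
    _ = 2 * r ^ (m - 1 / 2) := by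
        rw [mul_one, mul_assoc, ← Real.rpow_add hr0]
        ring_nf
    _ ≤ 34 * R ^ (2 * m - 1) := by linarith

theorem one_add_sq_rpow_lower (hm : 1 / 2 < m) (hm' : m ≤ 2 / 3) {s R : ℝ} (hR : 1 ≤ R)
    (hs : |s| ≤ 2 * R) : R ^ (2 * m - 2) / 5 ≤ (1 + s ^ 2) ^ (m - 1) := by
  have hR0 : 0 < R := by linarith
  have h3 : 1 + s ^ 2 ≤ 5 * R ^ 2 := by
    have := one_add_sq_le_of_abs_le hR hs
    norm_num at this
    exact this
  calc R ^ (2 * m - 2) / 5 = 5 ^ (-1 : ℝ) * R ^ (2 * m - 2) := by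
        rw [Real.rpow_neg_one]
        ring
    _ ≤ 5 ^ (m - 1) * R ^ (2 * m - 2) := by
        gcongr
        · norm_num
        · linarith
    _ = (5 * R ^ 2) ^ (m - 1) := by
        rw [Real.mul_rpow (by norm_num) (by positivity), ← Real.rpow_natCast R 2,
          ← Real.rpow_mul hR0.le]
        congr 2
        push_cast
        ring
    _ ≤ (1 + s ^ 2) ^ (m - 1) :=
        Real.rpow_le_rpow_of_nonpos (by positivity) h3 (by linarith)

/-- The decay of `|V|²` is slower than that of `b₂` by the factor `(1 + s²)^(2m-1)`, which is at
most of order `R^(4m-2)`, the order of `K²`. -/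
theorem one_add_sq_rpow_upper (hm : 1 / 2 < m) (hm' : m ≤ 2 / 3) {s R : ℝ} (hR : 1 ≤ R)
    (hs : |s| ≤ 2 * R) :
    (1 + s ^ 2) ^ (3 * m - 2) ≤ 5 * R ^ (4 * m - 2) * (1 + s ^ 2) ^ (m - 1) := by
  have hR0 : 0 < R := by linarith
  have h3 : 1 + s ^ 2 ≤ 5 * R ^ 2 := by
    have := one_add_sq_le_of_abs_le hR hs
    norm_num at this
    exact this
  have h4 : (1 + s ^ 2) ^ (2 * m - 1) ≤ 5 * R ^ (4 * m - 2) := by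
    calc (1 + s ^ 2) ^ (2 * m - 1) ≤ (5 * R ^ 2) ^ (2 * m - 1) :=
          Real.rpow_le_rpow (by positivity) h3 (by linarith)
      _ = 5 ^ (2 * m - 1) * R ^ (4 * m - 2) := by
          rw [Real.mul_rpow (by norm_num) (by positivity), ← Real.rpow_natCast R 2,
            ← Real.rpow_mul hR0.le]
          congr 2
          push_cast
          ring
      _ ≤ 5 ^ (1 : ℝ) * R ^ (4 * m - 2) := by
          gcongr
          · norm_num
          · linarith
      _ = 5 * R ^ (4 * m - 2) := by rw [Real.rpow_one]
  calc (1 + s ^ 2) ^ (3 * m - 2) = (1 + s ^ 2) ^ (2 * m - 1) * (1 + s ^ 2) ^ (m - 1) := by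
        rw [← Real.rpow_add (by positivity)]
        ring_nf
    _ ≤ _ := by gcongr

end Profile

/-! ### The Carleman weight in space-time coordinates -/

section Weight

variable {n : ℕ}

/-- The coordinate directions of space-time. -/
def coordDir (n : ℕ) : Option (Fin n) → SpaceTime n
  | none => (1, 0)
  | some i => (0, EuclideanSpace.single i 1)

theorem contDiff_spaceCoord (i : Fin n) {h : ℝ → ℝ} (hh : ContDiff ℝ ∞ h) :
    ContDiff ℝ ∞ fun z : SpaceTime n => h (z.2 i) :=
  hh.comp ((EuclideanSpace.proj (𝕜 := ℝ) i).contDiff.comp contDiff_snd)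

theorem dirDeriv_spaceCoord (i : Fin n) {h h' : ℝ → ℝ} (hh : ∀ s, HasDerivAt h (h' s) s)
    (j : Option (Fin n)) (z : SpaceTime n) :
    dirDeriv (coordDir n j) (fun z : SpaceTime n => h (z.2 i)) z =
      if j = some i then h' (z.2 i) else 0 := by
  let ℓ : SpaceTime n →L[ℝ] ℝ :=
    (EuclideanSpace.proj (𝕜 := ℝ) i).comp (ContinuousLinearMap.snd ℝ ℝ (Space n))
  have h1 : HasFDerivAt (fun z : SpaceTime n => h (z.2 i)) _ z :=
    (hh (z.2 i)).comp_hasFDerivAt z ℓ.hasFDerivAt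
  rw [dirDeriv, h1.fderiv]
  cases j with
  | none => simp [coordDir, ℓ]
  | some k => by_cases hk : i = k <;> simp [coordDir, ℓ, hk, eq_comm]

theorem contDiff_timeCoord {h : ℝ → ℝ} (hh : ContDiff ℝ ∞ h) :
    ContDiff ℝ ∞ fun z : SpaceTime n => h z.1 :=
  hh.comp contDiff_fst

theorem dirDeriv_timeCoord {h h' : ℝ → ℝ} (hh : ∀ s, HasDerivAt h (h' s) s)
    (j : Option (Fin n)) (z : SpaceTime n) :
    dirDeriv (coordDir n j) (fun z : SpaceTime n => h z.1) z =
      if j = none then h' z.1 else 0 := by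
  let ℓ : SpaceTime n →L[ℝ] ℝ := ContinuousLinearMap.fst ℝ ℝ (Space n)
  have h1 : HasFDerivAt (fun z : SpaceTime n => h z.1) _ z :=
    (hh z.1).comp_hasFDerivAt z ℓ.hasFDerivAt
  rw [dirDeriv, h1.fderiv]
  cases j with
  | none => simp [coordDir, ℓ]
  | some k => simp [coordDir, ℓ]

/-- The Carleman weight. -/
def carlemanWeight (i : Fin n) (m K M N : ℝ) (z : SpaceTime n) : ℝ :=
  (K * z.2 i + M * (1 + z.2 i ^ 2) ^ m) + -N * z.1 ^ 2

theorem isSeparatedWeight_carlemanWeight (i : Fin n) (m K M N : ℝ) :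
    IsSeparatedWeight (coordDir n) none (some i) N (carlemanWeight i m K M N)
      (fun z => -2 * N * z.1) (fun z => K + M * profileDeriv₁ m (z.2 i))
      (fun z => M * profileDeriv₂ m (z.2 i)) (fun z => M * profileDeriv₃ m (z.2 i))
      (fun z => M * profileDeriv₄ m (z.2 i)) where
  ne := by simp
  contDiff := (contDiff_spaceCoord i (h := fun s => K * s + M * (1 + s ^ 2) ^ m)
    ((contDiff_const.mul contDiff_id).add (contDiff_const.mul (contDiff_one_add_sq_rpow m)))).add
    (contDiff_timeCoord (h := fun t => -N * t ^ 2) (contDiff_const.mul (contDiff_id.pow 2)))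
  contDiff_a₁ := contDiff_timeCoord (h := fun t => -2 * N * t) (contDiff_const.mul contDiff_id)
  contDiff_b₁ := contDiff_spaceCoord i (h := fun s => K + M * profileDeriv₁ m s)
    (contDiff_const.add (contDiff_const.mul (contDiff_profileDeriv₁ m)))
  contDiff_b₂ := contDiff_spaceCoord i (h := fun s => M * profileDeriv₂ m s)
    (contDiff_const.mul (contDiff_profileDeriv₂ m))
  contDiff_b₃ := contDiff_spaceCoord i (h := fun s => M * profileDeriv₃ m s)
    (contDiff_const.mul (contDiff_profileDeriv₃ m))
  deriv := fun j z => by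
    have c1 : ContDiff ℝ ∞ fun z : SpaceTime n => K * z.2 i + M * (1 + z.2 i ^ 2) ^ m :=
      contDiff_spaceCoord i (h := fun s => K * s + M * (1 + s ^ 2) ^ m)
        ((contDiff_const.mul contDiff_id).add (contDiff_const.mul (contDiff_one_add_sq_rpow m)))
    have c2 : ContDiff ℝ ∞ fun z : SpaceTime n => -N * z.1 ^ 2 :=
      contDiff_timeCoord (h := fun t => -N * t ^ 2) (contDiff_const.mul (contDiff_id.pow 2))
    have d1 := dirDeriv_spaceCoord i (h := fun s => K * s + M * (1 + s ^ 2) ^ m)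
      (h' := fun s => K + M * profileDeriv₁ m s) (fun s => by
        have := ((hasDerivAt_id s).const_mul K).add
          ((hasDerivAt_one_add_sq_rpow m s).const_mul M)
        rw [mul_one] at this
        exact this) j z
    have d2 := dirDeriv_timeCoord (n := n) (h := fun t => -N * t ^ 2) (h' := fun t => -2 * N * t)
      (fun t => by
        have := (hasDerivAt_pow 2 t).const_mul (-N)
        exact this.congr_deriv (by
          simp only [Nat.cast_ofNat, Nat.add_one_sub_one, pow_one]
          ring)) j z
    have := dirDeriv_add c1 c2 (coordDir n j) z
    rw [d1, d2] at this
    rw [add_comm]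
    exact this
  deriv_a₁ := fun j z => dirDeriv_timeCoord (h := fun t => -2 * N * t) (h' := fun _ => -2 * N)
    (fun t => by simpa using (hasDerivAt_id t).const_mul (-2 * N)) j z
  deriv_b₁ := fun j z => dirDeriv_spaceCoord i (h := fun s => K + M * profileDeriv₁ m s)
    (h' := fun s => M * profileDeriv₂ m s)
    (fun s => ((hasDerivAt_profileDeriv₁ m s).const_mul M).const_add K) j z
  deriv_b₂ := fun j z => dirDeriv_spaceCoord i (h := fun s => M * profileDeriv₂ m s)
    (h' := fun s => M * profileDeriv₃ m s)
    (fun s => (hasDerivAt_profileDeriv₂ m s).const_mul M) j z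
  deriv_b₃ := fun j z => dirDeriv_spaceCoord i (h := fun s => M * profileDeriv₃ m s)
    (h' := fun s => M * profileDeriv₄ m s)
    (fun s => (hasDerivAt_profileDeriv₃ m s).const_mul M) j z

end Weight


/-! ### Cutoffs with derivative bounds uniform in the scale -/

section Cutoff

variable {F : Type*} [NormedAddCommGroup F] [NormedSpace ℝ F]

theorem dirDeriv_comp_smul {g : F → ℝ} (hg : ContDiff ℝ ∞ g) (c : ℝ) (e z : F) :
    dirDeriv e (fun z => g (c • z)) z = c * dirDeriv e g (c • z) := by
  have h1 : HasFDerivAt (fun z : F => g (c • z)) _ z :=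
    ((hg.differentiable (by simp)).differentiableAt (x := c • z)).hasFDerivAt.comp z
      ((hasFDerivAt_id z).const_smul c)
  rw [dirDeriv, h1.fderiv]
  simp [dirDeriv]

theorem dirDeriv_dirDeriv_comp_smul {g : F → ℝ} (hg : ContDiff ℝ ∞ g) (c : ℝ) (e z : F) :
    dirDeriv e (dirDeriv e fun z => g (c • z)) z = c ^ 2 * dirDeriv e (dirDeriv e g) (c • z) := by
  have h1 : dirDeriv e (fun z => g (c • z)) = fun z => c * (fun z => dirDeriv e g (c • z)) z :=
    funext fun z => dirDeriv_comp_smul hg c e z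
  have h2 : ContDiff ℝ ∞ fun z => dirDeriv e g (c • z) :=
    (hg.dirDeriv e).comp (contDiff_const_smul c)
  rw [h1, dirDeriv_mul contDiff_const h2,
    dirDeriv_const, dirDeriv_comp_smul (hg.dirDeriv e)]
  ring

variable [FiniteDimensional ℝ F] {J : Type*} [Fintype J]

/-- Smooth cutoffs at scale `R`: `η` equals `1` on the ball of radius `R`, and `ζ` equals `1` where
the derivatives of `η` do not vanish and is supported away from the ball of radius `R / 2`. -/
theorem exists_cutoffs (E : J → F) : ∃ B : ℝ, ∀ R : ℝ, 1 ≤ R → ∃ η ζ : F → ℝ,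
    ContDiff ℝ ∞ η ∧ HasCompactSupport η ∧ ContDiff ℝ ∞ ζ ∧ HasCompactSupport ζ ∧
    (∀ z ∈ tsupport η, ‖z‖ ≤ 2 * R) ∧ (∀ z, ‖z‖ ≤ R → η z = 1) ∧ (∀ z, |ζ z| ≤ 1) ∧
    (∀ z ∈ tsupport ζ, ‖z‖ ≤ 4 * R ∧ R / 2 ≤ ‖z‖) ∧
    (∀ j z, |dirDeriv (E j) η z| ≤ B * ζ z) ∧
    (∀ j z, |dirDeriv (E j) (dirDeriv (E j) η) z| ≤ B * ζ z) ∧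
    (∀ j z, |dirDeriv (E j) ζ z| ≤ B) := by
  let b : ContDiffBump (0 : F) := ⟨1, 2, one_pos, one_lt_two⟩
  let θ : F → ℝ := b
  have hθ : ContDiff ℝ ∞ θ := b.contDiff
  have hθc : HasCompactSupport θ := b.hasCompactSupport
  have hθ0 : ∀ z, 0 ≤ θ z := fun z => b.nonneg
  have hθ1 : ∀ z, θ z ≤ 1 := fun z => b.le_one
  have hθin : ∀ z, ‖z‖ ≤ 1 → θ z = 1 := fun z hz =>
    b.one_of_mem_closedBall (mem_closedBall_zero_iff.2 hz)
  have hθout : ∀ z, 2 ≤ ‖z‖ → θ z = 0 := fun z hz =>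
    b.zero_of_le_dist (by rw [dist_zero_right]; exact hz)
  have bd : ∀ g : J → F → ℝ, (∀ j, Continuous (g j)) → (∀ j, HasCompactSupport (g j)) →
      ∃ A : ℝ, 0 ≤ A ∧ ∀ j z, |g j z| ≤ A := by
    intro g hg hgc
    choose a ha using fun j => (hgc j).exists_bound_of_continuous (hg j)
    refine ⟨∑ j, |a j|, by positivity, fun j z => ?_⟩
    have h1 := (ha j z).trans (le_abs_self _)
    exact h1.trans (Finset.single_le_sum (f := fun j => |a j|) (fun j _ => abs_nonneg _)
      (Finset.mem_univ j))
  obtain ⟨A₁, hA₁, h1⟩ := bd (fun j => dirDeriv (E j) θ) (fun j => (hθ.dirDeriv _).continuous)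
    (fun j => hθc.dirDeriv _)
  obtain ⟨A₂, hA₂, h2⟩ := bd (fun j => dirDeriv (E j) (dirDeriv (E j) θ))
    (fun j => ((hθ.dirDeriv _).dirDeriv _).continuous) (fun j => (hθc.dirDeriv _).dirDeriv _)
  -- Rescaling multiplies derivatives by at most `2 R⁻¹ ≤ 2`; the product rule for `ζ` costs `A₁ + 2
  -- A₁`.
  refine ⟨3 * A₁ + A₂, fun R hR => ?_⟩
  have hR0 : 0 < R := by linarith
  have hinv : R⁻¹ ≤ 1 := inv_le_one_of_one_le₀ hR
  have hinv0 : 0 < R⁻¹ := by positivity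
  have hRR : R⁻¹ * R = 1 := inv_mul_cancel₀ hR0.ne'
  have scale : ∀ c : ℝ, ContDiff ℝ ∞ fun z => θ (c • z) := fun c =>
    hθ.comp (contDiff_const_smul c)
  have nrm : ∀ c : ℝ, 0 ≤ c → ∀ z : F, ‖c • z‖ = c * ‖z‖ := fun c hc z => by
    rw [norm_smul, Real.norm_of_nonneg hc]
  have csupp : ∀ c : ℝ, 0 < c → HasCompactSupport fun z => θ (c • z) := fun c hc =>
    hθc.comp_homeomorph (Homeomorph.smulOfNeZero c hc.ne')
  set η : F → ℝ := fun z => θ (R⁻¹ • z) with hη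
  -- `ζ = θ(z / 2R) (1 - θ(2z / R))` equals `1` for `R ≤ ‖z‖ ≤ 2R`, outside of which the derivatives
  -- of `η` vanish.
  set ζ : F → ℝ := fun z => (fun z => θ ((R⁻¹ / 2) • z)) z *
    (fun z => 1 + (fun z => -1 * (fun z => θ ((2 * R⁻¹) • z)) z) z) z with hζ
  have sm3 : ContDiff ℝ ∞ fun z => -1 * (fun z => θ ((2 * R⁻¹) • z)) z :=
    contDiff_const.mul (scale _)
  have sm2 : ContDiff ℝ ∞ fun z => 1 + (fun z => -1 * (fun z => θ ((2 * R⁻¹) • z)) z) z :=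
    contDiff_const.add sm3
  have hζs : ContDiff ℝ ∞ ζ := (scale _).mul sm2
  have hζ0 : ∀ z, 0 ≤ ζ z := fun z =>
    mul_nonneg (hθ0 _) (by have := hθ1 ((2 * R⁻¹) • z); simp only; linarith)
  have hζ1 : ∀ z, ζ z ≤ 1 := fun z =>
    mul_le_one₀ (hθ1 _) (by have := hθ1 ((2 * R⁻¹) • z); simp only; linarith)
      (by have := hθ0 ((2 * R⁻¹) • z); simp only; linarith)
  have hηt : ∀ z ∈ tsupport η, ‖z‖ ≤ 2 * R := by
    intro z hz
    have hcl : IsClosed {z : F | ‖z‖ ≤ 2 * R} := isClosed_le continuous_norm continuous_const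
    refine closure_minimal (fun w hw => ?_) hcl hz
    by_contra hcon
    simp only [Set.mem_ofPred_eq, not_le] at hcon
    refine hw (hθout _ ?_)
    rw [nrm _ hinv0.le]
    nlinarith
  have hη1 : ∀ z, ‖z‖ ≤ R → η z = 1 := fun z hz => hθin _ (by
    rw [nrm _ hinv0.le]
    nlinarith)
  have hζin : ∀ z, R ≤ ‖z‖ → ‖z‖ ≤ 2 * R → ζ z = 1 := fun z hz1 hz2 => by
    have t1 : θ ((R⁻¹ / 2) • z) = 1 := hθin _ (by
      rw [nrm _ (by positivity)]
      nlinarith)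
    have t2 : θ ((2 * R⁻¹) • z) = 0 := hθout _ (by
      rw [nrm _ (by positivity)]
      nlinarith)
    simp only [hζ, t1, t2]
    norm_num
  have hev : ∀ z, ‖z‖ < R → η =ᶠ[𝓝 z] fun _ => (1 : ℝ) := fun z hz => by
    filter_upwards [(isOpen_lt continuous_norm continuous_const).mem_nhds hz] with w hw
    exact hη1 w (le_of_lt hw)
  have hd0 : ∀ j z, ‖z‖ < R → dirDeriv (E j) η z = 0 := fun j z hz => by
    rw [dirDeriv, (hev z hz).fderiv_eq]
    simp
  have hdd0 : ∀ j z, ‖z‖ < R → dirDeriv (E j) (dirDeriv (E j) η) z = 0 := fun j z hz => by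
    have : dirDeriv (E j) η =ᶠ[𝓝 z] fun _ => (0 : ℝ) := by
      filter_upwards [(isOpen_lt continuous_norm continuous_const).mem_nhds hz] with w hw
      exact hd0 j w hw
    rw [dirDeriv, this.fderiv_eq]
    simp
  have hB : 0 ≤ 3 * A₁ + A₂ := by positivity
  refine ⟨η, ζ, scale _, csupp _ hinv0, hζs, (csupp _ (by positivity)).mul_right, hηt, hη1,
    fun z => abs_le.2 ⟨by linarith [hζ0 z], hζ1 z⟩, ?_, ?_, ?_, ?_⟩
  · intro z hz
    have hcl : IsClosed {z : F | ‖z‖ ≤ 4 * R ∧ R / 2 ≤ ‖z‖} :=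
      (isClosed_le continuous_norm continuous_const).inter
        (isClosed_le continuous_const continuous_norm)
    refine closure_minimal (fun w hw => ?_) hcl hz
    constructor
    · by_contra hcon
      rw [not_le] at hcon
      refine hw ?_
      have : θ ((R⁻¹ / 2) • w) = 0 := hθout _ (by
        rw [nrm _ (by positivity)]
        nlinarith)
      simp only [hζ, this, zero_mul]
    · by_contra hcon
      rw [not_le] at hcon
      refine hw ?_
      have : θ ((2 * R⁻¹) • w) = 1 := hθin _ (by
        rw [nrm _ (by positivity)]
        nlinarith)
      simp only [hζ, this]
      norm_num
  · intro j z
    by_cases hz1 : ‖z‖ < R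
    · rw [hd0 j z hz1, abs_zero]
      exact mul_nonneg hB (hζ0 z)
    by_cases hz2 : z ∈ tsupport η
    · rw [hζin z (not_lt.1 hz1) (hηt z hz2), mul_one, dirDeriv_comp_smul hθ, abs_mul,
        abs_of_pos hinv0]
      have := mul_le_mul hinv (h1 j (R⁻¹ • z)) (abs_nonneg _) zero_le_one
      linarith
    · rw [dirDeriv_eq_zero_of_notMem hz2, abs_zero]
      exact mul_nonneg hB (hζ0 z)
  · intro j z
    by_cases hz1 : ‖z‖ < R
    · rw [hdd0 j z hz1, abs_zero]
      exact mul_nonneg hB (hζ0 z)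
    by_cases hz2 : z ∈ tsupport η
    · rw [hζin z (not_lt.1 hz1) (hηt z hz2), mul_one, dirDeriv_dirDeriv_comp_smul hθ, abs_mul,
        abs_of_pos (by positivity : 0 < R⁻¹ ^ 2)]
      have := mul_le_mul (pow_le_one₀ hinv0.le hinv : R⁻¹ ^ 2 ≤ 1) (h2 j (R⁻¹ • z))
        (abs_nonneg _) zero_le_one
      linarith
    · rw [dirDeriv_eq_zero_of_notMem fun h => hz2 (tsupport_dirDeriv_subset _ _ h), abs_zero]
      exact mul_nonneg hB (hζ0 z)
  · intro j z
    rw [hζ, dirDeriv_mul (scale _) sm2, dirDeriv_add contDiff_const sm3,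
      dirDeriv_mul contDiff_const (scale _), dirDeriv_const, dirDeriv_const,
      dirDeriv_comp_smul hθ, dirDeriv_comp_smul hθ]
    have a1 := h1 j ((R⁻¹ / 2) • z)
    have a2 := h1 j ((2 * R⁻¹) • z)
    have b1 := hθ0 ((2 * R⁻¹) • z)
    have b2 := hθ1 ((2 * R⁻¹) • z)
    have b3 := hθ0 ((R⁻¹ / 2) • z)
    have b4 := hθ1 ((R⁻¹ / 2) • z)
    refine (abs_add_le _ _).trans ?_
    have t1 : |R⁻¹ / 2 * dirDeriv (E j) θ ((R⁻¹ / 2) • z) * (1 + -1 * θ ((2 * R⁻¹) • z))| ≤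
        1 * A₁ * 1 := by
      rw [abs_mul, abs_mul, abs_of_pos (by positivity : 0 < R⁻¹ / 2),
        abs_of_nonneg (by linarith : 0 ≤ 1 + -1 * θ ((2 * R⁻¹) • z))]
      exact mul_le_mul (mul_le_mul (by linarith) a1 (abs_nonneg _) zero_le_one) (by linarith)
        (by linarith) (by linarith)
    have t2 : |θ ((R⁻¹ / 2) • z) * (0 + (0 * θ ((2 * R⁻¹) • z) +
        -1 * (2 * R⁻¹ * dirDeriv (E j) θ ((2 * R⁻¹) • z))))| ≤ 1 * (2 * A₁) := by
      rw [abs_mul, abs_of_nonneg b3, zero_mul, zero_add, zero_add, abs_mul, abs_neg, abs_one,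
        one_mul, abs_mul, abs_of_pos (by positivity : 0 < 2 * R⁻¹)]
      exact mul_le_mul b4 (mul_le_mul (by linarith) a2 (abs_nonneg _) (by norm_num))
        (by positivity) zero_le_one
    linarith

end Cutoff

/-! ### The decay threshold and the size of the weight far away -/

section Parameters

variable {m : ℝ}

/-- The threshold exponent produced by Young's inequality. -/
def decayThreshold (m γ κ M : ℝ) : ℝ :=
  M * (1 + κ * (320 * κ / γ) ^ (2 * m - 1) + 8 * (γ / 320))

/-- Either `κ ρ ≤ ε R` and the first term suffices, or `R` is at most `(κ / ε) ρ` and the second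
does. -/
theorem young_rpow (hm : 1 / 2 < m) {κ ε R ρ : ℝ} (hκ : 0 < κ) (hε : 0 < ε) (hR : 0 < R)
    (hρ : 0 ≤ ρ) :
    κ * R ^ (2 * m - 1) * ρ ≤ ε * R ^ (2 * m) + κ * (κ / ε) ^ (2 * m - 1) * ρ ^ (2 * m) := by
  have hsplit : ∀ x : ℝ, 0 ≤ x → x ^ (2 * m) = x ^ (2 * m - 1) * x := fun x hx => by
    rcases hx.eq_or_lt with rfl | hx
    · rw [Real.zero_rpow (by linarith), mul_zero]
    · rw [← Real.rpow_add_one hx.ne']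
      ring_nf
  rw [hsplit R hR.le, hsplit ρ hρ]
  by_cases h : κ * ρ ≤ ε * R
  · have h1 : R ^ (2 * m - 1) * (κ * ρ) ≤ R ^ (2 * m - 1) * (ε * R) := by gcongr
    have h2 : 0 ≤ κ * (κ / ε) ^ (2 * m - 1) * (ρ ^ (2 * m - 1) * ρ) := by positivity
    linarith
  · rw [not_le] at h
    have h1 : R ≤ κ / ε * ρ := by
      rw [div_mul_eq_mul_div, le_div_iff₀ hε]
      linarith
    have h2 : R ^ (2 * m - 1) ≤ (κ / ε) ^ (2 * m - 1) * ρ ^ (2 * m - 1) := by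
      rw [← Real.mul_rpow (by positivity) hρ]
      exact Real.rpow_le_rpow hR.le h1 (by linarith)
    have h3 : κ * R ^ (2 * m - 1) * ρ ≤ κ * ((κ / ε) ^ (2 * m - 1) * ρ ^ (2 * m - 1)) * ρ := by
      gcongr
    have h4 : 0 ≤ ε * (R ^ (2 * m - 1) * R) := by positivity
    linarith

/-- For `|t| ≥ R / 2` the time term gains `γ / 160` times `M R^(2m)`; Young's inequality for the
linear term spends half of it. For `ρ ≥ R / 2` there is no such gain, but `R^(2m) ≤ 4 ρ^(2m)`, which
explains the summand `8 (γ / 320)` in `decayThreshold`. -/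
theorem weight_le_of_far (hm : 1 / 2 < m) (hm' : m ≤ 2 / 3) {γ κ M R s t ρ : ℝ} (hγ : 0 < γ)
    (hκ : 0 < κ) (hM : 0 ≤ M) (hR : 1 ≤ R) (hs : |s| ≤ ρ) (hfar : R / 2 ≤ |t| ∨ R / 2 ≤ ρ) :
    κ * M * R ^ (2 * m - 1) * s + M * (1 + s ^ 2) ^ m + -(M * γ * R ^ (2 * m - 2) / 40) * t ^ 2 ≤
      M - M * (γ / 320) * R ^ (2 * m) + decayThreshold m γ κ M * ρ ^ (2 * m) := by
  have hR0 : 0 < R := by linarith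
  have hρ : 0 ≤ ρ := (abs_nonneg s).trans hs
  have h1 := young_rpow hm hκ (by positivity : 0 < γ / 320) hR0 hρ
  have h2 : (1 + s ^ 2) ^ m ≤ 1 + ρ ^ (2 * m) := by
    have h3 : s ^ 2 ≤ ρ ^ 2 := by
      rw [← sq_abs]
      gcongr
    calc (1 + s ^ 2) ^ m ≤ (1 + ρ ^ 2) ^ m :=
          Real.rpow_le_rpow (by positivity) (by linarith) (by linarith)
      _ ≤ 1 ^ m + (ρ ^ 2) ^ m :=
          Real.rpow_add_le_add_rpow zero_le_one (sq_nonneg _) (by linarith) (by linarith)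
      _ = 1 + ρ ^ (2 * m) := by
          rw [Real.one_rpow, ← Real.rpow_natCast ρ 2, ← Real.rpow_mul hρ]
          norm_num
  have h4 : κ * R ^ (2 * m - 1) * s ≤ κ * R ^ (2 * m - 1) * ρ :=
    mul_le_mul_of_nonneg_left ((le_abs_self s).trans hs) (by positivity)
  have e1 : κ / (γ / 320) = 320 * κ / γ := by
    field_simp
  rw [e1] at h1
  have hx : R ^ (2 * m) = R ^ (2 * m - 2) * R ^ 2 := by
    rw [← Real.rpow_natCast R 2, ← Real.rpow_add hR0]
    norm_num
  have hRm : 0 ≤ R ^ (2 * m - 2) := by positivity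
  have hρm : 0 ≤ ρ ^ (2 * m) := by positivity
  set y := κ * (320 * κ / γ) ^ (2 * m - 1) * ρ ^ (2 * m) with hy
  have key : κ * R ^ (2 * m - 1) * s + (1 + s ^ 2) ^ m + -(γ * R ^ (2 * m - 2) / 40) * t ^ 2 ≤
      1 - γ / 320 * R ^ (2 * m) + (ρ ^ (2 * m) + y + 8 * (γ / 320) * ρ ^ (2 * m)) := by
    rcases hfar with hf | hf
    · have h5 : R ^ 2 / 4 ≤ t ^ 2 := by
        rw [← sq_abs t]
        nlinarith
      have h6 : γ * R ^ (2 * m - 2) / 40 * (R ^ 2 / 4) ≤ γ * R ^ (2 * m - 2) / 40 * t ^ 2 :=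
        mul_le_mul_of_nonneg_left h5 (by positivity)
      have h7 : 0 ≤ 8 * (γ / 320) * ρ ^ (2 * m) := by positivity
      rw [hx] at h1 ⊢
      linarith
    · have h5 : R ^ (2 * m) ≤ 4 * ρ ^ (2 * m) := by
        calc R ^ (2 * m) ≤ (2 * ρ) ^ (2 * m) :=
              Real.rpow_le_rpow hR0.le (by linarith) (by linarith)
          _ = 2 ^ (2 * m) * ρ ^ (2 * m) := Real.mul_rpow (by norm_num) hρ
          _ ≤ 2 ^ (2 : ℝ) * ρ ^ (2 * m) := by
              gcongr
              · norm_num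
              · linarith
          _ = 4 * ρ ^ (2 * m) := by norm_num
      have h6 : 0 ≤ γ * R ^ (2 * m - 2) / 40 * t ^ 2 := by positivity
      have h7 : γ / 320 * R ^ (2 * m) ≤ γ / 320 * (4 * ρ ^ (2 * m)) := by gcongr
      linarith
  have := mul_le_mul_of_nonneg_left key hM
  rw [decayThreshold]
  rw [hy] at this
  linarith

end Parameters


/-! ### The weighted estimate at scale `R` -/

section Vanishing

variable {n : ℕ}

instance : (volume : Measure (SpaceTime n)).IsAddHaarMeasure :=
  inferInstanceAs ((volume : Measure ℝ).prod (volume : Measure (Space n))).IsAddHaarMeasure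

theorem abs_coord_le_norm (z : SpaceTime n) (i : Fin n) : |z.2 i| ≤ ‖z.2‖ := by
  rw [← Real.norm_eq_abs]
  exact PiLp.norm_apply_le z.2 i

/-- The weighted estimate at scale `R` for the explicit weight. -/
theorem weighted_bound_at_scale (i : Fin n) {m C : ℝ} (hm : 1 / 2 < m) (hm' : m ≤ 2 / 3)
    (hC : 0 < C) {γ κ M : ℝ} (hγ : γ = 2 * m * (2 * m - 1)) (hκ : κ = 1600 / γ) (hM : 1 ≤ M)
    (hMC : 704 * C ^ 2 ≤ M * γ) :
    ∃ B : ℝ, 0 ≤ B ∧ ∀ R : ℝ, 1 ≤ R → ∀ (u : SpaceTime n → ℂ)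
      (du ddu : Option (Fin n) → SpaceTime n → ℂ),
      MemL2Loc u → (∀ j, MemL2Loc (du j)) → (∀ j, MemL2Loc (ddu j)) →
      (∀ j, IsWeakDeriv (coordDir n j) u (du j)) →
      (∀ j, IsWeakDeriv (coordDir n j) (du j) (ddu j)) →
      (∀ᵐ z, ‖∑ j, ddu j z‖ ^ 2 ≤ 2 * C ^ 2 * ((1 + z.2 i ^ 2) ^ (3 * m - 2) * ‖u z‖ ^ 2
        + (1 + z.2 i ^ 2) ^ (m - 1) * ∑ j, ‖du j z‖ ^ 2)) →
      ∃ S : Set (SpaceTime n), IsCompact S ∧ (∀ z ∈ S, ‖z‖ ≤ 4 * R ∧ R / 2 ≤ ‖z‖) ∧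
        ∫ z in Metric.closedBall 0 R, M * profileDeriv₂ m (z.2 i) *
          Real.exp (carlemanWeight i m (κ * M * R ^ (2 * m - 1)) M
            (M * γ * R ^ (2 * m - 2) / 40) z) ^ 2 * ‖u z‖ ^ 2 ≤
        B * ∫ z in S, Real.exp (carlemanWeight i m (κ * M * R ^ (2 * m - 1)) M
            (M * γ * R ^ (2 * m - 2) / 40) z) ^ 2 * ‖u z‖ ^ 2 := by
  obtain ⟨B, hB⟩ := exists_cutoffs (coordDir n)
  refine ⟨2 * cutoffConstant (Fintype.card (Option (Fin n))) B C *
        (2 + 8 * C ^ 2 + 16 * (Fintype.card (Option (Fin n)) * B ^ 2 + 5)), by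
    rw [cutoffConstant]
    positivity, fun R hR u du ddu hu hdus hddus hdu hddu hpde => ?_⟩
  obtain ⟨η, ζ, hη, hηc, hζ, hζc, hηt, hη1, hζ1, hζt, hdη, hddη, hdζ⟩ := hB R hR
  have hR0 : 0 < R := by linarith
  have hM0 : 0 < M := by linarith
  have hγ0 : 0 < γ := by
    rw [hγ]
    exact mul_pos (by linarith) (by linarith)
  have hγ1 : γ ≤ 4 / 9 := by
    rw [hγ]
    nlinarith
  -- Large enough for `K` to dominate the slope of the profile, at most `34 M X`, and the time
  -- slope.
  have hκ0 : 3600 ≤ κ := by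
    rw [hκ, le_div_iff₀ hγ0]
    linarith
  set X := R ^ (2 * m - 1) with hX
  have hX1 : 1 ≤ X := Real.one_le_rpow hR (by linarith)
  set K := κ * M * X with hK
  set N := M * γ * R ^ (2 * m - 2) / 40 with hN
  have hMX : 1 ≤ M * X := by nlinarith
  have hKMX : 3600 * (M * X) ≤ K := by
    rw [hK, mul_assoc]
    exact mul_le_mul_of_nonneg_right hκ0 (by positivity)
  have hK1 : 1 ≤ K := by linarith
  have hN0 : 0 ≤ N := by positivity
  have hb2l : ∀ z : SpaceTime n, M * γ * (1 + z.2 i ^ 2) ^ (m - 1) ≤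
      M * profileDeriv₂ m (z.2 i) := fun z => by
    have := mul_le_mul_of_nonneg_left (profileDeriv₂_lower hm hm' (z.2 i)) hM0.le
    rw [← hγ] at this
    linarith
  have hcoord : ∀ z : SpaceTime n, |z.2 i| ≤ ‖z‖ := fun z =>
    (abs_coord_le_norm z i).trans (norm_snd_le z)
  have htime : ∀ z : SpaceTime n, |z.1| ≤ ‖z‖ := fun z => norm_fst_le z
  have hg1 : ∀ z : SpaceTime n, ‖z‖ ≤ 4 * R → |M * profileDeriv₁ m (z.2 i)| ≤ K / 2 :=
    fun z hz => by
      rw [abs_mul, abs_of_pos hM0]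
      have := mul_le_mul_of_nonneg_left
        (abs_profileDeriv₁_le hm hm' hR ((hcoord z).trans hz)) hM0.le
      linarith
  have hNR : N * R = M * γ * X / 40 := by
    rw [hN, hX, show 2 * m - 1 = 2 * m - 2 + 1 by ring, Real.rpow_add_one hR0.ne']
    ring
  have ha : ∀ z : SpaceTime n, ‖z‖ ≤ 4 * R → |-2 * N * z.1| ≤ K / 8 := fun z hz => by
    rw [abs_mul, abs_mul, abs_neg, abs_two, abs_of_nonneg hN0]
    have h1 : N * |z.1| ≤ N * (4 * R) := by
      have := (htime z).trans hz
      gcongr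
    have h2 : M * X * γ ≤ M * X * (4 / 9) := by gcongr
    linarith
  -- The divisor `40` in `N` is chosen here: `8 N = M γ R^(2m-2) / 5` is the lower bound for the
  -- second derivative when `|s| ≤ 2 R`.
  have hNb : ∀ z : SpaceTime n, ‖z‖ ≤ 2 * R → 8 * N ≤ M * profileDeriv₂ m (z.2 i) :=
    fun z hz => by
      have h1 := one_add_sq_rpow_lower hm hm' hR ((hcoord z).trans hz)
      have h2 := mul_le_mul_of_nonneg_left h1 (by positivity : 0 ≤ M * γ)
      have h3 := hb2l z
      rw [hN]
      linarith
  have hK2 : K ^ 2 = κ ^ 2 * M ^ 2 * R ^ (4 * m - 2) := by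
    rw [hK, mul_pow, mul_pow, hX, sq (R ^ (2 * m - 1)), ← Real.rpow_add hR0]
    ring_nf
  -- `Γ = 40 / γ` compares the bound `40` for the higher derivatives of the profile with the bound
  -- `γ` for the second; then `40 Γ = κ ≤ K`.
  have hbound := (isSeparatedWeight_carlemanWeight i m K M N).weighted_bound (B := B) (C := C)
    (M := M) (K := K) (Γ := 40 / γ) (P := fun z => (1 + z.2 i ^ 2) ^ (3 * m - 2))
    (H := fun z => (1 + z.2 i ^ 2) ^ (m - 1)) hη hηc hζ hζc hC hK1 hN0
    (by
      have : 40 * (40 / γ) = κ := by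
        rw [hκ]
        ring
      rw [this]
      calc κ = κ * 1 := (mul_one κ).symm
        _ ≤ κ * (M * X) := by gcongr
        _ = K := by
          rw [hK]
          ring)
    (by nlinarith)
    (fun z hz => by
      have := abs_le.1 (hg1 z (by linarith [hηt z hz]))
      exact ⟨by linarith, by linarith⟩)
    (fun z hz => ha z (by linarith [hηt z hz]))
    (fun z hz => ⟨hNb z (hηt z hz), by
      have := mul_le_mul_of_nonneg_left (profileDeriv₂_upper hm hm' (z.2 i)) hM0.le
      linarith⟩)
    (fun z hz => by
      rw [abs_mul, abs_of_pos hM0]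
      have h1 := mul_le_mul_of_nonneg_left (abs_profileDeriv₃_le hm hm' (z.2 i)) hM0.le
      have h2 := mul_le_mul_of_nonneg_left (hb2l z) (by positivity : 0 ≤ 40 / γ)
      have h3 : 40 / γ * (M * γ * (1 + z.2 i ^ 2) ^ (m - 1)) =
        M * (40 * (1 + z.2 i ^ 2) ^ (m - 1)) := by field_simp
      linarith)
    (fun z hz => by
      rw [abs_mul, abs_of_pos hM0]
      have h1 := mul_le_mul_of_nonneg_left (abs_profileDeriv₄_le hm hm' (z.2 i)) hM0.le
      have h2 := mul_le_mul_of_nonneg_left (hb2l z) (by positivity : 0 ≤ 40 / γ)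
      have h3 : 40 / γ * (M * γ * (1 + z.2 i ^ 2) ^ (m - 1)) =
        M * (40 * (1 + z.2 i ^ 2) ^ (m - 1)) := by field_simp
      linarith)
    (fun z => le_trans (by positivity) (hb2l z))
    hu hdus hddus hdu hddu
    (fun z => one_add_sq_rpow_le_one (by linarith) _)
    (fun z => by positivity)
    (fun z => one_add_sq_rpow_le_one (by linarith) _)
    hpde hdη hddη
    (fun z hz => by
      refine le_trans ?_ (hb2l z)
      exact mul_le_mul_of_nonneg_right hMC (by positivity))
    (fun z hz => by
      have h1 := one_add_sq_rpow_upper hm hm' hR ((hcoord z).trans (hηt z hz))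
      have h2 := mul_le_mul_of_nonneg_right (hb2l z) (sq_nonneg K)
      refine le_trans ?_ h2
      set h := (1 + z.2 i ^ 2) ^ (m - 1)
      have h0 : 0 ≤ h := by positivity
      have hR4 : 0 ≤ R ^ (4 * m - 2) := by positivity
      have h3 : 352 * C ^ 2 * (1 + z.2 i ^ 2) ^ (3 * m - 2) ≤
          352 * C ^ 2 * (5 * R ^ (4 * m - 2) * h) := by gcongr
      have h4 : (5 : ℝ) ≤ κ ^ 2 * M ^ 2 := by
        have k1 : (1 : ℝ) ≤ M ^ 2 := one_le_pow₀ hM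
        have k2 : (3600 : ℝ) ^ 2 ≤ κ ^ 2 := pow_le_pow_left₀ (by norm_num) hκ0 2
        nlinarith
      have h5 : 704 * C ^ 2 * (5 * (R ^ (4 * m - 2) * h)) ≤
          M * γ * (κ ^ 2 * M ^ 2 * (R ^ (4 * m - 2) * h)) := by gcongr
      have h6 : 0 ≤ C ^ 2 * (R ^ (4 * m - 2) * h) := by positivity
      rw [hK2]
      linarith)
    hζ1 hdζ
    (fun z hz => by
      obtain ⟨hz4, -⟩ := hζt z hz
      have h1 := ha z hz4
      have h2 := hg1 z hz4
      have h3 : (-2 * N * z.1) ^ 2 ≤ (K / 8) ^ 2 := by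
        rw [← sq_abs]
        gcongr
      have h4 := abs_le.1 h2
      have h5 : (K + M * profileDeriv₁ m (z.2 i)) ^ 2 ≤ (2 * K) ^ 2 :=
        pow_le_pow_left₀ (by linarith) (by linarith) 2
      nlinarith [sq_nonneg K])
  refine ⟨tsupport ζ, hζc, hζt, le_trans ?_ hbound⟩
  have hw := isSeparatedWeight_carlemanWeight i m K M N
  have hexp : Continuous fun z => Real.exp (carlemanWeight i m K M N z) := hw.contDiff.exp.continuous
  have hηc' := hη.continuous
  have hb2c : Continuous fun z : SpaceTime n => M * profileDeriv₂ m (z.2 i) :=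
    hw.contDiff_b₂.continuous
  have hb20 : ∀ z : SpaceTime n, 0 ≤ M * profileDeriv₂ m (z.2 i) := fun z =>
    le_trans (by positivity) (hb2l z)
  have hint : Integrable fun z => M * profileDeriv₂ m (z.2 i) *
      (Real.exp (carlemanWeight i m K M N z) * η z) ^ 2 * ‖u z‖ ^ 2 := by
    have h1 := (hu.memLp_smul (c := fun z => √(M * profileDeriv₂ m (z.2 i)) *
      Real.exp (carlemanWeight i m K M N z) * η z) ((hb2c.sqrt.mul hexp).mul hηc')
      hηc.mul_left).integrable_norm_sq
    refine h1.congr (ae_of_all _ fun z => ?_)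
    beta_reduce
    rw [norm_real_smul_sq, mul_pow, mul_pow, Real.sq_sqrt (hb20 z)]
    ring
  have e1 : ∫ z in Metric.closedBall (0 : SpaceTime n) R, M * profileDeriv₂ m (z.2 i) *
      Real.exp (carlemanWeight i m K M N z) ^ 2 * ‖u z‖ ^ 2 =
      ∫ z in Metric.closedBall (0 : SpaceTime n) R, M * profileDeriv₂ m (z.2 i) *
      (Real.exp (carlemanWeight i m K M N z) * η z) ^ 2 * ‖u z‖ ^ 2 := by
    refine setIntegral_congr_fun Metric.isClosed_closedBall.measurableSet fun z hz => ?_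
    simp only
    rw [hη1 z (mem_closedBall_zero_iff.1 hz), mul_one]
  rw [e1]
  exact setIntegral_le_integral hint (ae_of_all _ fun z =>
    mul_nonneg (mul_nonneg (hb20 z) (sq_nonneg _)) (sq_nonneg _))

/-- A function with uniformly bounded weighted slices has bounded weighted mass in a time slab. -/
theorem lintegral_slab_le {u : SpaceTime n → ℂ} (hu : AEStronglyMeasurable u volume)
    {g : Space n → ℝ≥0∞} (hg : Measurable g) {A : ℝ≥0∞}
    (hA : ∀ t : ℝ, ∫⁻ x, g x * ‖u (t, x)‖ₑ ^ 2 ≤ A) (T : ℝ) :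
    ∫⁻ z in Set.Icc (-T) T ×ˢ (Set.univ : Set (Space n)), g z.2 * ‖u z‖ₑ ^ 2 ≤
      ENNReal.ofReal (2 * T) * A := by
  have hm : AEMeasurable (fun z : SpaceTime n => g z.2 * ‖u z‖ₑ ^ 2) volume :=
    (hg.comp measurable_snd).aemeasurable.mul (hu.enorm.pow_const 2)
  rw [Measure.volume_eq_prod, ← Measure.prod_restrict, Measure.restrict_univ, lintegral_prod]
  · calc ∫⁻ t in Set.Icc (-T) T, ∫⁻ x, g x * ‖u (t, x)‖ₑ ^ 2
        ≤ ∫⁻ t in Set.Icc (-T) T, A := lintegral_mono fun t => hA t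
      _ = ENNReal.ofReal (2 * T) * A := by
        rw [setLIntegral_const, Real.volume_Icc, mul_comm]
        ring_nf
  · have := hm.restrict (s := Set.Icc (-T) T ×ˢ (Set.univ : Set (Space n)))
    rwa [Measure.volume_eq_prod, ← Measure.prod_restrict, Measure.restrict_univ] at this

/-- Since `R^(2m) = R^(2m-1) R` with `R^(2m-1) ≥ 1` and `c - b R ≤ 0`, the exponent is at most `a +
c - b R`; then `e^y ≥ y² / 2` applies. -/
theorem mul_exp_le_div {a b c m R : ℝ} (hm : 1 / 2 < m) (hb : 0 < b) (hR : 1 ≤ R)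
    (hbR : c ≤ b * R) :
    R * Real.exp (a + c * R ^ (2 * m - 1) - b * R ^ (2 * m)) ≤
      2 * Real.exp (a + c) / b ^ 2 * (1 / R) := by
  have hR0 : 0 < R := by linarith
  have h1 : 1 ≤ R ^ (2 * m - 1) := Real.one_le_rpow hR (by linarith)
  have h2 : R ^ (2 * m) = R ^ (2 * m - 1) * R := by
    rw [← Real.rpow_add_one hR0.ne']
    ring_nf
  have h3 : a + c * R ^ (2 * m - 1) - b * R ^ (2 * m) ≤ (a + c) - b * R := by
    rw [h2]
    nlinarith
  have h4 : (b * R) ^ 2 / 2 ≤ Real.exp (b * R) := by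
    have := Real.quadratic_le_exp_of_nonneg (x := b * R) (by positivity)
    have h5 : 0 ≤ b * R := by positivity
    linarith
  calc R * Real.exp (a + c * R ^ (2 * m - 1) - b * R ^ (2 * m))
      ≤ R * Real.exp ((a + c) - b * R) := by gcongr
    _ = R * (Real.exp (a + c) / Real.exp (b * R)) := by rw [Real.exp_sub]
    _ ≤ R * (Real.exp (a + c) / ((b * R) ^ 2 / 2)) := by gcongr
    _ = 2 * Real.exp (a + c) / b ^ 2 * (1 / R) := by
        field_simp

end Vanishing


/-! ### Comparison of near and far regions -/

section UniqueContinuation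

variable {n : ℕ}

/-- Far from the origin the decay of the solution beats the Carleman weight. -/
theorem setIntegral_far_le (i : Fin n) {m γ κ M R lam : ℝ} (hm : 1 / 2 < m) (hm' : m ≤ 2 / 3)
    (hγ : 0 < γ) (hκ : 0 < κ) (hM : 0 ≤ M) (hR : 1 ≤ R) (hlam : decayThreshold m γ κ M ≤ lam)
    {u : SpaceTime n → ℂ} (hu : AEStronglyMeasurable u volume) {A : ℝ≥0∞} (hA₀ : A ≠ ⊤)
    (hA : ∀ t : ℝ, ∫⁻ x : Space n, ENNReal.ofReal (Real.exp (4 * lam * ‖x‖ ^ (2 * m))) *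
      ‖u (t, x)‖ₑ ^ 2 ≤ A)
    {S : Set (SpaceTime n)} (hS : MeasurableSet S) (hSR : ∀ z ∈ S, ‖z‖ ≤ 4 * R ∧ R / 2 ≤ ‖z‖) :
    ∫ z in S, Real.exp (carlemanWeight i m (κ * M * R ^ (2 * m - 1)) M
        (M * γ * R ^ (2 * m - 2) / 40) z) ^ 2 * ‖u z‖ ^ 2 ≤
      Real.exp (2 * M - 2 * M * (γ / 320) * R ^ (2 * m)) * (8 * R * A.toReal) := by
  have hR0 : 0 < R := by linarith
  have hlam0 : 0 ≤ lam := le_trans (by rw [decayThreshold]; positivity) hlam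
  set E := Real.exp (2 * M - 2 * M * (γ / 320) * R ^ (2 * m)) with hE
  have hE0 : 0 ≤ E := (Real.exp_pos _).le
  set g : Space n → ℝ≥0∞ := fun x => ENNReal.ofReal (Real.exp (4 * lam * ‖x‖ ^ (2 * m))) with hg
  have hgm : Measurable g := by
    refine ENNReal.measurable_ofReal.comp (Real.measurable_exp.comp ?_)
    exact (measurable_norm.pow_const _).const_mul _
  have hw : Continuous (carlemanWeight i m (κ * M * R ^ (2 * m - 1)) M
      (M * γ * R ^ (2 * m - 2) / 40)) :=
    (isSeparatedWeight_carlemanWeight i m _ M _).contDiff.continuous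
  have hmeas : AEStronglyMeasurable (fun z => Real.exp (carlemanWeight i m
      (κ * M * R ^ (2 * m - 1)) M (M * γ * R ^ (2 * m - 2) / 40) z) ^ 2 * ‖u z‖ ^ 2)
      (volume.restrict S) :=
    (hw.rexp.pow 2).aestronglyMeasurable.mul (hu.restrict.norm.pow 2)
  rw [integral_eq_lintegral_of_nonneg_ae (ae_of_all _ fun z => by positivity)
    hmeas]
  refine ENNReal.toReal_le_of_le_ofReal (by positivity) ?_
  have hpt : ∀ z ∈ S, ENNReal.ofReal (Real.exp (carlemanWeight i m (κ * M * R ^ (2 * m - 1)) M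
      (M * γ * R ^ (2 * m - 2) / 40) z) ^ 2 * ‖u z‖ ^ 2) ≤
      ENNReal.ofReal E * (g z.2 * ‖u z‖ₑ ^ 2) := fun z hz => by
    -- The norm on space-time is the maximum of the norms of the factors.
    have hfar : R / 2 ≤ |z.1| ∨ R / 2 ≤ ‖z.2‖ := by
      have := (hSR z hz).2
      rwa [Prod.norm_def, le_max_iff, Real.norm_eq_abs] at this
    have h1 := weight_le_of_far hm hm' hγ hκ hM hR (abs_coord_le_norm z i) hfar
    have h2 : decayThreshold m γ κ M * ‖z.2‖ ^ (2 * m) ≤ lam * ‖z.2‖ ^ (2 * m) := by gcongr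
    have h3 : 0 ≤ lam * ‖z.2‖ ^ (2 * m) := by positivity
    have h4 : Real.exp (carlemanWeight i m (κ * M * R ^ (2 * m - 1)) M
        (M * γ * R ^ (2 * m - 2) / 40) z) ^ 2 ≤ E * Real.exp (4 * lam * ‖z.2‖ ^ (2 * m)) := by
      rw [← Real.exp_nat_mul, hE, ← Real.exp_add, Real.exp_le_exp, carlemanWeight]
      push_cast
      linarith
    calc _ ≤ ENNReal.ofReal (E * Real.exp (4 * lam * ‖z.2‖ ^ (2 * m)) * ‖u z‖ ^ 2) := by gcongr
      _ = _ := by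
        rw [mul_assoc, ENNReal.ofReal_mul hE0, ENNReal.ofReal_mul (Real.exp_pos _).le,
          ENNReal.ofReal_pow (norm_nonneg _), ofReal_norm]
  calc _ ≤ ∫⁻ z in S, ENNReal.ofReal E * (g z.2 * ‖u z‖ₑ ^ 2) := setLIntegral_mono' hS hpt
    _ = ENNReal.ofReal E * ∫⁻ z in S, g z.2 * ‖u z‖ₑ ^ 2 :=
        lintegral_const_mul' _ _ ENNReal.ofReal_ne_top
    -- The bound on slices is uniform in time, so the slab costs only its length `8 R`.
    _ ≤ ENNReal.ofReal E * ∫⁻ z in Set.Icc (-(4 * R)) (4 * R) ×ˢ (Set.univ : Set (Space n)),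
          g z.2 * ‖u z‖ₑ ^ 2 := by
        gcongr
        intro z hz
        exact ⟨abs_le.1 ((norm_fst_le z).trans (hSR z hz).1), trivial⟩
    _ ≤ ENNReal.ofReal E * (ENNReal.ofReal (2 * (4 * R)) * A) := by
        gcongr
        exact lintegral_slab_le hu hgm hA _
    _ = ENNReal.ofReal (E * (8 * R * A.toReal)) := by
        rw [ENNReal.ofReal_mul hE0, ENNReal.ofReal_mul (p := 8 * R) (by positivity),
          ENNReal.ofReal_toReal hA₀]
        ring_nf

/-- Near the origin the Carleman weight is bounded below. -/
theorem near_weight_lower_bound (i : Fin n) {m γ κ M R r : ℝ} (hm : 1 / 2 < m) (hm' : m ≤ 2 / 3)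
    (hγ : γ = 2 * m * (2 * m - 1)) (hκ : 0 ≤ κ) (hM : 0 ≤ M) (hR : 1 ≤ R)
    {z : SpaceTime n} (hz : ‖z‖ ≤ r) :
    M * γ * (1 + r ^ 2) ^ (m - 1) *
        Real.exp (-((2 * κ * M * r + M * γ * r ^ 2) * R ^ (2 * m - 1))) ≤
      M * profileDeriv₂ m (z.2 i) * Real.exp (carlemanWeight i m (κ * M * R ^ (2 * m - 1)) M
        (M * γ * R ^ (2 * m - 2) / 40) z) ^ 2 := by
  have hγ0 : 0 ≤ γ := by
    rw [hγ]
    exact mul_nonneg (by linarith) (by linarith)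
  have hs : |z.2 i| ≤ r := ((abs_coord_le_norm z i).trans (norm_snd_le z)).trans hz
  have ht : |z.1| ≤ r := (norm_fst_le z).trans hz
  have hs2 : z.2 i ^ 2 ≤ r ^ 2 := sq_le_sq' (abs_le.1 hs).1 (abs_le.1 hs).2
  have ht2 : z.1 ^ 2 ≤ r ^ 2 := sq_le_sq' (abs_le.1 ht).1 (abs_le.1 ht).2
  have h1 : γ * (1 + r ^ 2) ^ (m - 1) ≤ profileDeriv₂ m (z.2 i) := by
    refine le_trans ?_ (profileDeriv₂_lower hm hm' (z.2 i))
    rw [← hγ]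
    exact mul_le_mul_of_nonneg_left
      (Real.rpow_le_rpow_of_nonpos (by positivity) (by linarith) (by linarith)) hγ0
  -- On a fixed ball the time term has a smaller power of `R` than the linear term, and the convex
  -- term is nonnegative and can be dropped.
  have hX : R ^ (2 * m - 2) ≤ R ^ (2 * m - 1) := Real.rpow_le_rpow_of_exponent_le hR (by linarith)
  have hX0 : 0 ≤ R ^ (2 * m - 1) := by positivity
  set X := R ^ (2 * m - 1)
  have h2 : -(κ * M * X * r) ≤ κ * M * X * z.2 i := by
    have := mul_le_mul_of_nonneg_left (abs_le.1 hs).1 (by positivity : 0 ≤ κ * M * X)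
    linarith
  have h3 : M * γ * R ^ (2 * m - 2) / 40 * z.1 ^ 2 ≤ M * γ * X / 40 * r ^ 2 := by gcongr
  have h4 : 0 ≤ M * (1 + z.2 i ^ 2) ^ m := by positivity
  have h5 : 0 ≤ M * γ * X * r ^ 2 := by positivity
  have h6 : Real.exp (-((2 * κ * M * r + M * γ * r ^ 2) * X)) ≤
      Real.exp (carlemanWeight i m (κ * M * X) M (M * γ * R ^ (2 * m - 2) / 40) z) ^ 2 := by
    rw [← Real.exp_nat_mul, Real.exp_le_exp, carlemanWeight]
    push_cast
    linarith
  rw [mul_assoc M]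
  exact mul_le_mul (mul_le_mul_of_nonneg_left h1 hM) h6 (Real.exp_pos _).le
    (mul_nonneg hM (le_trans (by positivity) h1))

/-- Solutions of the differential inequality with weighted `L²` decay vanish. -/
theorem ae_eq_zero_of_decay (i : Fin n) {m C : ℝ} (hm : 1 / 2 < m) (hm' : m ≤ 2 / 3)
    (hC : 0 < C) {γ κ M : ℝ} (hγ : γ = 2 * m * (2 * m - 1)) (hκ : κ = 1600 / γ) (hM : 1 ≤ M)
    (hMC : 704 * C ^ 2 ≤ M * γ) {lam : ℝ} (hlam : decayThreshold m γ κ M ≤ lam)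
    {u : SpaceTime n → ℂ} {du ddu : Option (Fin n) → SpaceTime n → ℂ}
    (hu : MemL2Loc u) (hdus : ∀ j, MemL2Loc (du j)) (hddus : ∀ j, MemL2Loc (ddu j))
    (hdu : ∀ j, IsWeakDeriv (coordDir n j) u (du j))
    (hddu : ∀ j, IsWeakDeriv (coordDir n j) (du j) (ddu j))
    (hpde : ∀ᵐ z, ‖∑ j, ddu j z‖ ^ 2 ≤ 2 * C ^ 2 * ((1 + z.2 i ^ 2) ^ (3 * m - 2) * ‖u z‖ ^ 2
        + (1 + z.2 i ^ 2) ^ (m - 1) * ∑ j, ‖du j z‖ ^ 2))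
    {A : ℝ≥0∞} (hA₀ : A ≠ ⊤)
    (hA : ∀ t : ℝ, ∫⁻ x : Space n, ENNReal.ofReal (Real.exp (4 * lam * ‖x‖ ^ (2 * m))) *
      ‖u (t, x)‖ₑ ^ 2 ≤ A) :
    ∀ᵐ z : SpaceTime n, u z = 0 := by
  obtain ⟨B, hB, hbound⟩ := weighted_bound_at_scale i hm hm' hC hγ hκ hM hMC
  have hγ0 : 0 < γ := by
    rw [hγ]
    exact mul_pos (by linarith) (by linarith)
  have hκ0 : 0 < κ := by
    rw [hκ]
    positivity
  have hM0 : 0 < M := by linarith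
  have hum : AEStronglyMeasurable u volume := (hdu none).locallyIntegrable.aestronglyMeasurable
  have hint : ∀ r : ℝ, ∀ w : SpaceTime n → ℝ, Continuous w →
      IntegrableOn (fun z => w z * ‖u z‖ ^ 2) (Metric.closedBall 0 r) := fun r w hw => by
    have h1 : IntegrableOn (fun z => ‖u z‖ ^ 2) (Metric.closedBall 0 r) :=
      (hu _ (isCompact_closedBall _ _)).integrable_norm_pow two_ne_zero
    exact h1.continuousOn_mul hw.continuousOn (isCompact_closedBall _ _)
  have hball : ∀ r : ℝ, ∫ z in Metric.closedBall (0 : SpaceTime n) r, ‖u z‖ ^ 2 = 0 := by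
    intro r
    set c := 2 * κ * M * r + M * γ * r ^ 2 with hc
    set b := 2 * M * (γ / 320) with hb
    have hb0 : 0 < b := by positivity
    set c₀ := M * γ * (1 + r ^ 2) ^ (m - 1) with hc₀
    have hc₀0 : 0 < c₀ := by positivity
    -- With `r` fixed, the near loss `exp(-c R^(2m-1))` is beaten by the far gain `exp(-b R^(2m))`;
    -- `c / b ≤ R` is where the latter takes over.
    have hle : ∀ R : ℝ, 1 ≤ R → r ≤ R → c / b ≤ R →
        ∫ z in Metric.closedBall (0 : SpaceTime n) r, ‖u z‖ ^ 2 ≤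
          B * (8 * A.toReal) / c₀ * (2 * Real.exp (2 * M + c) / b ^ 2) * (1 / R) := by
      intro R hR hrR hcR
      obtain ⟨S, hSc, hSR, hS⟩ := hbound R hR u du ddu hu hdus hddus hdu hddu hpde
      have hfar := setIntegral_far_le i hm hm' hγ0 hκ0 hM0.le hR hlam hum hA₀ hA
        hSc.isClosed.measurableSet hSR
      have hw := isSeparatedWeight_carlemanWeight i m (κ * M * R ^ (2 * m - 1)) M
        (M * γ * R ^ (2 * m - 2) / 40)
      set φ := carlemanWeight i m (κ * M * R ^ (2 * m - 1)) M (M * γ * R ^ (2 * m - 2) / 40)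
      have hwc : Continuous fun z : SpaceTime n =>
          M * profileDeriv₂ m (z.2 i) * Real.exp (φ z) ^ 2 :=
        hw.contDiff_b₂.continuous.mul (hw.contDiff.continuous.rexp.pow 2)
      set I := ∫ z in Metric.closedBall (0 : SpaceTime n) r, ‖u z‖ ^ 2
      have h1 : c₀ * Real.exp (-(c * R ^ (2 * m - 1))) * I ≤
          ∫ z in Metric.closedBall (0 : SpaceTime n) R,
            M * profileDeriv₂ m (z.2 i) * Real.exp (φ z) ^ 2 * ‖u z‖ ^ 2 := by
        calc _ = ∫ z in Metric.closedBall (0 : SpaceTime n) r,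
              c₀ * Real.exp (-(c * R ^ (2 * m - 1))) * ‖u z‖ ^ 2 := by
              rw [integral_const_mul]
          _ ≤ ∫ z in Metric.closedBall (0 : SpaceTime n) r,
              M * profileDeriv₂ m (z.2 i) * Real.exp (φ z) ^ 2 * ‖u z‖ ^ 2 := by
              refine setIntegral_mono_on (hint r _ continuous_const) (hint r _ hwc)
                Metric.isClosed_closedBall.measurableSet fun z hz => ?_
              exact mul_le_mul_of_nonneg_right (near_weight_lower_bound i hm hm' hγ hκ0.le hM0.le
                hR (mem_closedBall_zero_iff.1 hz)) (sq_nonneg _)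
          _ ≤ _ := by
              refine setIntegral_mono_set (hint R _ hwc) (ae_of_all _ fun z => ?_)
                (Metric.closedBall_subset_closedBall hrR).eventuallyLE
              have hp : 0 ≤ profileDeriv₂ m (z.2 i) :=
                le_trans (by rw [← hγ]; positivity) (profileDeriv₂_lower hm hm' (z.2 i))
              simp only [Pi.zero_apply]
              positivity
      have h2 := h1.trans (hS.trans (mul_le_mul_of_nonneg_left hfar hB))
      have h3 := mul_exp_le_div (a := 2 * M) (c := c) (b := b) hm hb0 hR (by
        rwa [div_le_iff₀ hb0, mul_comm] at hcR)
      have h4 : I ≤ B * (8 * A.toReal) / c₀ *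
          (R * Real.exp (2 * M + c * R ^ (2 * m - 1) - b * R ^ (2 * m))) := by
        have e : Real.exp (2 * M + c * R ^ (2 * m - 1) - b * R ^ (2 * m)) =
            Real.exp (2 * M - b * R ^ (2 * m)) * Real.exp (c * R ^ (2 * m - 1)) := by
          rw [← Real.exp_add]
          ring_nf
        rw [e]
        rw [Real.exp_neg] at h2
        have hX := Real.exp_pos (c * R ^ (2 * m - 1))
        generalize Real.exp (c * R ^ (2 * m - 1)) = X at h2 hX ⊢
        rw [← div_eq_mul_inv, div_mul_eq_mul_div, div_le_iff₀ hX] at h2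
        rw [div_mul_eq_mul_div, le_div_iff₀ hc₀0]
        linarith
      calc I ≤ _ := h4
        _ ≤ B * (8 * A.toReal) / c₀ * (2 * Real.exp (2 * M + c) / b ^ 2 * (1 / R)) := by gcongr
        _ = _ := by ring
    refine le_antisymm ?_ (integral_nonneg fun z => sq_nonneg _)
    have hlim : Tendsto (fun R : ℝ => B * (8 * A.toReal) / c₀ *
        (2 * Real.exp (2 * M + c) / b ^ 2) * (1 / R)) atTop (𝓝 0) := by
      have := tendsto_inv_atTop_zero.const_mul
        (B * (8 * A.toReal) / c₀ * (2 * Real.exp (2 * M + c) / b ^ 2))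
      rw [mul_zero] at this
      simpa only [one_div] using this
    refine ge_of_tendsto hlim ?_
    filter_upwards [eventually_ge_atTop 1, eventually_ge_atTop r, eventually_ge_atTop (c / b)]
      with R h1 h2 h3 using hle R h1 h2 h3
  have hall : ∀ᵐ z : SpaceTime n, ∀ k : ℕ, z ∈ Metric.closedBall (0 : SpaceTime n) k → u z = 0 := by
    refine ae_all_iff.2 fun k => ?_
    rw [← ae_restrict_iff' Metric.isClosed_closedBall.measurableSet]
    have h1 := (integral_eq_zero_iff_of_nonneg (fun z => sq_nonneg _)
      ((hu _ (isCompact_closedBall (0 : SpaceTime n) (k : ℝ))).integrable_norm_pow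
        two_ne_zero)).1 (hball k)
    filter_upwards [h1] with z hz
    simpa using hz
  filter_upwards [hall] with z hz
  obtain ⟨k, hk⟩ := exists_nat_ge ‖z‖
  exact hz k (mem_closedBall_zero_iff.2 hk)

end UniqueContinuation


/-! ### Reduction of the differential inequality and vanishing at every time -/

section Reduction

variable {n : ℕ}

/-- The weak partial derivatives of `u`, indexed by time (`none`) and the space coordinates. -/
def weakPartial (u : SpaceTime n → ℂ) (j : Option (Fin n)) : SpaceTime n → ℂ :=
  weakDeriv (coordDir n j) u

theorem weakSpaceTimeLaplacian_eq_sum (u : SpaceTime n → ℂ) (z : SpaceTime n) :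
    weakSpaceTimeLaplacian u z = ∑ j, weakPartial (weakPartial u j) j z := by
  rw [Fintype.sum_option]
  rfl

/-- Cauchy–Schwarz, which holds for the bilinear product because only absolute values enter. -/
theorem norm_firstOrderTerm_sq_le (W : SpaceTime n → CVec n) (u : SpaceTime n → ℂ)
    (z : SpaceTime n) :
    ‖firstOrderTerm W u z‖ ^ 2 ≤ ‖W z‖ ^ 2 * ∑ j, ‖weakPartial u j z‖ ^ 2 := by
  set a : Option (Fin n) → ℂ := fun j => j.elim (W z).fst (fun i => (W z).snd i) with ha
  have e1 : firstOrderTerm W u z = ∑ j, a j * weakPartial u j z := by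
    rw [Fintype.sum_option]
    rfl
  have e2 : ‖W z‖ ^ 2 = ∑ j, ‖a j‖ ^ 2 := by
    rw [Fintype.sum_option, WithLp.prod_norm_sq_eq_of_L2, EuclideanSpace.norm_sq_eq]
    rfl
  rw [e1, e2]
  calc ‖∑ j, a j * weakPartial u j z‖ ^ 2 ≤ (∑ j, ‖a j‖ * ‖weakPartial u j z‖) ^ 2 := by
        gcongr
        refine (norm_sum_le _ _).trans_eq ?_
        simp only [norm_mul]
    _ ≤ _ := Finset.sum_mul_sq_le_sq_mul_sq _ _ _

theorem sq_le_of_le_div_rpow {C a b x y q : ℝ} (hx : 0 ≤ x) (hb : 0 ≤ b) (hba : b ≤ a)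
    (hq : 0 ≤ q) (h : x ≤ C / (1 + a) ^ q) (hy : y = -(2 * q)) :
    x ^ 2 ≤ C ^ 2 * (1 + b) ^ y := by
  calc x ^ 2 ≤ (C / (1 + a) ^ q) ^ 2 := by gcongr
    _ = C ^ 2 * (1 + a) ^ y := by
        rw [div_pow, ← Real.rpow_mul_natCast (by linarith), hy, Real.rpow_neg (by linarith),
          div_eq_mul_inv]
        push_cast
        ring_nf
    _ ≤ C ^ 2 * (1 + b) ^ y := by
        have : (1 + a) ^ y ≤ (1 + b) ^ y :=
          Real.rpow_le_rpow_of_nonpos (by linarith) (by linarith) (by linarith)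
        gcongr

/-- The differential inequality in squared form, with coefficients decaying in one coordinate. -/
theorem norm_laplacian_sq_le (i : Fin n) {C α m : ℝ} (hα : 0 ≤ α) (hm : m = (2 - α) / 3)
    {V : SpaceTime n → ℂ} {W : SpaceTime n → CVec n} {u : SpaceTime n → ℂ} {z : SpaceTime n}
    (hV : ‖V z‖ ≤ C / (1 + ‖z.2‖ ^ 2) ^ (α / 2))
    (hW : ‖W z‖ ≤ C / (1 + ‖z.2‖ ^ 2) ^ ((1 + α) / 6))
    (h : ‖weakSpaceTimeLaplacian u z‖ ≤ ‖V z * u z‖ + ‖firstOrderTerm W u z‖) :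
    ‖∑ j, weakPartial (weakPartial u j) j z‖ ^ 2 ≤
      2 * C ^ 2 * ((1 + z.2 i ^ 2) ^ (3 * m - 2) * ‖u z‖ ^ 2
        + (1 + z.2 i ^ 2) ^ (m - 1) * ∑ j, ‖weakPartial u j z‖ ^ 2) := by
  rw [← weakSpaceTimeLaplacian_eq_sum]
  have hs : z.2 i ^ 2 ≤ ‖z.2‖ ^ 2 := by
    rw [← sq_abs]
    have := abs_coord_le_norm z i
    gcongr
  -- Here `3m - 2 = -α`, and below `m - 1 = -(1 + α) / 3`. Both are nonpositive, so decay in `|x|`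
  -- implies the same decay in a single coordinate.
  have hV2 : ‖V z‖ ^ 2 ≤ C ^ 2 * (1 + z.2 i ^ 2) ^ (3 * m - 2) :=
    sq_le_of_le_div_rpow (norm_nonneg _) (sq_nonneg _) hs (by positivity) hV (by rw [hm]; ring)
  have hW2 : ‖W z‖ ^ 2 ≤ C ^ 2 * (1 + z.2 i ^ 2) ^ (m - 1) :=
    sq_le_of_le_div_rpow (norm_nonneg _) (sq_nonneg _) hs (by positivity) hW (by rw [hm]; ring)
  have h1 : ‖V z * u z‖ ^ 2 ≤ C ^ 2 * (1 + z.2 i ^ 2) ^ (3 * m - 2) * ‖u z‖ ^ 2 := by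
    rw [norm_mul, mul_pow]
    gcongr
  have h2 : ‖firstOrderTerm W u z‖ ^ 2 ≤
      C ^ 2 * (1 + z.2 i ^ 2) ^ (m - 1) * ∑ j, ‖weakPartial u j z‖ ^ 2 :=
    (norm_firstOrderTerm_sq_le W u z).trans
      (mul_le_mul_of_nonneg_right hW2 (Finset.sum_nonneg fun j _ => sq_nonneg _))
  have h3 : ‖weakSpaceTimeLaplacian u z‖ ^ 2 ≤ (‖V z * u z‖ + ‖firstOrderTerm W u z‖) ^ 2 := by
    gcongr
  nlinarith [sq_nonneg (‖V z * u z‖ - ‖firstOrderTerm W u z‖)]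

/-- A curve in `H¹` that vanishes almost everywhere in space-time vanishes at every time. -/
theorem MemC1H1.ae_slice_eq_zero {u : SpaceTime n → ℂ} (hu : MemC1H1 u)
    (h : ∀ᵐ z : SpaceTime n, u z = 0) (t : ℝ) : ∀ᵐ x : Space n, u (t, x) = 0 := by
  obtain ⟨v, hv, hvu⟩ := hu
  have hcont : Continuous fun t => (v t).1.fst :=
    (WithLp.continuous_fst 2 _ _).comp (continuous_subtype_val.comp hv.continuous)
  have hae : ∀ᵐ s : ℝ, (v s).1.fst = 0 := by
    rw [Measure.volume_eq_prod] at h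
    filter_upwards [Measure.ae_ae_of_ae_prod h] with s hs
    rw [Lp.eq_zero_iff_ae_eq_zero]
    filter_upwards [hs, hvu s] with x h1 h2
    rw [← h2, h1, Pi.zero_apply]
  -- Two continuous curves that agree for almost every time agree for all times.
  have hall : (fun s => (v s).1.fst) = fun _ => 0 :=
    Continuous.ae_eq_iff_eq volume hcont continuous_const |>.1 hae
  have h0 : (v t).1.fst = 0 := congrFun hall t
  filter_upwards [hvu t, (Lp.eq_zero_iff_ae_eq_zero).1 h0] with x h1 h2
  rw [h1, h2, Pi.zero_apply]

end Reduction

end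

/-! ### Choice of the constants and conclusion -/

theorem theorem2 (n : ℕ) (hn : 1 ≤ n) (C : ℝ) (hC : 0 < C) (α : ℝ) (hα₀ : 0 ≤ α)
    (hα₁ : α < 1 / 2) :
    ∃ lam₀ : ℝ, ∀ (V : SpaceTime n → ℂ) (W : SpaceTime n → CVec n) (u : SpaceTime n → ℂ),
      MemLp V ⊤ volume →
      (∀ᵐ z : SpaceTime n, ‖V z‖ ≤ C / (1 + ‖z.2‖ ^ 2) ^ (α / 2)) →
      MemLp W ⊤ volume →
      (∀ᵐ z : SpaceTime n, ‖W z‖ ≤ C / (1 + ‖z.2‖ ^ 2) ^ ((1 + α) / 6)) →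
      MemC1H1 u →
      MemHLoc 2 u →
      (∀ᵐ z : SpaceTime n,
        ‖weakSpaceTimeLaplacian u z‖ ≤ ‖V z * u z‖ + ‖firstOrderTerm W u z‖) →
      (∃ lam : ℝ, lam₀ < lam ∧
        (⨆ t : ℝ, ∫⁻ x : Space n,
          ENNReal.ofReal (Real.exp (4 * lam * ‖x‖ ^ ((4 - 2 * α) / 3))) * ‖u (t, x)‖ₑ ^ 2) < ⊤) →
      ∀ t : ℝ, ∀ᵐ x : Space n, u (t, x) = 0 := by
  obtain ⟨m, hm⟩ : ∃ m : ℝ, m = (2 - α) / 3 := ⟨_, rfl⟩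
  obtain ⟨γ, hγ⟩ : ∃ γ : ℝ, γ = 2 * m * (2 * m - 1) := ⟨_, rfl⟩
  have hm₁ : 1 / 2 < m := by linarith
  have hm₂ : m ≤ 2 / 3 := by linarith
  have hγ0 : 0 < γ := by
    rw [hγ]
    exact mul_pos (by linarith) (by linarith)
  -- `M = 1 + 704 C² / γ` secures both `1 ≤ M` and the absorption condition `704 C² ≤ M γ`.
  refine ⟨decayThreshold m γ (1600 / γ) (1 + 704 * C ^ 2 / γ),
    fun V W u _ hV _ hW hu hu2 hpde => ?_⟩
  rintro ⟨lam, hlam, hdecay⟩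
  have hp : (4 - 2 * α) / 3 = 2 * m := by
    rw [hm]
    ring
  rw [hp] at hdecay
  refine hu.ae_slice_eq_zero ?_
  have hM : 1 ≤ 1 + 704 * C ^ 2 / γ := by
    have : 0 ≤ 704 * C ^ 2 / γ := by positivity
    linarith
  have hMC : 704 * C ^ 2 ≤ (1 + 704 * C ^ 2 / γ) * γ := by
    rw [add_mul, div_mul_cancel₀ _ hγ0.ne']
    linarith
  refine ae_eq_zero_of_decay ⟨0, hn⟩ hm₁ hm₂ hC hγ rfl hM hMC hlam.le hu2.memL2Loc
    (du := weakPartial u) (ddu := fun j => weakPartial (weakPartial u j) j)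
    (fun j => (hu2.weakDeriv _).memL2Loc) (fun j => ((hu2.weakDeriv _).weakDeriv _).memL2Loc)
    (fun j => hu2.isWeakDeriv _) (fun j => (hu2.weakDeriv _).isWeakDeriv _) ?_ hdecay.ne
    (fun t => le_iSup (fun t : ℝ => ∫⁻ x : Space n,
      ENNReal.ofReal (Real.exp (4 * lam * ‖x‖ ^ (2 * m))) * ‖u (t, x)‖ₑ ^ 2) t)
  filter_upwards [hV, hW, hpde] with z h1 h2 h3
  exact norm_laplacian_sq_le _ hα₀ hm h1 h2 h3
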